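/- Let $n\ge 0$, let $\omega:\mathbb R^n\to\mathbb R$, $G,K:\mathbb R^n\to\mathbb R^n$ and $f_0:\mathbb R^n\to\mathbb R$ be of class $C^\infty$, let $\omega\ge c$ for some constant $c>0$, and let the flow of $G$ be global and $2\pi$-periodic in time for every starting point. For $\varepsilon>0$ put $F^\varepsilon=\frac1\varepsilon\,\omega\,G+K$, and define, with $Y=(t,y)\in\mathbb R\times\mathbb R^n$, the augmented fields (independent of $t$) $$\check G=(0,G),\qquad \check K=\Big(\frac1\omega,\frac1\omega K\Big),\qquad \check F^\varepsilon=\frac1\varepsilon\check G+\check K=\frac1\omega\,(1,F^\varepsilon).$$ **Formal series.** A formal series $u^\varepsilon=\sum_{k\ge0}\varepsilon^k u_k$ has coefficients $u_k$ that are $C^\infty$ functions; identities between formal series mean equality of all coefficients. *Averaged fields* of $\check F^\varepsilon$ are two formal series $\check G^\varepsilon=(\check G_1^\varepsilon,\check G_2^\varepsilon)$ and $\check K^\varepsilon=(\check K_1^\varepsilon,\check K_2^\varepsilon)$ of fields $\mathbb R^n\to\mathbb R\times\mathbb R^n$ (functions of $y$ only, viewed as vector fields in $Y$) such that, in the sense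 of formal series, $\check F^\varepsilon=\frac1\varepsilon\check G^\varepsilon+\check K^\varepsilon$ with $\check G^\varepsilon=\check G+O(\varepsilon)$, the Lie bracket $[\check G^\varepsilon,\check K^\varepsilon]$ vanishes, and $\check G^\varepsilon$ generates a $2\pi$-periodic formal flow (the formal flow of $X^\varepsilon$ is the formal series $\varphi^\varepsilon_\tau(Y)$ with $\partial_\tau\varphi^\varepsilon_\tau=(D\varphi^\varepsilon_\tau)X^\varepsilon$, $\varphi_0^\varepsilon=\mathrm{id}$). **Theorem.** The averaged fields $\check G^\varepsilon,\check K^\varepsilon$ exist and are unique. Assume that $\check K_1^\varepsilon$ does not vanish (as a formal series: its leading coefficient $\check K_{1,0}$ has no zero) and that the leading coefficient $\check K_{2,0}/\check K_{1,0}$ of $\check K_2^\varepsilon/\check K_1^\varepsilon$ is a vector field with a global flow. Then: (i) The system, for all $(t,\tau,y)\in\mathbb R\times\mathbb R\times\mathbb R^n$, $$\check K_1^\varepsilon\,\partial_t h+\check K_2^\varepsilon\cdot\nabla_y h=0,\qquad \check K_1^\varepsilon\,\partial_\tau h+\big(\check K_1^\varepsilon\check G_2^\varepsilon-\check G_1^\varepsilon\check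 K_2^\varepsilon\big)\cdot\nabla_y h=0,\qquad h(0,0,y)=f_0(y),$$ has a unique solution $h=\sum_k\varepsilon^kh_k(t,\tau,y)$ among formal series, and $h$ is $2\pi$-periodic in $\tau$. (ii) The system $$\check K_1^\varepsilon\,\partial_t S+\check K_2^\varepsilon\cdot\nabla_y S=1,\qquad \check K_1^\varepsilon\,\partial_\tau S+\big(\check K_1^\varepsilon\check G_2^\varepsilon-\check G_1^\varepsilon\check K_2^\varepsilon\big)\cdot\nabla_y S=-\check G_1^\varepsilon,\qquad S(0,0,y)=0,$$ has a unique solution $S=\sum_k\varepsilon^kS_k(t,\tau,y)$ among formal series, and $S$ is $2\pi$-periodic in $\tau$. (iii) The solution $f$ of $\partial_tf+F^\varepsilon(y)\cdot\nabla_yf=0$, $f(0,\cdot)=f_0$, has the asymptotic expansion $f(t,y)=h(t,\tau(t,y),y)$, where $\tau(t,y)$ is defined implicitly by $\varepsilon\,\tau(t,y)=S(t,\tau(t,y),y)$. Precisely, for every $N\ge0$, with the relation $$(\ast)\qquad \varepsilon\tau=\sum_{k\le N}\varepsilon^kS_k(t,\tau,y):$$ for all $\varepsilon>0$ and all $(t,y)$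 there is a $\tau\in\mathbb R$ satisfying $(\ast)$; for every $y_0$ there are $r,\varepsilon_0>0$ such that, for $0<\varepsilon<\varepsilon_0$ and $|t|<r$, $|y-y_0|<r$, this $\tau$ is unique and is a $C^\infty$ function of $(t,y)$; and for every compact $C\subset\mathbb R\times\mathbb R^n$ there are $M$ and $\varepsilon_0>0$ such that, for all $0<\varepsilon<\varepsilon_0$, every classical (differentiable) solution $f$ on $\mathbb R\times\mathbb R^n$, all $(t,y)\in C$ and all $\tau$ satisfying $(\ast)$, $$\Big|f(t,y)-\sum_{k<N}\varepsilon^kh_k(t,\tau,y)\Big|\le M\varepsilon^N.$$ -/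

import Mathlib

open scoped ContDiff

noncomputable section

namespace HighOsc

/-- The phase space `ℝⁿ`. -/
abbrev Space (n : ℕ) : Type := EuclideanSpace ℝ (Fin n)

/-! ### Flows, transport equation, augmented fields -/

/-- `Φ` is the global flow of the vector field `X`: the map `τ ↦ Φ τ y` solves `ẋ = X x` on all of
`ℝ` and starts from `y`. -/
structure GeneratesFlow {V : Type*} [NormedAddCommGroup V] [NormedSpace ℝ V]
    (X : V → V) (Φ : ℝ → V → V) : Prop where
  init : ∀ y, Φ 0 y = y
  ode : ∀ τ y, HasDerivAt (fun s => Φ s y) (X (Φ τ y)) τ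

/-- The field `F^ε = w G / ε + K`. -/
def oscField {n : ℕ} (w : Space n → ℝ) (G K : Space n → Space n) (ε : ℝ) (y : Space n) : Space n :=
  (ε⁻¹ * w y) • G y + K y

/-- `f` is a classical solution on `ℝ × ℝⁿ` of `∂ₜ f + F · ∇_y f = 0`, `f(0, ·) = f₀`. -/
structure IsTransportSolution {n : ℕ} (F : Space n → Space n) (f₀ : Space n → ℝ)
    (f : ℝ → Space n → ℝ) : Prop where
  diff : Differentiable ℝ (fun p : ℝ × Space n => f p.1 p.2)
  eq : ∀ t y, deriv (fun s => f s y) t + fderiv ℝ (f t) y (F y) = 0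
  init : ∀ y, f 0 y = f₀ y

/-- The augmented field `Ǧ = (0, G)`, which is independent of `t`. -/
def augG {n : ℕ} (G : Space n → Space n) (y : Space n) : ℝ × Space n := (0, G y)

/-- The augmented field `Ǩ = (1/w, K/w)`, which is independent of `t`. -/
def augK {n : ℕ} (w : Space n → ℝ) (K : Space n → Space n) (y : Space n) : ℝ × Space n :=
  ((w y)⁻¹, (w y)⁻¹ • K y)

/-- A field depending on `y` only, seen as a vector field on the space of the `Y = (t, y)`. -/
def lift {n : ℕ} (X : Space n → ℝ × Space n) (Y : ℝ × Space n) : ℝ × Space n := X Y.2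

/-! ### Formal power series in `ε`

A formal series `∑ₖ εᵏ uₖ` is the sequence `k ↦ uₖ` of its coefficients. -/

/-- Cauchy product of a scalar series and a series with values in a vector space. -/
def mulSeries {W : Type*} [AddCommGroup W] [Module ℝ W] (a : ℕ → ℝ) (b : ℕ → W) (k : ℕ) : W :=
  ∑ p ∈ Finset.HasAntidiagonal.antidiagonal k, a p.1 • b p.2

/-- Cauchy product of a series of vectors `v` and a series of linear maps `L` (derivatives), by
evaluation; for `L = (D u₀, D u₁, …)` this is the series of `v · ∇ u`. -/
def applySeries {W Z : Type*} [NormedAddCommGroup W] [NormedSpace ℝ W] [NormedAddCommGroup Z]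
    [NormedSpace ℝ Z] (v : ℕ → W) (L : ℕ → W →L[ℝ] Z) (k : ℕ) : Z :=
  ∑ p ∈ Finset.HasAntidiagonal.antidiagonal k, L p.2 (v p.1)

/-- The formal series of vector fields `X`, `Z` commute: every coefficient of the series of their
Lie bracket vanishes. -/
def FormallyCommute {V : Type*} [NormedAddCommGroup V] [NormedSpace ℝ V] (X Z : ℕ → V → V) : Prop :=
  ∀ k Y, ∑ p ∈ Finset.HasAntidiagonal.antidiagonal k, VectorField.lieBracket ℝ (X p.1) (Z p.2) Y = 0

/-- `φ = ∑ₖ εᵏ φₖ` is the formal flow of the formal vector field `X = ∑ₖ εᵏ Xₖ`, that is,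
`φ_τ = exp(τ L_X) id`: it satisfies `∂_τ φ_τ = (D φ_τ) X` and `φ_0 = id`. (For a single field, this
linear equation characterises its flow, and unlike `∂_τ φ_τ = X ∘ φ_τ` it needs no
composition of formal series.) -/
structure IsFormalFlow {V : Type*} [NormedAddCommGroup V] [NormedSpace ℝ V]
    (X : ℕ → V → V) (φ : ℕ → ℝ → V → V) : Prop where
  smooth : ∀ k, ContDiff ℝ ∞ (fun p : ℝ × V => φ k p.1 p.2)
  init_zero : ∀ Y, φ 0 0 Y = Y
  init_succ : ∀ k Y, φ (k + 1) 0 Y = 0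
  eq : ∀ k τ Y, deriv (fun s => φ k s Y) τ =
    applySeries (fun i => X i Y) (fun j => fderiv ℝ (φ j τ) Y) k

/-- `Gε = ∑ₖ εᵏ Gεₖ` and `Kε = ∑ₖ εᵏ Kεₖ` are the averaged fields (normal form) of the augmented
field `F̌^ε = Ǧ/ε + Ǩ`: one has `F̌^ε = Gε/ε + Kε`, the fields `Gε`, `Kε` commute, and `Gε`
generates a `2π`-periodic flow, all in the sense of formal series in `ε`. -/
structure IsNormalForm {n : ℕ} (w : Space n → ℝ) (G K : Space n → Space n)
    (Gε Kε : ℕ → Space n → ℝ × Space n) : Prop where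
  smooth_G : ∀ k, ContDiff ℝ ∞ (Gε k)
  smooth_K : ∀ k, ContDiff ℝ ∞ (Kε k)
  split_zero : ∀ y, Gε 0 y = augG G y
  split_one : ∀ y, Gε 1 y + Kε 0 y = augK w K y
  split_succ : ∀ k y, Gε (k + 2) y + Kε (k + 1) y = 0
  commute : FormallyCommute (fun i => lift (Gε i)) (fun i => lift (Kε i))
  periodic : ∃ φ : ℕ → ℝ → ℝ × Space n → ℝ × Space n,
    IsFormalFlow (fun i => lift (Gε i)) φ ∧ ∀ k τ Y, φ k (τ + 2 * Real.pi) Y = φ k τ Y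

/-! ### The two systems

Unknowns are formal series `u = ∑ₖ εᵏ uₖ` of smooth functions of `(t, τ, y)`. -/

/-- All coefficients are smooth functions of `(t, τ, y)`. -/
def SmoothSeries {n : ℕ} (u : ℕ → ℝ → ℝ → Space n → ℝ) : Prop :=
  ∀ k, ContDiff ℝ ∞ (fun p : ℝ × ℝ × Space n => u k p.1 p.2.1 p.2.2)

/-- All coefficients are `2π`-periodic in `τ`. -/
def PeriodicSeries {n : ℕ} (u : ℕ → ℝ → ℝ → Space n → ℝ) : Prop :=
  ∀ k t τ y, u k t (τ + 2 * Real.pi) y = u k t τ y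

/-- The series of `Kε₁ ∂ₜ u + Kε₂ · ∇_y u` at `(t, τ, y)`. -/
def tOperator {n : ℕ} (Kε : ℕ → Space n → ℝ × Space n) (u : ℕ → ℝ → ℝ → Space n → ℝ)
    (t τ : ℝ) (y : Space n) (k : ℕ) : ℝ :=
  mulSeries (fun i => (Kε i y).1) (fun j => deriv (fun s => u j s τ y) t) k +
    applySeries (fun i => (Kε i y).2) (fun j => fderiv ℝ (u j t τ) y) k

/-- The series of the vector `Kε₁ Gε₂ - Gε₁ Kε₂` at `y`. -/
def crossField {n : ℕ} (Gε Kε : ℕ → Space n → ℝ × Space n) (y : Space n) (k : ℕ) : Space n :=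
  mulSeries (fun i => (Kε i y).1) (fun j => (Gε j y).2) k -
    mulSeries (fun i => (Gε i y).1) (fun j => (Kε j y).2) k

/-- The series of `Kε₁ ∂_τ u + (Kε₁ Gε₂ - Gε₁ Kε₂) · ∇_y u` at `(t, τ, y)`. -/
def tauOperator {n : ℕ} (Gε Kε : ℕ → Space n → ℝ × Space n) (u : ℕ → ℝ → ℝ → Space n → ℝ)
    (t τ : ℝ) (y : Space n) (k : ℕ) : ℝ :=
  mulSeries (fun i => (Kε i y).1) (fun j => deriv (fun s => u j t s y) τ) k +
    applySeries (crossField Gε Kε y) (fun j => fderiv ℝ (u j t τ) y) k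

/-- `h` solves the system for the profile, with `h(0, 0, ·) = f₀`. -/
structure IsProfile {n : ℕ} (Gε Kε : ℕ → Space n → ℝ × Space n) (f₀ : Space n → ℝ)
    (h : ℕ → ℝ → ℝ → Space n → ℝ) : Prop where
  smooth : SmoothSeries h
  eq_t : ∀ t τ y k, tOperator Kε h t τ y k = 0
  eq_tau : ∀ t τ y k, tauOperator Gε Kε h t τ y k = 0
  init_zero : ∀ y, h 0 0 0 y = f₀ y
  init_succ : ∀ k y, h (k + 1) 0 0 y = 0

/-- `S` solves the system for the phase, with `S(0, 0, ·) = 0`. -/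
structure IsPhase {n : ℕ} (Gε Kε : ℕ → Space n → ℝ × Space n)
    (S : ℕ → ℝ → ℝ → Space n → ℝ) : Prop where
  smooth : SmoothSeries S
  eq_t : ∀ t τ y k, tOperator Kε S t τ y k = if k = 0 then 1 else 0
  eq_tau : ∀ t τ y k, tauOperator Gε Kε S t τ y k = -(Gε k y).1
  init : ∀ k y, S k 0 0 y = 0

/-- The partial sum `∑_{k < m} εᵏ uₖ(t, τ, y)`. -/
def partialSum {n : ℕ} (u : ℕ → ℝ → ℝ → Space n → ℝ) (m : ℕ) (ε t τ : ℝ) (y : Space n) : ℝ :=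
  ∑ k ∈ Finset.range m, ε ^ k * u k t τ y

/-- The relation `ε τ = S(t, τ, y)` with the series `S` cut after the term of order `N`. -/
def PhaseRelation {n : ℕ} (S : ℕ → ℝ → ℝ → Space n → ℝ) (N : ℕ) (ε t τ : ℝ) (y : Space n) : Prop :=
  ε * τ = partialSum S (N + 1) ε t τ y

/-- The relation `ε τ = S(t, τ, y)` defines `τ` as a function of `(t, y)`: at every order it has
solutions for all `(t, y)`, and, for `(t, y)` near `(0, y₀)` (uniformly in small `ε`), exactly one,
which depends smoothly on `(t, y)`. -/
def PhaseSolvable {n : ℕ} (S : ℕ → ℝ → ℝ → Space n → ℝ) : Prop :=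
  ∀ N : ℕ,
    (∀ ε > 0, ∀ t y, ∃ τ, PhaseRelation S N ε t τ y) ∧
    ∀ y₀ : Space n, ∃ r > 0, ∃ ε₀ > 0, ∀ ε ∈ Set.Ioo 0 ε₀, ∃ T : ℝ × Space n → ℝ,
      ContDiffOn ℝ ∞ T (Metric.ball (0, y₀) r) ∧
      ∀ p ∈ Metric.ball ((0 : ℝ), y₀) r, ∀ τ : ℝ, PhaseRelation S N ε p.1 τ p.2 ↔ τ = T p

/-- `h(t, τ(t, y), y)`, with `ε τ(t, y) = S(t, τ(t, y), y)`, is the asymptotic expansion as `ε → 0`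
of the solution of `∂ₜ f + F^ε · ∇_y f = 0`, `f(0, ·) = f₀`: at every order `N`, locally uniformly
in `(t, y)`, and for every solution `τ` of the relation. -/
def RecoversSolution {n : ℕ} (w : Space n → ℝ) (G K : Space n → Space n) (f₀ : Space n → ℝ)
    (h S : ℕ → ℝ → ℝ → Space n → ℝ) : Prop :=
  ∀ N : ℕ, ∀ C : Set (ℝ × Space n), IsCompact C → ∃ M : ℝ, ∃ ε₀ > 0, ∀ ε ∈ Set.Ioo 0 ε₀,
    ∀ f : ℝ → Space n → ℝ, IsTransportSolution (oscField w G K ε) f₀ f →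
      ∀ p ∈ C, ∀ τ : ℝ, PhaseRelation S N ε p.1 τ p.2 →
        |f p.1 p.2 - partialSum h N ε p.1 τ p.2| ≤ M * ε ^ N

end HighOsc

end

/-! The averaged fields come from a logarithm. Let X = Ǧ + εǨ, and let exp(τ L_X) be its formal
evolution on functions. At order zero this is composition with the flow of Ǧ, which has period 2π,
so exp(2π L_X) is the identity at order zero. It therefore has a unique logarithm: a field L = O(ε)
with exp(2π L_L) = exp(2π L_X) (`evol_logField`, `eq_of_evol_eq`). A field commuting with X commutes
with this evolution, hence with L (`formallyCommute_logField`). In particular [X, L] = 0, so X - L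
has trivial evolution over 2π, and G^ε = X - L, εK^ε = L are averaged fields. Conversely, any
splitting into averaged fields gives exp(2π L_X) = exp(2π L_{εK^ε}), so εK^ε is the logarithm
(`evol_eq_of_split`). Evolutions are multiplicative, so by Hadamard's lemma it is enough to know
them on linear functions (`evol_eq_evol`).

Divided by K₁, both systems read ∂ₜu + a·∇u = σ/K₁ and ∂_τ u + b·∇u = -σG₁/K₁, with a = K₂/K₁, b =
G₂ - G₁a, and σ = 0 for h, σ = 1 for S. From [G^ε, K^ε] = 0 it follows that a and b commute and that
the right-hand sides are compatible (`formallyCommute_quotient`, `IsNormalForm.compatible`). The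
problem is thus integrable in the sense of Frobenius, and it is solved order by order along the
global flows of the leading fields (`exists_twoTime`). Recombining the equations gives ∂_τ u +
G^ε·∇u = 0 in the variables (t, y), hence periodicity in τ.

Adding ε times the t-equation brings the original field back: ∂ₜu + (ω/ε)∂_τ u + F^ε·∇u = σω. Along
the curves t' = 1, τ' = ω/ε, y' = F^ε, the quantities f, h and S - ετ are all constant. If ετ = S at
the starting point, the curve reaches t = 0 at some (0, τ', y') with ετ' = S(0, τ', y'). For small ε
this forces τ' = 0, so f and h both equal f₀(y'). Truncating the series turns these identities into
estimates (`recoversSolution`).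

Two facts make the estimates work. First, S₀ does not depend on τ, and at t = 0 the function 1 - ∂_τ
S₁ equals 1/(ωK₁,₀) along an orbit of G; it has no zero and takes the value 1, so it is positive
(`IsSystemSol.phase_one_pos`). Second, let Φ and Ψ be the flows of G and K₂,₀/K₁,₀. Profiles with
the coordinates as initial data show that Φ_{-τ}Ψ_{-t}y moves only by O(ε) along the curves, which
keeps them in a compact set (`exists_confined_characteristic`). -/

noncomputable section

namespace HighOsc

open Set Filter Topology MeasureTheory

/-! ### The composition operator on continuous curves -/

section Composition

variable {E F : Type} [NormedAddCommGroup E] [NormedSpace ℝ E] [NormedAddCommGroup F]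
  [NormedSpace ℝ F]

lemma contDiff_of_eq {f g : E → F} {m : WithTop ℕ∞} (hf : ContDiff ℝ m f) (h : ∀ x, g x = f x) :
    ContDiff ℝ m g := (funext h : g = f) ▸ hf

/-- The superposition operator `γ ↦ X ∘ γ` on curves `[0, 1] → E`. -/
def superpose (X : C(E, F)) (γ : C(unitInterval, E)) : C(unitInterval, F) := X.comp γ

/-- Pointwise application of a curve of linear maps to a curve of vectors. -/
def pointwiseApply :
    C(unitInterval, E →L[ℝ] F) →L[ℝ] C(unitInterval, E) →L[ℝ] C(unitInterval, F) :=
  LinearMap.mkContinuous₂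
    (LinearMap.mk₂ ℝ (fun (A : C(unitInterval, E →L[ℝ] F)) (γ : C(unitInterval, E)) =>
      (⟨fun s => A s (γ s), by fun_prop⟩ : C(unitInterval, F)))
      (fun _ _ _ => by ext; simp) (fun _ _ _ => by ext; simp)
      (fun _ _ _ => by ext; simp) (fun _ _ _ => by ext; simp)) 1 (by
    intro A γ
    rw [one_mul]
    refine (ContinuousMap.norm_le _ (by positivity)).2 fun s => ?_
    refine ((A s).le_opNorm _).trans ?_
    gcongr
    exacts [A.norm_coe_le_norm s, γ.norm_coe_le_norm s])

@[simp] lemma pointwiseApply_apply (A : C(unitInterval, E →L[ℝ] F)) (γ : C(unitInterval, E))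
    (s : unitInterval) : pointwiseApply A γ s = A s (γ s) := rfl

/-- Continuity of γ ↦ X' ∘ γ in the sup norm controls X' on all the segments from γ(s) to γ(s) +
δ(s) at once. The mean value inequality then bounds the remainder uniformly in s. -/
lemma hasFDerivAt_superpose (X : C(E, F)) (X' : C(E, E →L[ℝ] F))
    (h : ∀ x, HasFDerivAt X (X' x) x) (γ : C(unitInterval, E)) :
    HasFDerivAt (superpose X) (pointwiseApply (superpose X' γ)) γ := by
  rw [hasFDerivAt_iff_isLittleO_nhds_zero, Asymptotics.isLittleO_iff]
  intro c hc
  have hcont : Continuous (superpose X' : C(unitInterval, E) → _) :=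
    ContinuousMap.continuous_postcomp X'
  obtain ⟨d, hd, hball⟩ := Metric.continuousAt_iff.1 (hcont.continuousAt (x := γ)) c hc
  filter_upwards [Metric.ball_mem_nhds 0 hd] with δ hδ
  rw [mem_ball_zero_iff] at hδ
  rw [ContinuousMap.norm_le _ (by positivity)]
  intro s
  have key : ‖X (γ s + δ s) - X (γ s) - X' (γ s) (γ s + δ s - γ s)‖
      ≤ c * ‖γ s + δ s - γ s‖ := by
    refine (convex_segment (γ s) (γ s + δ s)).norm_image_sub_le_of_norm_hasFDerivWithin_le'
      (fun x _ => (h x).hasFDerivWithinAt) ?_ (left_mem_segment ..) (right_mem_segment ..)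
    intro x hx
    rw [segment_eq_image'] at hx
    obtain ⟨θ, hθ, rfl⟩ := hx
    have h1 : dist (γ + θ • δ) γ < d := by
      rw [dist_eq_norm, add_sub_cancel_left, norm_smul, Real.norm_eq_abs, abs_of_nonneg hθ.1]
      exact (mul_le_of_le_one_left (norm_nonneg _) hθ.2).trans_lt hδ
    have h2 := (ContinuousMap.dist_apply_le_dist (f := superpose X' (γ + θ • δ))
      (g := superpose X' γ) s).trans (hball h1).le
    rw [dist_eq_norm] at h2
    simpa [superpose] using h2
  simp only [add_sub_cancel_left] at key
  exact key.trans (mul_le_mul_of_nonneg_left (δ.norm_coe_le_norm s) hc.le)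

/-- The derivative is pointwise multiplication by the superposition with X', so each degree of
smoothness follows from the previous one. The target space varies in the induction because X' takes
values in linear maps. -/
lemma contDiff_superpose_nat (m : ℕ) : ∀ {F : Type} [NormedAddCommGroup F] [NormedSpace ℝ F]
    (X : C(E, F)), ContDiff ℝ ∞ X → ContDiff ℝ m (superpose X) := by
  induction m with
  | zero => intro F _ _ X _
            exact contDiff_zero.2 (ContinuousMap.continuous_postcomp X)
  | succ m ih =>
    intro F _ _ X hX
    have hX' : ContDiff ℝ ∞ (fderiv ℝ X) := hX.fderiv_right (by simp)
    have h := hasFDerivAt_superpose X ⟨fderiv ℝ X, hX'.continuous⟩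
      (fun x => (hX.differentiable (by simp) x).hasFDerivAt)
    exact_mod_cast contDiff_succ_iff_hasFDerivAt.2
      ⟨_, pointwiseApply.contDiff.comp (ih ⟨fderiv ℝ X, hX'.continuous⟩ hX'), h⟩

lemma contDiff_superpose (X : C(E, F)) (hX : ContDiff ℝ ∞ X) : ContDiff ℝ ∞ (superpose X) :=
  contDiff_infty.2 fun m => contDiff_superpose_nat m X hX

end Composition

/-! ### Primitives and parametric integrals -/

section Primitive

variable {E F : Type} [NormedAddCommGroup E] [NormedSpace ℝ E] [NormedAddCommGroup F]
  [NormedSpace ℝ F] [CompleteSpace F]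

omit [NormedSpace ℝ F] [CompleteSpace F] in
lemma continuous_comp_projIcc (γ : C(unitInterval, F)) :
    Continuous fun r : ℝ => γ (projIcc 0 1 zero_le_one r) :=
  γ.continuous.comp continuous_projIcc

omit [CompleteSpace F] in
lemma norm_integral_comp_projIcc_le (γ : C(unitInterval, F)) (s : unitInterval) :
    ‖∫ r in (0 : ℝ)..s, γ (projIcc 0 1 zero_le_one r)‖ ≤ ‖γ‖ := by
  refine (intervalIntegral.norm_integral_le_of_norm_le_const
    (fun r _ => γ.norm_coe_le_norm (projIcc 0 1 zero_le_one r))).trans ?_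
  rw [sub_zero, abs_of_nonneg s.2.1]
  exact mul_le_of_le_one_right (norm_nonneg _) s.2.2

/-- The primitive vanishing at `0` of a curve on `[0, 1]`. -/
def primitive : C(unitInterval, F) →L[ℝ] C(unitInterval, F) :=
  LinearMap.mkContinuous
    { toFun := fun γ => ⟨fun s => ∫ r in (0 : ℝ)..s, γ (projIcc 0 1 zero_le_one r),
        (intervalIntegral.continuous_primitive
          (fun a b => (continuous_comp_projIcc γ).intervalIntegrable a b) 0).comp
          continuous_subtype_val⟩
      map_add' := fun γ δ => by
        ext s
        exact intervalIntegral.integral_add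
          ((continuous_comp_projIcc γ).intervalIntegrable _ _)
          ((continuous_comp_projIcc δ).intervalIntegrable _ _)
      map_smul' := fun c γ => by
        ext s
        exact intervalIntegral.integral_smul c _ } 1 (by
    intro γ
    rw [one_mul, ContinuousMap.norm_le _ (norm_nonneg _)]
    exact norm_integral_comp_projIcc_le γ)

lemma primitive_apply (γ : C(unitInterval, F)) (s : unitInterval) :
    primitive γ s = ∫ r in (0 : ℝ)..s, γ (projIcc 0 1 zero_le_one r) := rfl

omit [CompleteSpace F] in
lemma contDiff_curve (g : E × ℝ → F) (hg : ContDiff ℝ ∞ g) :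
    ContDiff ℝ ∞ (fun p => (⟨fun s : unitInterval => g (p, s),
      hg.continuous.comp (by fun_prop)⟩ : C(unitInterval, F))) := by
  have h : ContDiff ℝ ∞ (fun p : E => (ContinuousMap.const unitInterval ((p, 0) : E × ℝ)
      + ⟨fun s : unitInterval => (0, (s : ℝ)), by fun_prop⟩ : C(unitInterval, E × ℝ))) := by
    refine ContDiff.add ?_ contDiff_const
    exact (ContinuousLinearMap.contDiff (𝕜 := ℝ)
      ((ContinuousLinearMap.const ℝ unitInterval).comp (ContinuousLinearMap.inl ℝ E ℝ)))
  refine contDiff_of_eq ((contDiff_superpose ⟨g, hg.continuous⟩ hg).comp h) fun p => ?_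
  ext s
  simp [superpose]

/-- The integral is a continuous linear functional, the primitive evaluated at 1, of a curve
depending smoothly on p. No differentiation under the integral sign is needed. -/
lemma contDiff_integral_unit (g : E × ℝ → F) (hg : ContDiff ℝ ∞ g) :
    ContDiff ℝ ∞ (fun p => ∫ s in (0 : ℝ)..1, g (p, s)) := by
  refine contDiff_of_eq ((((ContinuousMap.evalCLM ℝ (1 : unitInterval)).comp
    (primitive (F := F))).contDiff (𝕜 := ℝ)).comp (contDiff_curve g hg)) fun p => ?_
  simp only [Function.comp, ContinuousLinearMap.comp_apply, ContinuousMap.evalCLM_apply,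
    primitive_apply]
  refine intervalIntegral.integral_congr fun s hs => ?_
  have hs' : s ∈ Icc (0 : ℝ) 1 := by simpa using hs
  simp [projIcc_of_mem zero_le_one hs']

/-- A primitive in time of a smooth function is smooth. -/
lemma contDiff_integral (q : ℝ × E → F) (hq : ContDiff ℝ ∞ q) :
    ContDiff ℝ ∞ (fun p : ℝ × E => ∫ s in (0 : ℝ)..p.1, q (s, p.2)) := by
  -- Rescaling to a fixed interval: ∫₀ᵗ q(s) ds = t ∫₀¹ q(ts) ds.
  have h := contDiff_integral_unit (fun x : (ℝ × E) × ℝ => q (x.1.1 * x.2, x.1.2))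
    (hq.comp (by fun_prop))
  refine contDiff_of_eq (contDiff_fst.smul h) fun p => ?_
  have := intervalIntegral.smul_integral_comp_mul_left (a := 0) (b := 1)
    (fun s => q (s, p.2)) p.1
  simpa using this.symm

end Primitive

/-! ### Smoothness of flows -/

section Flow

variable {E : Type} [NormedAddCommGroup E] [NormedSpace ℝ E]

/-- The unit 1 - x^m factors as 1 - x times a geometric sum that commutes with it. -/
lemma isUnit_one_sub_of_norm_pow_lt {R : Type*} [NormedRing R] [CompleteSpace R]
    (x : R) (m : ℕ) (h : ‖x ^ m‖ < 1) : IsUnit (1 - x) := by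
  have hu : IsUnit (1 - x ^ m) := isUnit_one_sub_of_norm_lt_one h
  have h1 : Commute (1 - x) (∑ i ∈ Finset.range m, x ^ i) := by
    rw [Commute, SemiconjBy, mul_neg_geom_sum, geom_sum_mul_neg]
  rw [← mul_neg_geom_sum x m, h1.isUnit_mul_iff] at hu
  exact hu.1

lemma norm_volterra_pow_apply_le [CompleteSpace E] (A : C(unitInterval, E →L[ℝ] E)) (m : ℕ)
    (γ : C(unitInterval, E)) (s : unitInterval) :
    ‖((primitive.comp (pointwiseApply A)) ^ m) γ s‖
      ≤ ‖A‖ ^ m * ‖γ‖ * ((s : ℝ) ^ m / m.factorial) := by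
  induction m generalizing s with
  | zero => simpa using γ.norm_coe_le_norm s
  | succ m ih =>
    rw [pow_succ', mul_apply_eq_comp, ContinuousLinearMap.comp_apply, primitive_apply]
    have h1 : ∀ r ∈ Ioc (0 : ℝ) s,
        ‖pointwiseApply A (((primitive.comp (pointwiseApply A)) ^ m) γ)
          (projIcc 0 1 zero_le_one r)‖ ≤ ‖A‖ ^ (m + 1) * ‖γ‖ * (r ^ m / m.factorial) := by
      intro r hr
      have hr' : r ∈ Icc (0 : ℝ) 1 := ⟨hr.1.le, hr.2.trans s.2.2⟩
      rw [projIcc_of_mem _ hr', pointwiseApply_apply]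
      refine ((A _).le_opNorm _).trans ?_
      refine (mul_le_mul (A.norm_coe_le_norm _) (ih ⟨r, hr'⟩) (norm_nonneg _)
        (norm_nonneg _)).trans (le_of_eq ?_)
      simp only
      ring
    refine (intervalIntegral.norm_integral_le_of_norm_le s.2.1 (Eventually.of_forall h1)
      (by apply Continuous.intervalIntegrable; fun_prop)).trans (le_of_eq ?_)
    rw [intervalIntegral.integral_const_mul, intervalIntegral.integral_div, integral_pow,
      Nat.factorial_succ]
    have : (m.factorial : ℝ) ≠ 0 := by positivity
    push_cast
    field_simp
    simp

/-- Iterating the Volterra operator gains a factorial, so some power has norm less than 1 however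
large A is. -/
lemma isUnit_one_sub_volterra [CompleteSpace E] (A : C(unitInterval, E →L[ℝ] E)) :
    IsUnit (1 - primitive.comp (pointwiseApply A)) := by
  have h := FloorSemiring.tendsto_pow_div_factorial_atTop ‖A‖
  obtain ⟨m, hm⟩ := (h.eventually (gt_mem_nhds zero_lt_one)).exists
  refine isUnit_one_sub_of_norm_pow_lt (R := C(unitInterval, E) →L[ℝ] C(unitInterval, E)) _ m
    (lt_of_le_of_lt ?_ hm)
  refine ContinuousLinearMap.opNorm_le_bound _ (by positivity) fun γ => ?_
  rw [ContinuousMap.norm_le _ (by positivity)]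
  intro s
  refine (norm_volterra_pow_apply_le A m γ s).trans ?_
  have h1 : (s : ℝ) ^ m ≤ 1 := pow_le_one₀ s.2.1 s.2.2
  calc ‖A‖ ^ m * ‖γ‖ * ((s : ℝ) ^ m / m.factorial) ≤ ‖A‖ ^ m * ‖γ‖ * (1 / m.factorial) := by gcongr
    _ = _ := by ring

/-- Uniqueness for an autonomous equation with smooth right-hand side. -/
lemma eqOn_of_hasDerivAt [FiniteDimensional ℝ E] {X : E → E} (hX : ContDiff ℝ ∞ X) {a b : ℝ}
    {f g : ℝ → E} (hf : ContinuousOn f (Icc a b)) (hg : ContinuousOn g (Icc a b))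
    (hf' : ∀ t ∈ Ico a b, HasDerivWithinAt f (X (f t)) (Ici t) t)
    (hg' : ∀ t ∈ Ico a b, HasDerivWithinAt g (X (g t)) (Ici t) t) (h : f a = g a) :
    EqOn f g (Icc a b) := by
  have hc : IsCompact (f '' Icc a b ∪ g '' Icc a b) :=
    (isCompact_Icc.image_of_continuousOn hf).union (isCompact_Icc.image_of_continuousOn hg)
  obtain ⟨R, hR⟩ := hc.isBounded.subset_closedBall 0
  have : ProperSpace E := FiniteDimensional.proper ℝ E
  obtain ⟨C, hC⟩ := (hX.contDiffOn (s := Metric.closedBall 0 R)).exists_lipschitzOnWith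
    (by simp) (convex_closedBall 0 R) (isCompact_closedBall 0 R)
  exact ODE_solution_unique_of_mem_Icc_right (v := fun _ => X)
    (s := fun _ => Metric.closedBall 0 R) (fun _ _ => hC) hf hf'
    (fun t ht => hR (Or.inl ⟨t, Ico_subset_Icc_self ht, rfl⟩)) hg hg'
    (fun t ht => hR (Or.inr ⟨t, Ico_subset_Icc_self ht, rfl⟩)) h

lemma GeneratesFlow.hasDerivAt_mul {X : E → E} {Φ : ℝ → E → E} (h : GeneratesFlow X Φ)
    (c s : ℝ) (y : E) : HasDerivAt (fun r => Φ (c * r) y) (c • X (Φ (c * s) y)) s := by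
  have := (h.ode (c * s) y).scomp s ((hasDerivAt_id s).const_mul c)
  simpa [Function.comp_def] using this

lemma GeneratesFlow.neg {X : E → E} {Φ : ℝ → E → E} (h : GeneratesFlow X Φ) :
    GeneratesFlow (fun y => -X y) (fun t y => Φ (-t) y) :=
  ⟨fun y => by simpa using h.init y, fun t y => by
    simpa using h.hasDerivAt_mul (-1) t y⟩

variable [FiniteDimensional ℝ E]

/-- Any integral curve on `[0, 1]` of `c X` follows the flow of `X`. -/
lemma GeneratesFlow.eq_of_hasDerivWithinAt {X : E → E} {Φ : ℝ → E → E} (h : GeneratesFlow X Φ)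
    (hX : ContDiff ℝ ∞ X) {c : ℝ} {f : ℝ → E} (hf : ContinuousOn f (Icc 0 1))
    (hf' : ∀ t ∈ Ico (0 : ℝ) 1, HasDerivWithinAt f (c • X (f t)) (Ici t) t) :
    ∀ s ∈ Icc (0 : ℝ) 1, f s = Φ (c * s) (f 0) := by
  refine eqOn_of_hasDerivAt (X := fun y => c • X y) (contDiff_const.smul hX) hf
    (g := fun s => Φ (c * s) (f 0)) ?_ hf' ?_ (by simp [h.init])
  · exact fun t _ => (h.hasDerivAt_mul c t (f 0)).continuousAt.continuousWithinAt
  · exact fun t _ => (h.hasDerivAt_mul c t (f 0)).hasDerivWithinAt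

lemma GeneratesFlow.eq_apply {X : E → E} {Φ : ℝ → E → E} (h : GeneratesFlow X Φ)
    (hX : ContDiff ℝ ∞ X) {f : ℝ → E} (hf : ∀ t, HasDerivAt f (X (f t)) t) (t : ℝ) :
    f t = Φ t (f 0) := by
  have hd : ∀ s, HasDerivAt (fun s => f (t * s)) (t • X (f (t * s))) s := fun s => by
    have := (hf (t * s)).scomp s ((hasDerivAt_id s).const_mul t)
    simpa [Function.comp_def] using this
  have := h.eq_of_hasDerivWithinAt hX (c := t) (f := fun s => f (t * s))
    (fun s _ => (hd s).continuousAt.continuousWithinAt)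
    (fun s _ => (hd s).hasDerivWithinAt) 1 (by simp)
  simpa using this

lemma GeneratesFlow.apply_add {X : E → E} {Φ : ℝ → E → E} (h : GeneratesFlow X Φ)
    (hX : ContDiff ℝ ∞ X) (s t : ℝ) (y : E) : Φ (s + t) y = Φ s (Φ t y) := by
  have hd : ∀ r, HasDerivAt (fun r => Φ (r + t) y) (X (Φ (r + t) y)) r := fun r =>
    (h.ode (r + t) y).comp_add_const r t
  simpa using h.eq_apply hX hd s

lemma GeneratesFlow.apply_neg_apply {X : E → E} {Φ : ℝ → E → E} (h : GeneratesFlow X Φ)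
    (hX : ContDiff ℝ ∞ X) (t : ℝ) (y : E) : Φ (-t) (Φ t y) = y := by
  rw [← h.apply_add hX, neg_add_cancel, h.init]

lemma GeneratesFlow.apply_apply_neg {X : E → E} {Φ : ℝ → E → E} (h : GeneratesFlow X Φ)
    (hX : ContDiff ℝ ∞ X) (t : ℝ) (y : E) : Φ t (Φ (-t) y) = y := by
  rw [← h.apply_add hX, add_neg_cancel, h.init]

/-- The defect `γ - y - t ∫ X(γ)` of the integral equation for `γ' = t X(γ)`, `γ(0) = y`. -/
def picardDefect (X : C(E, E)) (p : (ℝ × E) × C(unitInterval, E)) : C(unitInterval, E) :=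
  p.2 - ContinuousMap.const unitInterval p.1.2 - p.1.1 • primitive (superpose X p.2)

lemma contDiff_picardDefect (X : C(E, E)) (hX : ContDiff ℝ ∞ X) :
    ContDiff ℝ ∞ (picardDefect X) := by
  refine (contDiff_snd.sub ?_).sub ?_
  · exact ((ContinuousLinearMap.const ℝ unitInterval : E →L[ℝ] C(unitInterval, E)).contDiff.comp
      (contDiff_snd.comp contDiff_fst))
  · exact (contDiff_fst.comp contDiff_fst).smul
      (primitive.contDiff.comp ((contDiff_superpose X hX).comp contDiff_snd))

/-- The partial derivative in γ is the identity minus a Volterra operator. This is what the implicit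
function theorem needs for smooth dependence on (t, y). -/
lemma isInvertible_fderiv_picardDefect (X : C(E, E)) (hX : ContDiff ℝ ∞ X)
    (p : (ℝ × E) × C(unitInterval, E)) :
    (fderiv ℝ (picardDefect X) p ∘L
      ContinuousLinearMap.inr ℝ (ℝ × E) C(unitInterval, E)).IsInvertible := by
  have hX' : ContDiff ℝ ∞ (fderiv ℝ X) := hX.fderiv_right (by simp)
  set A : C(unitInterval, E →L[ℝ] E) := superpose ⟨fderiv ℝ X, hX'.continuous⟩ p.2
  have h0 := hasFDerivAt_superpose X ⟨fderiv ℝ X, hX'.continuous⟩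
    (fun x => (hX.differentiable (by simp) x).hasFDerivAt) p.2
  have h1 : HasFDerivAt (fun γ => picardDefect X (p.1, γ))
      (1 - primitive.comp (pointwiseApply (p.1.1 • A))) p.2 := by
    have := ((hasFDerivAt_id p.2).sub_const (ContinuousMap.const unitInterval p.1.2)).sub
      ((primitive.hasFDerivAt.comp p.2 h0).const_smul p.1.1)
    refine this.congr_fderiv ?_
    ext γ s
    simp [A]
  have h2 : HasFDerivAt (fun γ => picardDefect X (p.1, γ)) (fderiv ℝ (picardDefect X) p ∘L
      ContinuousLinearMap.inr ℝ (ℝ × E) C(unitInterval, E)) p.2 :=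
    HasFDerivAt.comp p.2 (g := picardDefect X) (f := fun γ => (p.1, γ))
      ((contDiff_picardDefect X hX).differentiable (by simp) p).hasFDerivAt
      (hasFDerivAt_prodMk_right p.1 p.2)
  rw [h2.unique h1]
  obtain ⟨u, hu⟩ := isUnit_one_sub_volterra (p.1.1 • A)
  rw [← hu]
  exact ⟨ContinuousLinearEquiv.ofUnit u, rfl⟩

lemma picardDefect_flow (X : C(E, E)) {Φ : ℝ → E → E}
    (h : GeneratesFlow X Φ) (t : ℝ) (y : E) :
    picardDefect X ((t, y), ⟨fun s : unitInterval => Φ (t * s) y,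
      (continuous_iff_continuousAt.2 fun s => (h.hasDerivAt_mul t s y).continuousAt).comp
        continuous_subtype_val⟩) = 0 := by
  ext s
  have hcont : Continuous fun s => Φ (t * s) y :=
    continuous_iff_continuousAt.2 fun s => (h.hasDerivAt_mul t s y).continuousAt
  have hint : ∫ r in (0 : ℝ)..s, t • X (Φ (t * r) y) = Φ (t * s) y - Φ (t * 0) y :=
    intervalIntegral.integral_eq_sub_of_hasDerivAt (fun r _ => h.hasDerivAt_mul t r y)
      ((continuous_const.smul (X.continuous.comp hcont)).intervalIntegrable _ _)
  rw [intervalIntegral.integral_smul, mul_zero, h.init] at hint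
  have hcongr : ∫ r in (0 : ℝ)..s, X (Φ (t * (projIcc 0 1 zero_le_one r : unitInterval)) y)
      = ∫ r in (0 : ℝ)..s, X (Φ (t * r) y) := by
    refine intervalIntegral.integral_congr fun r hr => ?_
    rw [uIcc_of_le s.2.1] at hr
    have hr' : r ∈ Icc (0 : ℝ) 1 := ⟨hr.1, hr.2.trans s.2.2⟩
    simp [projIcc_of_mem _ hr']
  simp [picardDefect, primitive_apply, superpose, hcongr, hint]

lemma eq_flow_of_picardDefect_eq_zero (X : C(E, E)) (hX : ContDiff ℝ ∞ X) {Φ : ℝ → E → E}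
    (h : GeneratesFlow X Φ) (t : ℝ) (y : E) (γ : C(unitInterval, E))
    (hγ : picardDefect X ((t, y), γ) = 0) : γ 1 = Φ t y := by
  have hcont : Continuous fun r : ℝ => X (γ (projIcc 0 1 zero_le_one r)) :=
    X.continuous.comp (continuous_comp_projIcc γ)
  -- The right-hand side of the integral equation makes sense on all of ℝ. It agrees with γ on [0,
  -- 1] and has a two-sided derivative there, including at the end points.
  set f : ℝ → E := fun s => y + t • ∫ r in (0 : ℝ)..s, X (γ (projIcc 0 1 zero_le_one r)) with hf
  have hfγ : ∀ s (hs : s ∈ Icc (0 : ℝ) 1), f s = γ ⟨s, hs⟩ := by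
    intro s hs
    have := congrArg (fun δ : C(unitInterval, E) => δ ⟨s, hs⟩) hγ
    simp only [picardDefect, ContinuousMap.sub_apply, ContinuousMap.const_apply,
      ContinuousMap.smul_apply, primitive_apply, superpose, ContinuousMap.comp_apply,
      ContinuousMap.zero_apply] at this
    rw [sub_eq_zero, sub_eq_iff_eq_add'] at this
    exact this.symm
  have hd : ∀ s ∈ Icc (0 : ℝ) 1, HasDerivAt f (t • X (f s)) s := by
    intro s hs
    have h1 := ((intervalIntegral.integral_hasDerivAt_right (hcont.intervalIntegrable 0 s)
      (hcont.stronglyMeasurableAtFilter _ _) hcont.continuousAt).const_smul t).const_add y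
    rw [hfγ s hs, ← projIcc_of_mem zero_le_one hs]
    exact h1
  have := h.eq_of_hasDerivWithinAt hX (c := t) (f := f)
    (fun s hs => (hd s hs).continuousAt.continuousWithinAt)
    (fun s hs => (hd s (Ico_subset_Icc_self hs)).hasDerivWithinAt) 1 (by simp)
  rw [hfγ 1 (by simp)] at this
  have h0 : f 0 = y := by simp [hf]
  rw [h0, mul_one] at this
  exact this

/-- The flow of a smooth vector field is smooth in time and initial value. -/
theorem GeneratesFlow.contDiff {X : E → E} {Φ : ℝ → E → E} (h : GeneratesFlow X Φ)
    (hX : ContDiff ℝ ∞ X) : ContDiff ℝ ∞ (fun p : ℝ × E => Φ p.1 p.2) := by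
  set Xc : C(E, E) := ⟨X, hX.continuous⟩ with hXc
  have h' : GeneratesFlow Xc Φ := h
  rw [contDiff_iff_contDiffAt]
  rintro ⟨t, y⟩
  set γ : C(unitInterval, E) := ⟨fun s : unitInterval => Φ (t * s) y,
      (continuous_iff_continuousAt.2 fun s => (h.hasDerivAt_mul t s y).continuousAt).comp
        continuous_subtype_val⟩
  have hsm : ContDiffAt ℝ ∞ (picardDefect Xc) ((t, y), γ) :=
    (contDiff_picardDefect Xc hX).contDiffAt
  have hinv := isInvertible_fderiv_picardDefect Xc hX ((t, y), γ)
  have h1 := hsm.contDiffAt_implicitFunction (by simp) hinv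
  have h2 := hsm.eventually_apply_implicitFunction (by simp) hinv
  have h3 := (ContinuousMap.evalCLM ℝ (1 : unitInterval) :
    C(unitInterval, E) →L[ℝ] E).contDiff.contDiffAt.comp (t, y) h1
  -- The implicit function takes its values among the zeros of the defect, and the end point of such
  -- a zero is the flow at time t.
  refine h3.congr_of_eventuallyEq ?_
  filter_upwards [h2] with p hp
  rw [picardDefect_flow Xc h' t y] at hp
  exact (eq_flow_of_picardDefect_eq_zero Xc hX h' p.1 p.2 _ hp).symm

end Flow


/-! ### Sums over antidiagonals -/

section Antidiagonal

variable {M : Type*} [AddCommMonoid M]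

lemma sum_antidiagonal_assoc (f : ℕ → ℕ → ℕ → M) (k : ℕ) :
    ∑ p ∈ Finset.HasAntidiagonal.antidiagonal k, ∑ q ∈ Finset.HasAntidiagonal.antidiagonal p.2, f p.1 q.1 q.2 =
      ∑ p ∈ Finset.HasAntidiagonal.antidiagonal k, ∑ q ∈ Finset.HasAntidiagonal.antidiagonal p.1, f q.1 q.2 p.2 := by
  rw [Finset.sum_sigma', Finset.sum_sigma']
  refine Finset.sum_nbij' (fun x => ⟨(x.1.1 + x.2.1, x.2.2), (x.1.1, x.2.1)⟩)
    (fun x => ⟨(x.2.1, x.2.2 + x.1.2), (x.2.2, x.1.2)⟩) ?_ ?_ ?_ ?_ ?_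
  all_goals rintro ⟨⟨a, b⟩, ⟨c, d⟩⟩ h
  all_goals simp only [Finset.mem_sigma, Finset.HasAntidiagonal.mem_antidiagonal] at h ⊢
  all_goals obtain ⟨rfl, rfl⟩ := h
  · simp [add_assoc]
  · simp [add_assoc]
  · rfl
  · rfl

lemma sum_antidiagonal_swap (f : ℕ → ℕ → M) (k : ℕ) :
    ∑ p ∈ Finset.HasAntidiagonal.antidiagonal k, f p.1 p.2 = ∑ p ∈ Finset.HasAntidiagonal.antidiagonal k, f p.2 p.1 :=
  (Finset.Nat.sum_antidiagonal_swap (f := fun p => f p.2 p.1)).symm ▸ rfl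

/-- The sum runs over `Fin k` so that the bound j < k is available to recursions and inductions on
the order. -/
lemma sum_antidiagonal_eq_add_fin (f : ℕ → ℕ → M) (k : ℕ) :
    ∑ p ∈ Finset.HasAntidiagonal.antidiagonal k, f p.1 p.2 = f 0 k + ∑ j : Fin k, f (k - j) j := by
  rw [sum_antidiagonal_swap, Finset.Nat.sum_antidiagonal_eq_sum_range_succ (fun i j => f j i),
    Finset.sum_range_succ, Nat.sub_self, add_comm, Finset.sum_range (fun j => f (k - j) j)]

end Antidiagonal

/-! ### Formal functions and formal vector fields -/

section Formal

variable {E W : Type} [NormedAddCommGroup E] [NormedSpace ℝ E] [NormedAddCommGroup W]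
  [NormedSpace ℝ W]

/-- All coefficients of a formal series are smooth. -/
def Smooth (u : ℕ → E → W) : Prop := ∀ k, ContDiff ℝ ∞ (u k)

lemma Smooth.differentiable {u : ℕ → E → W} (hu : Smooth u) (k : ℕ) : Differentiable ℝ (u k) :=
  (hu k).differentiable (by simp)

/-- Derivative of the formal series `u` along the formal vector field `X`. -/
def LD (X : ℕ → E → E) (u : ℕ → E → W) (k : ℕ) (Y : E) : W :=
  applySeries (fun i => X i Y) (fun j => fderiv ℝ (u j) Y) k

lemma LD_apply (X : ℕ → E → E) (u : ℕ → E → W) (k : ℕ) (Y : E) :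
    LD X u k Y = ∑ p ∈ Finset.HasAntidiagonal.antidiagonal k, fderiv ℝ (u p.2) Y (X p.1 Y) := rfl

lemma Smooth.LD {X : ℕ → E → E} {u : ℕ → E → W} (hX : Smooth X) (hu : Smooth u) :
    Smooth (LD X u) := fun k => by
  have : HighOsc.LD X u k = fun Y => ∑ p ∈ Finset.HasAntidiagonal.antidiagonal k, fderiv ℝ (u p.2) Y (X p.1 Y) :=
    rfl
  rw [this]
  exact ContDiff.sum fun p _ => ((hu p.2).fderiv_right (by simp)).clm_apply (hX p.1)

lemma Smooth.add {u v : ℕ → E → W} (hu : Smooth u) (hv : Smooth v) :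
    Smooth (fun k Y => u k Y + v k Y) := fun k => (hu k).add (hv k)

lemma Smooth.sub {u v : ℕ → E → W} (hu : Smooth u) (hv : Smooth v) :
    Smooth (fun k Y => u k Y - v k Y) := fun k => (hu k).sub (hv k)

lemma Smooth.neg {u : ℕ → E → W} (hu : Smooth u) : Smooth (fun k Y => -u k Y) :=
  fun k => (hu k).neg

lemma Smooth.comp {E' : Type} [NormedAddCommGroup E'] [NormedSpace ℝ E'] {u : ℕ → E → W}
    (hu : Smooth u) {g : E' → E} (hg : ContDiff ℝ ∞ g) : Smooth (fun k P => u k (g P)) :=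
  fun k => (hu k).comp hg

lemma Smooth.zero : Smooth (fun _ _ => 0 : ℕ → E → W) := fun _ => contDiff_const

lemma LD_add {X : ℕ → E → E} {u v : ℕ → E → W} (hu : Smooth u) (hv : Smooth v) (k : ℕ) (Y : E) :
    LD X (fun k Y => u k Y + v k Y) k Y = LD X u k Y + LD X v k Y := by
  simp only [LD_apply, ← Finset.sum_add_distrib]
  refine Finset.sum_congr rfl fun p _ => ?_
  rw [fderiv_fun_add (hu.differentiable _ _) (hv.differentiable _ _), add_apply]

lemma LD_sub {X : ℕ → E → E} {u v : ℕ → E → W} (hu : Smooth u) (hv : Smooth v) (k : ℕ) (Y : E) :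
    LD X (fun k Y => u k Y - v k Y) k Y = LD X u k Y - LD X v k Y := by
  simp only [LD_apply, ← Finset.sum_sub_distrib]
  refine Finset.sum_congr rfl fun p _ => ?_
  rw [fderiv_fun_sub (hu.differentiable _ _) (hv.differentiable _ _), sub_apply]

lemma LD_neg_field (X : ℕ → E → E) (u : ℕ → E → W) (k : ℕ) (Y : E) :
    LD (fun k Y => -X k Y) u k Y = -LD X u k Y := by
  simp [LD_apply]

lemma LD_add_field (X Z : ℕ → E → E) (u : ℕ → E → W) (k : ℕ) (Y : E) :
    LD (fun k Y => X k Y + Z k Y) u k Y = LD X u k Y + LD Z u k Y := by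
  simp [LD_apply, Finset.sum_add_distrib]

lemma LD_sub_field (X Z : ℕ → E → E) (u : ℕ → E → W) (k : ℕ) (Y : E) :
    LD (fun k Y => X k Y - Z k Y) u k Y = LD X u k Y - LD Z u k Y := by
  simp [LD_apply, Finset.sum_sub_distrib]

lemma LD_zero (X : ℕ → E → E) (k : ℕ) (Y : E) :
    LD X (fun _ _ => 0 : ℕ → E → W) k Y = 0 := by
  simp [LD_apply]

/-- Used at the first order not yet known to vanish: there a formal equation involves only the
leading field. -/
lemma LD_eq_of_lt {X : ℕ → E → E} {u : ℕ → E → W} {k : ℕ} (h : ∀ j < k, ∀ Y, u j Y = 0) (Y : E) :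
    LD X u k Y = fderiv ℝ (u k) Y (X 0 Y) := by
  rw [LD_apply, sum_antidiagonal_eq_add_fin (fun i j => fderiv ℝ (u j) Y (X i Y)),
    Finset.sum_eq_zero, add_zero]
  intro j _
  have : u j = fun _ => 0 := funext (h j j.2)
  simp [this]

lemma LD_eq_of_field_lt {X : ℕ → E → E} {u : ℕ → E → W} {k : ℕ} {Y : E} (h : ∀ i < k, X i Y = 0) :
    LD X u k Y = fderiv ℝ (u 0) Y (X k Y) := by
  rw [LD_apply, sum_antidiagonal_swap (fun i j => fderiv ℝ (u j) Y (X i Y)),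
    sum_antidiagonal_eq_add_fin (fun j i => fderiv ℝ (u j) Y (X i Y)), Finset.sum_eq_zero, add_zero]
  intro j _
  rw [h j j.2, map_zero]

lemma LD_clm_comp {W' : Type} [NormedAddCommGroup W'] [NormedSpace ℝ W'] (l : W →L[ℝ] W')
    (X : ℕ → E → E) {u : ℕ → E → W} (hu : Smooth u) (k : ℕ) (Y : E) :
    LD X (fun k Y => l (u k Y)) k Y = l (LD X u k Y) := by
  simp only [LD_apply, map_sum]
  refine Finset.sum_congr rfl fun p _ => ?_
  have h : HasFDerivAt (fun Y => l (u p.2 Y)) _ Y :=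
    l.hasFDerivAt.comp Y (hu.differentiable p.2 Y).hasFDerivAt
  rw [h.fderiv]
  rfl

/-- The series of the Lie brackets of two formal vector fields. -/
def fBracket (X Z : ℕ → E → E) (k : ℕ) (Y : E) : E :=
  ∑ p ∈ Finset.HasAntidiagonal.antidiagonal k, VectorField.lieBracket ℝ (X p.1) (Z p.2) Y

lemma formallyCommute_iff {X Z : ℕ → E → E} :
    FormallyCommute X Z ↔ ∀ k Y, fBracket X Z k Y = 0 := Iff.rfl

lemma fderiv_LD_apply {X : ℕ → E → E} {u : ℕ → E → W} (hX : Smooth X) (hu : Smooth u) (k : ℕ)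
    (Y v : E) : fderiv ℝ (LD X u k) Y v = ∑ p ∈ Finset.HasAntidiagonal.antidiagonal k,
      (fderiv ℝ (fderiv ℝ (u p.2)) Y v (X p.1 Y) + fderiv ℝ (u p.2) Y (fderiv ℝ (X p.1) Y v)) := by
  have h : ∀ p ∈ Finset.HasAntidiagonal.antidiagonal k, HasFDerivAt (fun Y => fderiv ℝ (u p.2) Y (X p.1 Y)) _ Y :=
    fun p _ => ((((hu p.2).fderiv_right (m := ∞) (by simp)).differentiable (by simp)
      Y).hasFDerivAt).clm_apply (hX.differentiable p.1 Y).hasFDerivAt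
  have h2 : HasFDerivAt (LD X u k) _ Y := HasFDerivAt.fun_sum h
  rw [h2.fderiv, sum_apply]
  refine Finset.sum_congr rfl fun p _ => ?_
  simp [add_comm]

lemma two_le_infty : minSmoothness ℝ 2 ≤ (∞ : WithTop ℕ∞) := by
  rw [minSmoothness_of_isRCLikeNormedField]
  exact WithTop.coe_le_coe.2 (le_top : (2 : ℕ∞) ≤ ⊤)

/-- The second derivatives cancel by symmetry, and the first-order terms that remain are those of
the brackets. -/
lemma LD_LD_sub_LD_LD {X Z : ℕ → E → E} {u : ℕ → E → W} (hX : Smooth X) (hZ : Smooth Z)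
    (hu : Smooth u) (k : ℕ) (Y : E) :
    LD X (LD Z u) k Y - LD Z (LD X u) k Y = LD (fBracket X Z) u k Y := by
  have hs : ∀ l (v v' : E), fderiv ℝ (fderiv ℝ (u l)) Y v v' = fderiv ℝ (fderiv ℝ (u l)) Y v' v :=
    fun l v v' => ((hu l).contDiffAt (x := Y)).isSymmSndFDerivAt two_le_infty v v'
  rw [LD_apply X, LD_apply Z]
  simp only [fderiv_LD_apply hZ hu, fderiv_LD_apply hX hu]
  rw [sum_antidiagonal_assoc (fun i j l => fderiv ℝ (fderiv ℝ (u l)) Y (X i Y) (Z j Y) +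
      fderiv ℝ (u l) Y (fderiv ℝ (Z j) Y (X i Y))),
    sum_antidiagonal_assoc (fun j i l => fderiv ℝ (fderiv ℝ (u l)) Y (Z j Y) (X i Y) +
      fderiv ℝ (u l) Y (fderiv ℝ (X i) Y (Z j Y))), ← Finset.sum_sub_distrib, LD_apply]
  refine Finset.sum_congr rfl fun p _ => ?_
  rw [sum_antidiagonal_swap (fun j i => fderiv ℝ (fderiv ℝ (u p.2)) Y (Z j Y) (X i Y) +
      fderiv ℝ (u p.2) Y (fderiv ℝ (X i) Y (Z j Y))), ← Finset.sum_sub_distrib, fBracket, map_sum]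
  refine Finset.sum_congr rfl fun q _ => ?_
  rw [hs, VectorField.lieBracket, map_sub]
  abel

lemma LD_comm {X Z : ℕ → E → E} {u : ℕ → E → W} (hX : Smooth X) (hZ : Smooth Z)
    (hu : Smooth u) (h : FormallyCommute X Z) (k : ℕ) (Y : E) :
    LD X (LD Z u) k Y = LD Z (LD X u) k Y := by
  rw [← sub_eq_zero, LD_LD_sub_LD_LD hX hZ hu, LD_apply]
  exact Finset.sum_eq_zero fun p _ => by rw [formallyCommute_iff.1 h, map_zero]

lemma fBracket_swap (X Z : ℕ → E → E) (k : ℕ) (Y : E) : fBracket X Z k Y = -fBracket Z X k Y := by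
  rw [fBracket, fBracket, sum_antidiagonal_swap (fun i j => VectorField.lieBracket ℝ (X i) (Z j) Y),
    ← Finset.sum_neg_distrib]
  refine Finset.sum_congr rfl fun p _ => ?_
  exact VectorField.lieBracket_swap

lemma FormallyCommute.symm {X Z : ℕ → E → E} (h : FormallyCommute X Z) : FormallyCommute Z X :=
  fun k Y => by
    have := fBracket_swap Z X k Y
    rw [formallyCommute_iff.1 h, neg_zero] at this
    exact this

lemma formallyCommute_self (X : ℕ → E → E) : FormallyCommute X X := fun k Y => by
  have h := fBracket_swap X X k Y
  rw [eq_neg_iff_add_eq_zero, ← two_smul ℝ] at h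
  exact (smul_eq_zero.1 h).resolve_left two_ne_zero

lemma fBracket_neg_left (X Z : ℕ → E → E) (k : ℕ) (Y : E) :
    fBracket (fun k Y => -X k Y) Z k Y = -fBracket X Z k Y := by
  rw [fBracket, fBracket, ← Finset.sum_neg_distrib]
  refine Finset.sum_congr rfl fun p _ => ?_
  have h2 : (fun Y => -X p.1 Y) = -X p.1 := rfl
  simp only [VectorField.lieBracket, h2, fderiv_neg]
  simp
  abel

lemma FormallyCommute.neg {X Z : ℕ → E → E} (h : FormallyCommute X Z) :
    FormallyCommute (fun k Y => -X k Y) Z := by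
  rw [formallyCommute_iff] at h ⊢
  intro k Y
  rw [fBracket_neg_left, h, neg_zero]

lemma FormallyCommute.add {X X' Z : ℕ → E → E} (hX : Smooth X) (hX' : Smooth X')
    (h : FormallyCommute X Z) (h' : FormallyCommute X' Z) :
    FormallyCommute (fun k Y => X k Y + X' k Y) Z := fun k Y => by
  have h1 := h k Y
  have h2 := h' k Y
  have h3 := congrArg₂ (· + ·) h1 h2
  simp only [add_zero, ← Finset.sum_add_distrib] at h3
  rw [← h3]
  refine Finset.sum_congr rfl fun p _ => ?_
  exact VectorField.lieBracket_add_left (hX.differentiable _ _) (hX'.differentiable _ _)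

/-! ### Extension to `ℝ × E` -/

/-- The formal vector field `(c, X)` on `ℝ × E`, with `c` constant. -/
def pair (c : ℕ → ℝ) (X : ℕ → E → E) (k : ℕ) (P : ℝ × E) : ℝ × E := (c k, X k P.2)

/-- The formal vector field `(0, X)` on `ℝ × E`. -/
def ext (X : ℕ → E → E) : ℕ → ℝ × E → ℝ × E := pair (fun _ => 0) X

/-- The transport field `∂_τ - X` on `ℝ × E`. -/
def tf (X : ℕ → E → E) : ℕ → ℝ × E → ℝ × E :=
  pair (fun k => if k = 0 then 1 else 0) (fun k Y => -X k Y)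

lemma Smooth.pair {c : ℕ → ℝ} {X : ℕ → E → E} (hX : Smooth X) : Smooth (pair c X) :=
  fun k => contDiff_const.prodMk ((hX k).comp contDiff_snd)

lemma Smooth.ext {X : ℕ → E → E} (hX : Smooth X) : Smooth (ext X) := hX.pair

lemma Smooth.tf {X : ℕ → E → E} (hX : Smooth X) : Smooth (tf X) := hX.neg.pair

lemma fBracket_pair {X Z : ℕ → E → E} (hX : Smooth X) (hZ : Smooth Z) (c c' : ℕ → ℝ) (k : ℕ)
    (P : ℝ × E) : fBracket (pair c X) (pair c' Z) k P = (0, fBracket X Z k P.2) := by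
  have h1 : ∀ {X : ℕ → E → E} (_ : Smooth X) (c : ℕ → ℝ) (i : ℕ) (v : ℝ × E),
      fderiv ℝ (pair c X i) P v = (0, fderiv ℝ (X i) P.2 v.2) := by
    intro X hX c i v
    have : HasFDerivAt (pair c X i) _ P :=
      (hasFDerivAt_const (c i) P).prodMk
        ((hX.differentiable i P.2).hasFDerivAt.comp P hasFDerivAt_snd)
    rw [this.fderiv]
    simp
  have h2 : ∀ p ∈ Finset.HasAntidiagonal.antidiagonal k, VectorField.lieBracket ℝ (pair c X p.1)
      (pair c' Z p.2) P = (0, VectorField.lieBracket ℝ (X p.1) (Z p.2) P.2) := by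
    intro p _
    simp [VectorField.lieBracket, h1 hX, h1 hZ, pair]
  rw [fBracket, Finset.sum_congr rfl h2]
  exact Prod.ext (by simp [Prod.fst_sum]) (by simp [Prod.snd_sum, fBracket])

lemma FormallyCommute.pair {X Z : ℕ → E → E} (hX : Smooth X) (hZ : Smooth Z)
    (h : FormallyCommute X Z) (c c' : ℕ → ℝ) : FormallyCommute (pair c X) (pair c' Z) := by
  rw [formallyCommute_iff] at h ⊢
  intro k P
  rw [fBracket_pair hX hZ, h]
  rfl

lemma LD_pair_comp_snd (c : ℕ → ℝ) (X : ℕ → E → E) {p : ℕ → E → W} (hp : Smooth p) (k : ℕ)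
    (P : ℝ × E) : LD (pair c X) (fun k P => p k P.2) k P = LD X p k P.2 := by
  simp only [LD_apply]
  refine Finset.sum_congr rfl fun q _ => ?_
  have h : HasFDerivAt (fun P : ℝ × E => p q.2 P.2) _ P :=
    (hp.differentiable q.2 P.2).hasFDerivAt.comp P hasFDerivAt_snd
  rw [h.fderiv]
  rfl

lemma LD_tf_comp_snd (X : ℕ → E → E) {p : ℕ → E → W} (hp : Smooth p) (k : ℕ)
    (P : ℝ × E) : LD (tf X) (fun k P => p k P.2) k P = -LD X p k P.2 := by
  rw [tf, LD_pair_comp_snd _ _ hp, LD_neg_field]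

lemma LD_ext_comp_snd (X : ℕ → E → E) {p : ℕ → E → W} (hp : Smooth p) (k : ℕ)
    (P : ℝ × E) : LD (ext X) (fun k P => p k P.2) k P = LD X p k P.2 :=
  LD_pair_comp_snd _ _ hp k P

lemma fderiv_slice {u : ℝ × E → W} {τ : ℝ} {Y : E} (hu : DifferentiableAt ℝ u (τ, Y)) (v : E) :
    fderiv ℝ (fun Y => u (τ, Y)) Y v = fderiv ℝ u (τ, Y) (0, v) := by
  have h : HasFDerivAt (fun Y => u (τ, Y)) _ Y :=
    hu.hasFDerivAt.comp Y (hasFDerivAt_prodMk_right τ Y)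
  rw [h.fderiv]
  rfl

lemma hasDerivAt_slice {u : ℝ × E → W} {τ : ℝ} {Y : E} (hu : DifferentiableAt ℝ u (τ, Y)) :
    HasDerivAt (fun s => u (s, Y)) (fderiv ℝ u (τ, Y) (1, 0)) τ :=
  hu.hasFDerivAt.comp_hasDerivAt τ ((hasDerivAt_id τ).prodMk (hasDerivAt_const τ Y))

lemma LD_ext_slice (X : ℕ → E → E) {u : ℕ → ℝ × E → W} (hu : Smooth u) (k : ℕ) (τ : ℝ) (Y : E) :
    LD (ext X) u k (τ, Y) = LD X (fun k Y => u k (τ, Y)) k Y := by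
  simp only [LD_apply]
  refine Finset.sum_congr rfl fun q _ => ?_
  rw [fderiv_slice (hu.differentiable _ _)]
  rfl

/-- The component ∂_τ of the field has order zero, so it meets only the coefficient of order k. -/
lemma LD_tf_slice (X : ℕ → E → E) {u : ℕ → ℝ × E → W} (hu : Smooth u) (k : ℕ) (τ : ℝ) (Y : E) :
    LD (tf X) u k (τ, Y) =
      deriv (fun s => u k (s, Y)) τ - LD X (fun k Y => u k (τ, Y)) k Y := by
  rw [← LD_ext_slice X hu, (hasDerivAt_slice (hu.differentiable k (τ, Y))).deriv]
  have h : ∀ i P, tf X i P = ((if i = 0 then 1 else 0 : ℝ), (0 : E)) - ext X i P := by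
    intro i P
    simp [tf, ext, pair]
  have h2 : LD (tf X) u k (τ, Y) = LD (fun i P => ((if i = 0 then 1 else 0 : ℝ), (0 : E))) u k (τ, Y)
      - LD (ext X) u k (τ, Y) := by
    rw [← LD_sub_field]
    simp only [LD_apply, h]
  rw [h2, LD_apply (fun i P => ((if i = 0 then 1 else 0 : ℝ), (0 : E))),
    sum_antidiagonal_eq_add_fin
      (fun i j => fderiv ℝ (u j) (τ, Y) ((if i = 0 then 1 else 0 : ℝ), (0 : E))),
    Finset.sum_eq_zero, add_zero, if_pos rfl]
  intro j _
  have : k - (j : ℕ) ≠ 0 := by have := j.2; omega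
  rw [if_neg this]
  exact map_zero _

/-- `u` is a smooth formal solution of `∂_τ u = L_X u + p`. -/
structure IsSol (X : ℕ → E → E) (p : ℕ → E → W) (u : ℕ → ℝ × E → W) : Prop where
  smooth : Smooth u
  eq : ∀ k P, LD (tf X) u k P = p k P.2

lemma IsSol.hasDerivAt {X : ℕ → E → E} {p : ℕ → E → W} {u : ℕ → ℝ × E → W} (h : IsSol X p u)
    (k : ℕ) (τ : ℝ) (Y : E) :
    HasDerivAt (fun s => u k (s, Y)) (LD X (fun k Y => u k (τ, Y)) k Y + p k Y) τ := by
  have h1 := h.eq k (τ, Y)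
  rw [LD_tf_slice X h.smooth, sub_eq_iff_eq_add'] at h1
  rw [← h1]
  exact (hasDerivAt_slice (h.smooth.differentiable k (τ, Y))).differentiableAt.hasDerivAt

lemma isSol_of_deriv {X : ℕ → E → E} {p : ℕ → E → W} {u : ℕ → ℝ × E → W} (hu : Smooth u)
    (h : ∀ k τ Y, deriv (fun s => u k (s, Y)) τ = LD X (fun k Y => u k (τ, Y)) k Y + p k Y) :
    IsSol X p u :=
  ⟨hu, fun k P => by rw [← Prod.mk.eta (p := P), LD_tf_slice X hu, h, add_sub_cancel_left]⟩

lemma IsSol.sub {X : ℕ → E → E} {p : ℕ → E → W} {u v : ℕ → ℝ × E → W} (hu : IsSol X p u)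
    (hv : IsSol X p v) : IsSol X (fun _ _ => 0 : ℕ → E → W) (fun k P => u k P - v k P) :=
  ⟨hu.smooth.sub hv.smooth, fun k P => by
    rw [LD_sub hu.smooth hv.smooth, hu.eq, hv.eq, sub_self]⟩

lemma IsSol.clm_comp {W' : Type} [NormedAddCommGroup W'] [NormedSpace ℝ W'] (l : W →L[ℝ] W')
    {X : ℕ → E → E} {u : ℕ → ℝ × E → W} (hu : IsSol X (fun _ _ => 0 : ℕ → E → W) u) :
    IsSol X (fun _ _ => 0 : ℕ → E → W') (fun k P => l (u k P)) :=
  ⟨fun k => l.contDiff.comp (hu.smooth k), fun k P => by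
    rw [LD_clm_comp l _ hu.smooth, hu.eq, map_zero]⟩

lemma IsSol.shift {X : ℕ → E → E} {p : ℕ → E → W} {u : ℕ → ℝ × E → W} (hu : IsSol X p u) (c : ℝ) :
    IsSol X p (fun k P => u k (P.1 + c, P.2)) := by
  refine isSol_of_deriv (hu.smooth.comp (by fun_prop)) fun k τ Y => ?_
  exact ((hu.hasDerivAt k (τ + c) Y).comp_add_const τ c).deriv

/-! ### The Cauchy problem -/

variable [FiniteDimensional ℝ E]

/-- The function `u₀ ∘ Φ_τ + ∫₀^τ r_s ∘ Φ_{τ - s} ds`. -/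
def duhamel (Φ : ℝ → E → E) (u₀ : E → W) (r : ℝ × E → W) (P : ℝ × E) : W :=
  u₀ (Φ P.1 P.2) + ∫ s in (0 : ℝ)..P.1, r (s, Φ (-s) (Φ P.1 P.2))

omit [FiniteDimensional ℝ E] in
lemma duhamel_zero {A : E → E} {Φ : ℝ → E → E} (hΦ : GeneratesFlow A Φ) (u₀ : E → W)
    (r : ℝ × E → W) (Y : E) : duhamel Φ u₀ r (0, Y) = u₀ Y := by
  simp [duhamel, hΦ.init]

lemma contDiff_duhamel {A : E → E} {Φ : ℝ → E → E} (hΦ : GeneratesFlow A Φ)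
    (hA : ContDiff ℝ ∞ A) {u₀ : E → W} {r : ℝ × E → W} (hu₀ : ContDiff ℝ ∞ u₀)
    (hr : ContDiff ℝ ∞ r) [CompleteSpace W] : ContDiff ℝ ∞ (duhamel Φ u₀ r) := by
  have h1 := hΦ.contDiff hA
  have h2 : ContDiff ℝ ∞ (fun P : ℝ × E => r (P.1, Φ (-P.1) P.2)) :=
    hr.comp (contDiff_fst.prodMk (h1.comp (contDiff_fst.neg.prodMk contDiff_snd)))
  exact (hu₀.comp h1).add ((contDiff_integral _ h2).comp (contDiff_fst.prodMk h1))

omit [FiniteDimensional ℝ E] in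
lemma hasDerivAt_characteristic {A : E → E} {Φ : ℝ → E → E} (hΦ : GeneratesFlow A Φ) (z : E)
    {u : ℝ × E → W} (hu : Differentiable ℝ u) (τ : ℝ) :
    HasDerivAt (fun s => u (s, Φ (-s) z)) (fderiv ℝ u (τ, Φ (-τ) z) (1, -A (Φ (-τ) z))) τ :=
  (hu _).hasFDerivAt.comp_hasDerivAt τ ((hasDerivAt_id τ).prodMk (hΦ.neg.ode τ z))

/-- Along s ↦ (s, Φ_{-s}z) the initial term is constant and the integrand no longer depends on the
upper limit. The fundamental theorem of calculus gives r without differentiating the flow in space.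
-/
lemma fderiv_duhamel [CompleteSpace W] {A : E → E} {Φ : ℝ → E → E} (hΦ : GeneratesFlow A Φ)
    (hA : ContDiff ℝ ∞ A) {u₀ : E → W} {r : ℝ × E → W} (hu₀ : ContDiff ℝ ∞ u₀)
    (hr : ContDiff ℝ ∞ r) (P : ℝ × E) : fderiv ℝ (duhamel Φ u₀ r) P (1, -A P.2) = r P := by
  have h1 := hasDerivAt_characteristic hΦ (Φ P.1 P.2)
    ((contDiff_duhamel hΦ hA hu₀ hr).differentiable (by simp)) P.1
  have hcont : Continuous fun s => r (s, Φ (-s) (Φ P.1 P.2)) :=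
    hr.continuous.comp (continuous_id.prodMk
      ((hΦ.contDiff hA).continuous.comp (continuous_neg.prodMk continuous_const)))
  have h2 : HasDerivAt (fun s => duhamel Φ u₀ r (s, Φ (-s) (Φ P.1 P.2)))
      (r (P.1, Φ (-P.1) (Φ P.1 P.2))) P.1 := by
    have h3 := (intervalIntegral.integral_hasDerivAt_right (hcont.intervalIntegrable 0 P.1)
      (hcont.stronglyMeasurableAtFilter _ _) hcont.continuousAt).const_add (u₀ (Φ P.1 P.2))
    refine h3.congr_of_eventuallyEq (Eventually.of_forall fun s => ?_)
    simp [duhamel, hΦ.apply_apply_neg hA]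
  have := h1.unique h2
  rwa [hΦ.apply_neg_apply hA] at this

/-- The function is constant on the characteristic through P, which exists for all times and so
reaches τ = 0. -/
lemma eq_zero_of_transport {A : E → E} {Φ : ℝ → E → E} (hΦ : GeneratesFlow A Φ)
    (hA : ContDiff ℝ ∞ A) {d : ℝ × E → W} (hd : Differentiable ℝ d)
    (h : ∀ P : ℝ × E, fderiv ℝ d P (1, -A P.2) = 0) (h0 : ∀ Y, d (0, Y) = 0) (P : ℝ × E) :
    d P = 0 := by
  have h1 := hasDerivAt_characteristic hΦ (Φ P.1 P.2) hd
  have h2 := is_const_of_deriv_eq_zero (fun s => (h1 s).differentiableAt)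
    (fun s => by rw [(h1 s).deriv]; exact h _) P.1 0
  simpa [hΦ.apply_neg_apply hA, h0, hΦ.init] using h2

variable {X : ℕ → E → E} {Φ : ℝ → E → E}

/-- Once the lower orders vanish, each order solves the transport equation of the leading field. The
cutoff m allows equations with a residual that starts only at order m. -/
lemma eq_zero_of_isSol_lt (hΦ : GeneratesFlow (X 0) Φ)
    (hX : ContDiff ℝ ∞ (X 0)) {d : ℕ → ℝ × E → W} (hd : Smooth d) {m : ℕ}
    (h : ∀ k < m, ∀ P, LD (tf X) d k P = 0) (h0 : ∀ k < m, ∀ Y, d k (0, Y) = 0) :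
    ∀ k < m, ∀ P, d k P = 0 := by
  intro k
  induction k using Nat.strong_induction_on with
  | _ k ih =>
    intro hk
    refine eq_zero_of_transport hΦ hX (hd.differentiable k) (fun P => ?_) (h0 k hk)
    rw [← h k hk P, LD_eq_of_lt fun j hj => ih j hj (hj.trans hk)]
    simp [tf, pair]

lemma IsSol.unique (hΦ : GeneratesFlow (X 0) Φ) (hX : ContDiff ℝ ∞ (X 0)) {p : ℕ → E → W}
    {u v : ℕ → ℝ × E → W} (hu : IsSol X p u) (hv : IsSol X p v)
    (h : ∀ k Y, u k (0, Y) = v k (0, Y)) (k : ℕ) (P : ℝ × E) : u k P = v k P := by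
  have hd := hu.sub hv
  exact sub_eq_zero.1 (eq_zero_of_isSol_lt hΦ hX hd.smooth (fun k _ P => hd.eq k P)
    (fun k _ Y => sub_eq_zero.2 (h k Y)) k (Nat.lt_succ_self k) P)

omit [FiniteDimensional ℝ E] in
variable (Φ X) in
/-- The solution of `∂_τ u = L_X u + p` with initial value `u₀`; `Φ` is the flow of `X 0`. -/
def cauchy (p u₀ : ℕ → E → W) (k : ℕ) : ℝ × E → W :=
  duhamel Φ (u₀ k) fun P => p k P.2 +
    -- At order k only the leading field acts on the unknown; the other fields act on coefficients
    -- already constructed and enter as a source.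
    ∑ j : Fin k, fderiv ℝ (cauchy p u₀ j) P (0, X (k - j) P.2)
termination_by k
decreasing_by exact j.2

omit [FiniteDimensional ℝ E] in
lemma cauchy_zero (hΦ : GeneratesFlow (X 0) Φ) (p u₀ : ℕ → E → W) (k : ℕ) (Y : E) :
    cauchy X Φ p u₀ k (0, Y) = u₀ k Y := by
  rw [cauchy, duhamel_zero hΦ]

lemma smooth_cauchy [CompleteSpace W] (hΦ : GeneratesFlow (X 0) Φ) (hX : Smooth X)
    {p u₀ : ℕ → E → W} (hp : Smooth p) (hu₀ : Smooth u₀) : Smooth (cauchy X Φ p u₀) := by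
  intro k
  induction k using Nat.strong_induction_on with
  | _ k ih =>
    rw [cauchy]
    exact contDiff_duhamel hΦ (hX 0) (hu₀ k) (((hp k).comp contDiff_snd).add
      (ContDiff.sum fun j _ => ((ih j j.2).fderiv_right (by simp)).clm_apply
        (contDiff_const.prodMk ((hX _).comp contDiff_snd))))

lemma isSol_cauchy [CompleteSpace W] (hΦ : GeneratesFlow (X 0) Φ) (hX : Smooth X)
    {p u₀ : ℕ → E → W} (hp : Smooth p) (hu₀ : Smooth u₀) : IsSol X p (cauchy X Φ p u₀) := by
  have hs := smooth_cauchy hΦ hX hp hu₀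
  refine ⟨hs, fun k P => ?_⟩
  rw [LD_apply, sum_antidiagonal_eq_add_fin
    (fun i j => fderiv ℝ (cauchy X Φ p u₀ j) P (tf X i P))]
  have h0 : tf X 0 P = (1, -X 0 P.2) := by simp [tf, pair]
  rw [h0]
  have h1 : fderiv ℝ (cauchy X Φ p u₀ k) P (1, -X 0 P.2) = p k P.2 +
      ∑ j : Fin k, fderiv ℝ (cauchy X Φ p u₀ j) P (0, X (k - j) P.2) := by
    conv_lhs => rw [cauchy]
    refine fderiv_duhamel hΦ (hX 0) (hu₀ k) ?_ P
    exact ((hp k).comp contDiff_snd).add (ContDiff.sum fun j _ =>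
      ((hs j).fderiv_right (by simp)).clm_apply
        (contDiff_const.prodMk ((hX _).comp contDiff_snd)))
  rw [h1, add_assoc, ← Finset.sum_add_distrib, Finset.sum_eq_zero, add_zero]
  intro j _
  have h2 : k - (j : ℕ) ≠ 0 := by have := j.2; omega
  rw [tf, pair, if_neg h2, ← map_add, Prod.mk_add_mk, add_zero, add_neg_cancel]
  exact map_zero _

/-! ### Two commuting fields -/

lemma GeneratesFlow.ext (hΦ : GeneratesFlow (X 0) Φ) :
    GeneratesFlow (HighOsc.ext X 0) (fun t P => (P.1, Φ t P.2)) :=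
  ⟨fun P => by simp [hΦ.init], fun t P => (hasDerivAt_const t P.1).prodMk (hΦ.ode t P.2)⟩

/-- Commuting evolutions have a common solution `H(σ, τ, ·)`. -/
theorem exists_twoTime [CompleteSpace W] {Z : ℕ → E → E} {Ψ : ℝ → E → E}
    (hΦ : GeneratesFlow (X 0) Φ) (hΨ : GeneratesFlow (Z 0) Ψ) (hX : Smooth X) (hZ : Smooth Z)
    (hXZ : FormallyCommute X Z) {p q u₀ : ℕ → E → W} (hp : Smooth p) (hq : Smooth q)
    (hu₀ : Smooth u₀) (hpq : ∀ k Y, LD X q k Y = LD Z p k Y) :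
    ∃ H : ℕ → ℝ × ℝ × E → W, IsSol (ext X) (fun k P => p k P.2) H ∧
      (∀ k P, LD (ext (tf Z)) H k P = q k P.2.2) ∧ ∀ k Y, H k (0, 0, Y) = u₀ k Y := by
  -- The solution is built in τ at σ = 0 first and then continued in σ, with τ as a parameter.
  set w := cauchy Z Ψ q u₀
  have hw : IsSol Z q w := isSol_cauchy hΨ hZ hq hu₀
  have hΦ' := hΦ.ext
  have hp' : Smooth (fun k (P : ℝ × E) => p k P.2) := hp.comp contDiff_snd
  set H := cauchy (ext X) (fun t P => (P.1, Φ t P.2)) (fun k (P : ℝ × E) => p k P.2) w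
  have hH : IsSol (ext X) (fun k (P : ℝ × E) => p k P.2) H :=
    isSol_cauchy hΦ' hX.ext hp' hw.smooth
  have hH0 : ∀ k P, H k (0, P) = w k P := cauchy_zero hΦ' _ _
  refine ⟨H, hH, ?_, fun k Y => by rw [hH0]; exact cauchy_zero hΨ _ _ k Y⟩
  have hq' : Smooth (fun k (P : ℝ × ℝ × E) => q k P.2.2) := hq.comp (by fun_prop)
  have hL : Smooth (LD (ext (tf Z)) H) := hZ.tf.ext.LD hH.smooth
  have hcomm : FormallyCommute (tf (ext X)) (ext (tf Z)) := by
    refine FormallyCommute.pair hX.ext.neg hZ.tf (FormallyCommute.neg ?_) _ _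
    refine FormallyCommute.pair hX hZ.neg ?_ _ _
    exact hXZ.symm.neg.symm
  -- The defect of the τ-equation has no source in σ: applying ∂_σ - X, which commutes with ∂_τ - Z,
  -- yields -L_Z p + L_X q = 0. It vanishes at σ = 0 by construction, hence everywhere.
  have hd : IsSol (ext X) (fun _ _ => 0 : ℕ → ℝ × E → W)
      (fun k P => LD (ext (tf Z)) H k P - q k P.2.2) := by
    refine ⟨hL.sub hq', fun k P => ?_⟩
    rw [LD_sub hL hq', LD_comm hX.ext.tf hZ.tf.ext hH.smooth hcomm]
    have h1 : LD (tf (ext X)) H = fun k P => p k P.2.2 := by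
      funext k P
      exact hH.eq k P
    rw [h1, LD_ext_comp_snd _ hp', LD_tf_comp_snd _ hp,
      LD_tf_comp_snd (HighOsc.ext X) (p := fun k P => q k P.2) (hq.comp contDiff_snd),
      LD_ext_comp_snd _ hq, hpq]
    simp
  intro k P
  refine sub_eq_zero.1 (hd.unique hΦ' (hX.ext 0) (v := fun _ _ => 0) ⟨Smooth.zero, fun k P => ?_⟩
    (fun k P => ?_) k P)
  · exact LD_zero _ k P
  · have h2 : (fun k P => H k (0, P)) = w := funext fun k => funext fun P => hH0 k P
    rw [LD_ext_slice _ hH.smooth, h2, hw.eq, sub_self]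

/-- The diagonal `τ ↦ H(c τ, τ, ·)` of a two-time solution. -/
lemma isSol_diagonal {Z : ℕ → E → E} {H : ℕ → ℝ × ℝ × E → W}
    (hH : IsSol (ext X) (fun _ _ => 0 : ℕ → ℝ × E → W) H)
    (hH' : ∀ k P, LD (ext (tf Z)) H k P = 0) (c : ℝ) :
    IsSol (fun k Y => c • X k Y + Z k Y) (fun _ _ => 0 : ℕ → E → W)
      (fun k P => H k (c * P.1, P)) := by
  have hs : Smooth (fun k (P : ℝ × E) => H k (c * P.1, P)) := hH.smooth.comp (by fun_prop)
  refine isSol_of_deriv hs fun k τ Y => ?_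
  have h0 : ∀ k, DifferentiableAt ℝ (H k) (c * τ, τ, Y) := fun k => hH.smooth.differentiable k _
  have h1 : HasDerivAt (fun s => H k (c * s, s, Y)) (fderiv ℝ (H k) (c * τ, τ, Y) (c, 1, 0)) τ := by
    have := (h0 k).hasFDerivAt.comp_hasDerivAt τ (((hasDerivAt_id τ).const_mul c).prodMk
      ((hasDerivAt_id τ).prodMk (hasDerivAt_const τ Y)))
    simpa [Function.comp_def] using this
  have h2 : ((c, 1, 0) : ℝ × ℝ × E) = c • ((1, 0) : ℝ × ℝ × E) + (0, 1, 0) := by simp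
  have h3 := (hH.hasDerivAt k (c * τ) (τ, Y)).unique (hasDerivAt_slice (h0 k))
  have h4 := hH' k (c * τ, τ, Y)
  rw [LD_ext_slice _ hH.smooth, LD_tf_slice _ (hH.smooth.comp (by fun_prop)), sub_eq_zero] at h4
  have h5 : HasDerivAt (fun s => H k (c * τ, s, Y)) (fderiv ℝ (H k) (c * τ, τ, Y) (0, 1, 0)) τ :=
    (h0 k).hasFDerivAt.comp_hasDerivAt τ ((hasDerivAt_const τ (c * τ)).prodMk
      ((hasDerivAt_id τ).prodMk (hasDerivAt_const τ Y)))
  rw [h5.deriv] at h4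
  rw [LD_ext_slice X (u := fun k P => H k (c * τ, P)) (hH.smooth.comp (by fun_prop))] at h3
  rw [h1.deriv, h2, map_add, map_smul, ← h3, h4, add_zero, add_zero, LD_add_field]
  simp [LD_apply, Finset.smul_sum]

end Formal


/-! ### Formal evolutions -/

section Evolution

variable {E W : Type} [NormedAddCommGroup E] [NormedSpace ℝ E] [NormedAddCommGroup W]
  [NormedSpace ℝ W]

/-- A function as a formal series without higher order terms. -/
def lead (f : E → W) (k : ℕ) (Y : E) : W := if k = 0 then f Y else 0

lemma smooth_lead {f : E → W} (hf : ContDiff ℝ ∞ f) : Smooth (lead f) := fun k => by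
  by_cases h : k = 0
  · exact contDiff_of_eq hf fun Y => if_pos h
  · exact contDiff_of_eq (contDiff_const (c := 0)) fun Y => if_neg h

/-- Multiplication of a formal series by `ε`. -/
def mulEps (u : ℕ → E → W) : ℕ → E → W
  | 0, _ => 0
  | k + 1, Y => u k Y

lemma Smooth.mulEps {u : ℕ → E → W} (hu : Smooth u) : Smooth (mulEps u)
  | 0 => contDiff_const
  | k + 1 => hu k

/-- Product of formal functions. -/
def mulS (u v : ℕ → E → ℝ) (k : ℕ) (Y : E) : ℝ := mulSeries (fun i => u i Y) (fun i => v i Y) k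

lemma mulS_apply (u v : ℕ → E → ℝ) (k : ℕ) (Y : E) :
    mulS u v k Y = ∑ p ∈ Finset.HasAntidiagonal.antidiagonal k, u p.1 Y * v p.2 Y := rfl

lemma Smooth.mulS {u v : ℕ → E → ℝ} (hu : Smooth u) (hv : Smooth v) : Smooth (mulS u v) :=
  fun k => ContDiff.sum (s := Finset.HasAntidiagonal.antidiagonal k)
    fun p _ => (hu p.1).mul (hv p.2)

lemma mulS_lead (f g : E → ℝ) (k : ℕ) (Y : E) :
    mulS (lead f) (lead g) k Y = lead (fun Y => f Y * g Y) k Y := by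
  rw [mulS_apply, sum_antidiagonal_eq_add_fin (fun i j => lead f i Y * lead g j Y),
    Finset.sum_eq_zero, add_zero]
  · by_cases h : k = 0 <;> simp [lead, h]
  · intro j _
    have : k - (j : ℕ) ≠ 0 := by have := j.2; omega
    simp [lead, this]

lemma LD_mulS {X : ℕ → E → E} {u v : ℕ → E → ℝ} (hu : Smooth u) (hv : Smooth v) (k : ℕ) (Y : E) :
    LD X (mulS u v) k Y = mulS (LD X u) v k Y + mulS u (LD X v) k Y := by
  have h1 : ∀ m i, fderiv ℝ (mulS u v m) Y (X i Y) = ∑ q ∈ Finset.HasAntidiagonal.antidiagonal m,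
      (fderiv ℝ (u q.1) Y (X i Y) * v q.2 Y + u q.1 Y * fderiv ℝ (v q.2) Y (X i Y)) := by
    intro m i
    have h : ∀ q ∈ Finset.HasAntidiagonal.antidiagonal m,
        HasFDerivAt (fun Y => u q.1 Y * v q.2 Y) _ Y := fun q _ =>
      (hu.differentiable q.1 Y).hasFDerivAt.mul (hv.differentiable q.2 Y).hasFDerivAt
    have h2 : HasFDerivAt (mulS u v m) _ Y := HasFDerivAt.fun_sum h
    rw [h2.fderiv, sum_apply]
    refine Finset.sum_congr rfl fun q _ => ?_
    simp
    ring
  rw [LD_apply]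
  simp only [h1]
  simp only [Finset.sum_add_distrib]
  congr 1
  · rw [sum_antidiagonal_assoc (fun i a b => fderiv ℝ (u a) Y (X i Y) * v b Y), mulS_apply]
    refine Finset.sum_congr rfl fun p _ => ?_
    rw [LD_apply, Finset.sum_mul]
  · rw [sum_antidiagonal_assoc (fun i a b => u a Y * fderiv ℝ (v b) Y (X i Y))]
    simp only [fun p : ℕ × ℕ =>
      sum_antidiagonal_swap (fun i a => u a Y * fderiv ℝ (v p.2) Y (X i Y)) p.1]
    rw [← sum_antidiagonal_assoc (fun a i b => u a Y * fderiv ℝ (v b) Y (X i Y)), mulS_apply]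
    refine Finset.sum_congr rfl fun p _ => ?_
    rw [LD_apply, Finset.mul_sum]

lemma LD_mulEps (X : ℕ → E → E) (u : ℕ → E → W) : LD X (mulEps u) = mulEps (LD X u) := by
  funext k Y
  cases k with
  | zero =>
    have : mulEps u 0 = fun _ => 0 := rfl
    simp [LD_apply, mulEps, this]
  | succ k =>
    rw [LD_apply, Finset.Nat.sum_antidiagonal_succ']
    have : mulEps u 0 = fun _ => 0 := rfl
    simp [mulEps, this, LD_apply]
    rfl

lemma eq_add_smul_of_hasDerivAt {f : ℝ → W} {c : W} (h : ∀ t, HasDerivAt f c t) (t : ℝ) :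
    f t = f 0 + t • c := by
  have h1 : ∀ s, HasDerivAt (fun s => f s - s • c) 0 s := fun s => by
    have := (h s).fun_sub ((hasDerivAt_id s).smul_const c)
    simpa using this
  have := is_const_of_deriv_eq_zero (fun s => (h1 s).differentiableAt)
    (fun s => (h1 s).deriv) t 0
  simp only [zero_smul, sub_zero] at this
  rw [← this, sub_add_cancel]

lemma eq_of_forall_clm {v w : W} (h : ∀ l : W →L[ℝ] ℝ, l v = l w) : v = w := by
  by_contra hne
  obtain ⟨l, hl⟩ := SeparatingDual.exists_ne_zero (R := ℝ) (sub_ne_zero.2 hne)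
  exact hl (by rw [map_sub, h, sub_self])

variable [FiniteDimensional ℝ E]

/-- The formal evolution `exp(τ L_X) u`. -/
abbrev evol (X : ℕ → E → E) (Φ : ℝ → E → E) (u : ℕ → E → W) : ℕ → ℝ × E → W :=
  cauchy X Φ (fun _ _ => 0) u

/-- The transport field acts as a derivation, so it annihilates products of series it annihilates.
This makes evolutions multiplicative. -/
lemma isSol_mulS {X : ℕ → E → E} {u v : ℕ → ℝ × E → ℝ}
    (hu : IsSol X (fun _ _ => 0 : ℕ → E → ℝ) u) (hv : IsSol X (fun _ _ => 0 : ℕ → E → ℝ) v) :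
    IsSol X (fun _ _ => 0 : ℕ → E → ℝ) (mulS u v) := by
  refine ⟨hu.smooth.mulS hv.smooth, fun k P => ?_⟩
  rw [LD_mulS hu.smooth hv.smooth, mulS_apply, mulS_apply]
  simp [hu.eq, hv.eq]

section

variable {X : ℕ → E → E} {Φ : ℝ → E → E}

lemma evol_zero_order (_ : GeneratesFlow (X 0) Φ) (u : ℕ → E → W) (P : ℝ × E) :
    evol X Φ u 0 P = u 0 (Φ P.1 P.2) := by
  rw [evol, cauchy]
  simp [duhamel]

variable [CompleteSpace W]

lemma isSol_evol (hΦ : GeneratesFlow (X 0) Φ) (hX : Smooth X) {u : ℕ → E → W} (hu : Smooth u) :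
    IsSol X (fun _ _ => 0 : ℕ → E → W) (evol X Φ u) :=
  isSol_cauchy hΦ hX Smooth.zero hu

lemma evol_init (hΦ : GeneratesFlow (X 0) Φ) (u : ℕ → E → W) (k : ℕ) (Y : E) :
    evol X Φ u k (0, Y) = u k Y := cauchy_zero hΦ _ _ k Y

-- This is the way identities for `evol` are proved below: the other side solves the same linear
-- equation with the same initial value.
omit [CompleteSpace W] in
lemma IsSol.eq_evol (hΦ : GeneratesFlow (X 0) Φ) (hX : Smooth X) [CompleteSpace W]
    {v : ℕ → ℝ × E → W} (hv : IsSol X (fun _ _ => 0 : ℕ → E → W) v) {u : ℕ → E → W}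
    (hu : Smooth u) (h : ∀ k Y, v k (0, Y) = u k Y) (k : ℕ) (P : ℝ × E) :
    v k P = evol X Φ u k P :=
  hv.unique hΦ (hX 0) (isSol_evol hΦ hX hu) (fun k Y => by rw [h, evol_init hΦ]) k P

lemma evol_add (hΦ : GeneratesFlow (X 0) Φ) (hX : Smooth X) {u v : ℕ → E → W} (hu : Smooth u)
    (hv : Smooth v) (k : ℕ) (P : ℝ × E) :
    evol X Φ (fun k Y => u k Y + v k Y) k P = evol X Φ u k P + evol X Φ v k P := by
  have h1 := isSol_evol hΦ hX hu
  have h2 := isSol_evol hΦ hX hv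
  refine (IsSol.eq_evol hΦ hX (v := fun k P => evol X Φ u k P + evol X Φ v k P)
    ⟨h1.smooth.add h2.smooth, fun k P => ?_⟩ (hu.add hv) (fun k Y => ?_) k P).symm
  · rw [LD_add h1.smooth h2.smooth, h1.eq, h2.eq, add_zero]
  · rw [evol_init hΦ, evol_init hΦ]

lemma evol_mulEps (hΦ : GeneratesFlow (X 0) Φ) (hX : Smooth X) {u : ℕ → E → W} (hu : Smooth u)
    (k : ℕ) (P : ℝ × E) : evol X Φ (mulEps u) k P = mulEps (evol X Φ u) k P := by
  have h1 := isSol_evol hΦ hX hu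
  refine (IsSol.eq_evol hΦ hX (v := mulEps (evol X Φ u))
    ⟨h1.smooth.mulEps, fun k P => ?_⟩ hu.mulEps (fun k Y => ?_) k P).symm
  · rw [LD_mulEps]
    cases k
    exacts [rfl, h1.eq _ _]
  · cases k
    exacts [rfl, evol_init hΦ _ _ _]

lemma evol_clm_comp {W' : Type} [NormedAddCommGroup W'] [NormedSpace ℝ W'] [CompleteSpace W']
    (hΦ : GeneratesFlow (X 0) Φ) (hX : Smooth X) (l : W →L[ℝ] W') {u : ℕ → E → W}
    (hu : Smooth u) (k : ℕ) (P : ℝ × E) :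
    evol X Φ (fun k Y => l (u k Y)) k P = l (evol X Φ u k P) :=
  (((isSol_evol hΦ hX hu).clm_comp l).eq_evol hΦ hX (fun k => l.contDiff.comp (hu k))
    (fun k Y => by rw [evol_init hΦ]; rfl) k P).symm

lemma evol_mulS (hΦ : GeneratesFlow (X 0) Φ) (hX : Smooth X) {u v : ℕ → E → ℝ} (hu : Smooth u)
    (hv : Smooth v) (k : ℕ) (P : ℝ × E) :
    evol X Φ (mulS u v) k P = mulS (evol X Φ u) (evol X Φ v) k P :=
  ((isSol_mulS (isSol_evol hΦ hX hu) (isSol_evol hΦ hX hv)).eq_evol hΦ hX (hu.mulS hv)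
    (fun k Y => by simp only [mulS_apply, evol_init hΦ]) k P).symm

lemma evol_const (hΦ : GeneratesFlow (X 0) Φ) (hX : Smooth X) (c : W) (k : ℕ) (P : ℝ × E) :
    evol X Φ (lead fun _ => c) k P = lead (fun _ => c) k P.2 := by
  have hs : Smooth (lead fun _ : E => c) := smooth_lead contDiff_const
  refine (IsSol.eq_evol hΦ hX (v := fun k P => lead (fun _ => c) k P.2)
    ⟨hs.comp contDiff_snd, fun k P => ?_⟩ hs (fun k Y => rfl) k P).symm
  rw [LD_tf_comp_snd _ hs, LD_apply, Finset.sum_eq_zero, neg_zero]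
  intro p _
  have : lead (fun _ : E => c) p.2 = fun _ => if p.2 = 0 then c else 0 := rfl
  simp [this]

/-- A field commuting with `X` commutes with the evolution. -/
lemma evol_LD {Z : ℕ → E → E} (hΦ : GeneratesFlow (X 0) Φ) (hX : Smooth X) (hZ : Smooth Z)
    (h : FormallyCommute X Z) {u : ℕ → E → W} (hu : Smooth u) (k : ℕ) (τ : ℝ) (Y : E) :
    LD Z (fun k Y => evol X Φ u k (τ, Y)) k Y = evol X Φ (LD Z u) k (τ, Y) := by
  have h1 := isSol_evol hΦ hX hu
  rw [← LD_ext_slice Z h1.smooth]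
  refine IsSol.eq_evol hΦ hX ⟨hZ.ext.LD h1.smooth, fun k P => ?_⟩ (hZ.LD hu) (fun k Y => ?_) k _
  · have hc : FormallyCommute (tf X) (ext Z) := FormallyCommute.pair hX.neg hZ h.neg _ _
    have h2 : LD (tf X) (evol X Φ u) = fun _ _ => 0 := funext fun k => funext fun P => h1.eq k P
    rw [LD_comm hX.tf hZ.ext h1.smooth hc, h2]
    exact LD_zero _ k P
  · rw [LD_ext_slice Z h1.smooth]
    simp only [evol_init hΦ]

/-- If the evolution over a period is trivial on scalar functions, all solutions are periodic. -/
lemma IsSol.periodic (hΦ : GeneratesFlow (X 0) Φ) (hX : Smooth X) {c : ℝ}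
    (h : ∀ u : ℕ → E → ℝ, Smooth u → ∀ k Y, evol X Φ u k (c, Y) = u k Y)
    {v : ℕ → ℝ × E → W} (hv : IsSol X (fun _ _ => 0 : ℕ → E → W) v) (k : ℕ) (τ : ℝ) (Y : E) :
    v k (τ + c, Y) = v k (τ, Y) := by
  refine (hv.shift c).unique hΦ (hX 0) hv (fun k Y => ?_) k (τ, Y)
  rw [zero_add]
  -- The hypothesis concerns scalar series, so the values after one period are compared through
  -- linear functionals.
  refine eq_of_forall_clm fun l => ?_
  have hs : Smooth (fun k Y => l (v k (0, Y))) :=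
    fun k => l.contDiff.comp ((hv.smooth k).comp (by fun_prop))
  have h1 := (hv.clm_comp l).eq_evol hΦ hX hs (fun k Y => rfl) k (c, Y)
  rw [h1, h _ hs]

end

/-- The flow of the zero field. -/
lemma generatesFlow_id {X : ℕ → E → E} (h : ∀ Y, X 0 Y = 0) :
    GeneratesFlow (X 0) (fun _ Y => Y) :=
  ⟨fun _ => rfl, fun t Y => by rw [h]; exact hasDerivAt_const t Y⟩

/-! ### Multiplicative operators are determined by the coordinates -/

/-- The increment is the integral of the derivative along the segment from a to Y; expanding Y - a
in a basis gives the factors. -/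
lemma hadamard {f : E → ℝ} (hf : ContDiff ℝ ∞ f) (a : E) :
    ∃ g : Fin (Module.finrank ℝ E) → E → ℝ, (∀ i, ContDiff ℝ ∞ (g i)) ∧ ∀ Y, f Y = f a +
      ∑ i, ((Module.finBasis ℝ E).coord i Y - (Module.finBasis ℝ E).coord i a) * g i Y := by
  set b := Module.finBasis ℝ E
  have hdf : ContDiff ℝ ∞ (fderiv ℝ f) := hf.fderiv_right (by simp)
  have hsm : ∀ i, ContDiff ℝ ∞ (fun x : E × ℝ => fderiv ℝ f (a + x.2 • (x.1 - a)) (b i)) :=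
    fun i => (hdf.comp (by fun_prop)).clm_apply contDiff_const
  refine ⟨fun i Y => ∫ s in (0 : ℝ)..1, fderiv ℝ f (a + s • (Y - a)) (b i),
    fun i => contDiff_integral_unit _ (hsm i), fun Y => ?_⟩
  have hd : ∀ s : ℝ, HasDerivAt (fun s => f (a + s • (Y - a)))
      (fderiv ℝ f (a + s • (Y - a)) (Y - a)) s := fun s => by
    have := ((hf.differentiable (by simp) (a + s • (Y - a))).hasFDerivAt).comp_hasDerivAt s
      (((hasDerivAt_id s).smul_const (Y - a)).const_add a)
    simpa [Function.comp_def] using this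
  have hc : ∀ v, Continuous fun s : ℝ => fderiv ℝ f (a + s • (Y - a)) v := fun v =>
    (hdf.continuous.comp (by fun_prop)).clm_apply continuous_const
  have h1 := intervalIntegral.integral_eq_sub_of_hasDerivAt (a := 0) (b := 1)
    (fun s _ => hd s) ((hc _).intervalIntegrable _ _)
  have h2 : ∀ s : ℝ, fderiv ℝ f (a + s • (Y - a)) (Y - a) =
      ∑ i, (b.coord i Y - b.coord i a) * fderiv ℝ f (a + s • (Y - a)) (b i) := fun s => by
    conv_lhs => rw [← b.sum_repr (Y - a), map_sum, b.sum_repr (Y - a)]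
    refine Finset.sum_congr rfl fun i _ => ?_
    rw [map_smul, smul_eq_mul, ← map_sub]
    rfl
  simp only [h2] at h1
  rw [intervalIntegral.integral_finsetSum
    (fun i _ => ((hc (b i)).const_mul _).intervalIntegrable _ _)] at h1
  simp only [intervalIntegral.integral_const_mul] at h1
  simp at h1
  simp only [Module.Basis.coord_apply]
  rw [h1]
  ring

lemma lead_add_mulEps (u : ℕ → E → ℝ) :
    u = fun k Y => lead (u 0) k Y + mulEps (fun j => u (j + 1)) k Y := by
  funext k Y
  cases k <;> simp [lead, mulEps]

/-- Two formal evolutions which agree on linear functions agree on all functions. -/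
theorem evol_eq_evol {X X' : ℕ → E → E} {Φ Φ' : ℝ → E → E} (hΦ : GeneratesFlow (X 0) Φ)
    (hΦ' : GeneratesFlow (X' 0) Φ') (hX : Smooth X) (hX' : Smooth X') (c : ℝ)
    (h : ∀ (l : E →L[ℝ] ℝ) k Y, evol X Φ (lead l) k (c, Y) = evol X' Φ' (lead l) k (c, Y))
    (k : ℕ) : ∀ u : ℕ → E → ℝ, Smooth u →
      ∀ Y, evol X Φ u k (c, Y) = evol X' Φ' u k (c, Y) := by
  -- At order zero the hypothesis says that the two leading flows coincide at time c.
  have hflow : ∀ Y, Φ c Y = Φ' c Y := fun Y => eq_of_forall_clm fun l => by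
    have := h l 0 Y
    rwa [evol_zero_order hΦ, evol_zero_order hΦ', lead, if_pos rfl, lead, if_pos rfl] at this
  induction k using Nat.strong_induction_on with
  | _ k ih =>
  intro u hu Y
  cases k with
  | zero => rw [evol_zero_order hΦ, evol_zero_order hΦ', hflow]
  | succ m =>
  -- The evolutions agree at lower orders, so multiplicativity makes their discrepancy at order m +
  -- 1 a point derivation at Φ_c Y. It kills constants and linear functions, hence everything by
  -- Hadamard's lemma.
  set δ : (E → ℝ) → ℝ := fun f =>
    evol X Φ (lead f) (m + 1) (c, Y) - evol X' Φ' (lead f) (m + 1) (c, Y) with hδ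
  have hmul : ∀ f g, ContDiff ℝ ∞ f → ContDiff ℝ ∞ g →
      δ (fun Y => f Y * g Y) = f (Φ c Y) * δ g + δ f * g (Φ c Y) := by
    intro f g hf hg
    have hfs := smooth_lead hf
    have hgs := smooth_lead hg
    have e : lead (fun Y => f Y * g Y) = mulS (lead f) (lead g) :=
      funext fun k => funext fun Y => (mulS_lead f g k Y).symm
    simp only [hδ, e]
    rw [evol_mulS hΦ hX hfs hgs, evol_mulS hΦ' hX' hfs hgs, mulS_apply, mulS_apply,
      Finset.Nat.sum_antidiagonal_succ, Finset.Nat.sum_antidiagonal_succ]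
    cases m with
    | zero =>
      simp only [evol_zero_order hΦ, evol_zero_order hΦ', hflow, lead, if_pos]
      simp [evol_zero_order hΦ, evol_zero_order hΦ', hflow, lead]
      ring
    | succ m =>
      rw [Finset.Nat.sum_antidiagonal_succ', Finset.Nat.sum_antidiagonal_succ']
      have e2 : ∑ p ∈ Finset.HasAntidiagonal.antidiagonal m, evol X Φ (lead f) (p.1 + 1) (c, Y) *
          evol X Φ (lead g) (p.2 + 1) (c, Y) = ∑ p ∈ Finset.HasAntidiagonal.antidiagonal m,
          evol X' Φ' (lead f) (p.1 + 1) (c, Y) * evol X' Φ' (lead g) (p.2 + 1) (c, Y) := by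
        refine Finset.sum_congr rfl fun p hp => ?_
        rw [Finset.HasAntidiagonal.mem_antidiagonal] at hp
        rw [ih (p.1 + 1) (by omega) _ hfs, ih (p.2 + 1) (by omega) _ hgs]
      simp only [e2, evol_zero_order hΦ, evol_zero_order hΦ', hflow, lead, if_pos]
      ring
  have hadd : ∀ f g, ContDiff ℝ ∞ f → ContDiff ℝ ∞ g →
      δ (fun Y => f Y + g Y) = δ f + δ g := by
    intro f g hf hg
    have e : lead (fun Y => f Y + g Y) = fun k Y => lead f k Y + lead g k Y := by
      funext k Y
      by_cases hk : k = 0 <;> simp [lead, hk]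
    simp only [hδ, e]
    rw [evol_add hΦ hX (smooth_lead hf) (smooth_lead hg),
      evol_add hΦ' hX' (smooth_lead hf) (smooth_lead hg)]
    ring
  have hconst : ∀ r : ℝ, δ (fun _ => r) = 0 := fun r => by
    simp only [hδ]
    rw [evol_const hΦ hX, evol_const hΦ' hX', sub_self]
  have hlin : ∀ l : E →L[ℝ] ℝ, δ l = 0 := fun l => sub_eq_zero.2 (h l (m + 1) Y)
  have hsum : ∀ (s : Finset (Fin (Module.finrank ℝ E))) (F : Fin (Module.finrank ℝ E) → E → ℝ),
      (∀ i, ContDiff ℝ ∞ (F i)) → δ (fun Y => ∑ i ∈ s, F i Y) = ∑ i ∈ s, δ (F i) := by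
    intro s F hF
    induction s using Finset.induction_on with
    | empty => simpa using hconst 0
    | insert i s hi ih2 =>
      simp only [Finset.sum_insert hi]
      rw [hadd _ _ (hF i) (ContDiff.sum fun j _ => hF j), ih2]
  have hzero : ∀ f, ContDiff ℝ ∞ f → δ f = 0 := by
    intro f hf
    obtain ⟨g, hg, hfg⟩ := hadamard hf (Φ c Y)
    set b := Module.finBasis ℝ E
    set x : Fin (Module.finrank ℝ E) → E →L[ℝ] ℝ := fun i => (b.coord i).toContinuousLinearMap
    have hx : ∀ i (r : ℝ), ContDiff ℝ ∞ (fun Y => x i Y + r) :=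
      fun i r => (x i).contDiff.add contDiff_const
    have e : f = fun Y' => f (Φ c Y) + ∑ i, (x i Y' + -(x i (Φ c Y))) * g i Y' :=
      funext fun Y' => by rw [hfg Y']; simp [x, sub_eq_add_neg]
    rw [e, hadd _ _ contDiff_const (ContDiff.sum fun i _ => (hx i _).mul (hg i)), hconst,
      hsum _ (fun i Y' => (x i Y' + -(x i (Φ c Y))) * g i Y') (fun i => (hx i _).mul (hg i)),
      zero_add]
    refine Finset.sum_eq_zero fun i _ => ?_
    rw [hmul _ _ (hx i _) (hg i), hadd _ _ (x i).contDiff contDiff_const, hlin, hconst]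
    simp
  -- A general series is its leading function plus ε times a series, and the factor ε reduces the
  -- second part to order m.
  have hu' : Smooth (fun j => u (j + 1)) := fun j => hu (j + 1)
  rw [lead_add_mulEps u, evol_add hΦ hX (smooth_lead (hu 0)) hu'.mulEps,
    evol_add hΦ' hX' (smooth_lead (hu 0)) hu'.mulEps, sub_eq_zero.1 (hzero _ (hu 0)),
    evol_mulEps hΦ hX hu', evol_mulEps hΦ' hX' hu']
  exact congrArg _ (ih m (Nat.lt_succ_self m) _ hu' Y)

/-- The evolution over `c` is trivial if it is trivial on linear functions. -/
theorem evol_eq_self {X : ℕ → E → E} {Φ : ℝ → E → E} (hΦ : GeneratesFlow (X 0) Φ)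
    (hX : Smooth X) (c : ℝ)
    (h : ∀ (l : E →L[ℝ] ℝ) k Y, evol X Φ (lead l) k (c, Y) = lead l k Y)
    (u : ℕ → E → ℝ) (hu : Smooth u) (k : ℕ) (Y : E) : evol X Φ u k (c, Y) = u k Y := by
  set X' : ℕ → E → E := fun _ _ => 0
  have hΦ' : GeneratesFlow (X' 0) (fun _ Y => Y) := generatesFlow_id fun _ => rfl
  have h0 : ∀ {u : ℕ → E → ℝ} (_ : Smooth u) k Y, evol X' (fun _ Y => Y) u k (c, Y) = u k Y := by
    intro u hu k Y
    refine (IsSol.eq_evol hΦ' Smooth.zero (v := fun k P => u k P.2)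
      ⟨hu.comp contDiff_snd, fun k P => ?_⟩ hu (fun _ _ => rfl) k (c, Y)).symm
    rw [LD_tf_comp_snd _ hu]
    simp [LD_apply, X']
  rw [evol_eq_evol hΦ hΦ' hX Smooth.zero c (fun l k Y => ?_) k u hu, h0 hu]
  rw [h, h0 (smooth_lead l.contDiff)]

/-! ### Evolutions of small fields -/

/-- First order perturbation of a formal field with vanishing leading term. -/
lemma evol_sub_evol [CompleteSpace W] {X X' : ℕ → E → E} (hX : Smooth X) (hX' : Smooth X')
    (h0 : ∀ Y, X 0 Y = 0) (m : ℕ) (h : ∀ i ≤ m, ∀ Y, X i Y = X' i Y) {u : ℕ → E → W}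
    (hu : Smooth u) (τ : ℝ) (Y : E) :
    evol X (fun _ Y => Y) u (m + 1) (τ, Y) - evol X' (fun _ Y => Y) u (m + 1) (τ, Y) =
      τ • fderiv ℝ (u 0) Y (X (m + 1) Y - X' (m + 1) Y) := by
  have hΦ := generatesFlow_id h0
  have hΦ' := generatesFlow_id (X := X') fun Y => by rw [← h 0 m.zero_le, h0]
  have h1 := isSol_evol hΦ hX hu
  have h2 := isSol_evol hΦ' hX' hu
  have hd : Smooth (fun k P => evol X (fun _ Y => Y) u k P - evol X' (fun _ Y => Y) u k P) :=
    h1.smooth.sub h2.smooth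
  -- The difference solves an equation for ∂_τ - X whose source is X - X' applied to the second
  -- evolution; this source starts at order m + 1.
  have hres : ∀ k ≤ m + 1, ∀ P, LD (tf X) (fun k P => evol X (fun _ Y => Y) u k P -
      evol X' (fun _ Y => Y) u k P) k P =
      LD (ext fun k Y => X k Y - X' k Y) (evol X' (fun _ Y => Y) u) k P := by
    intro k _ P
    rw [LD_sub h1.smooth h2.smooth, h1.eq]
    have e : tf X = fun k P => tf X' k P - ext (fun k Y => X k Y - X' k Y) k P := by
      funext k P
      simp only [tf, ext, pair, Prod.mk_sub_mk, sub_zero]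
      congr 1
      abel
    rw [e, LD_sub_field, h2.eq]
    simp
  have hlow : ∀ k < m + 1, ∀ P, evol X (fun _ Y => Y) u k P - evol X' (fun _ Y => Y) u k P = 0 := by
    refine eq_zero_of_isSol_lt hΦ (hX 0) hd (fun k hk P => ?_)
      (fun k _ Y => by rw [evol_init hΦ, evol_init hΦ', sub_self])
    rw [hres k hk.le, LD_apply, Finset.sum_eq_zero]
    intro p hp
    rw [Finset.HasAntidiagonal.mem_antidiagonal] at hp
    rw [ext, pair, h p.1 (by omega), sub_self]
    exact map_zero _
  -- The leading fields vanish, so at order m + 1 the derivative in τ is constant and the difference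
  -- is linear in τ.
  have hder : ∀ τ, HasDerivAt (fun τ => evol X (fun _ Y => Y) u (m + 1) (τ, Y) -
      evol X' (fun _ Y => Y) u (m + 1) (τ, Y))
      (fderiv ℝ (u 0) Y (X (m + 1) Y - X' (m + 1) Y)) τ := by
    intro τ
    have h3 := hasDerivAt_slice (hd.differentiable (m + 1) (τ, Y))
    have h4 := hres (m + 1) le_rfl (τ, Y)
    rw [LD_eq_of_lt hlow, LD_eq_of_field_lt] at h4
    · have e1 : tf X 0 (τ, Y) = (1, 0) := by simp [tf, pair, h0]
      have e2 : evol X' (fun _ Y => Y) u 0 = fun P => u 0 P.2 :=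
        funext fun P => evol_zero_order hΦ' u P
      have e3 : ∀ v : E, fderiv ℝ (fun P : ℝ × E => u 0 P.2) (τ, Y) (0, v) = fderiv ℝ (u 0) Y v := by
        intro v
        rw [← fderiv_slice ((hu.comp contDiff_snd).differentiable 0 _)]
      rw [e1, e2, ext, pair, e3] at h4
      rw [← h4]
      exact h3
    · intro i hi
      rw [ext, pair, h i (by omega), sub_self]
      rfl
  have := eq_add_smul_of_hasDerivAt hder τ
  rw [this, evol_init hΦ, evol_init hΦ', sub_self, zero_add]

/-- A field commuting with the evolution of a small field commutes with the field. -/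
lemma formallyCommute_of_evol {X Z : ℕ → E → E} (hX : Smooth X) (hZ : Smooth Z)
    (h0 : ∀ Y, X 0 Y = 0) {c : ℝ} (hc : c ≠ 0)
    (h : ∀ u : ℕ → E → ℝ, Smooth u → ∀ k Y, LD Z (fun k Y => evol X (fun _ Y => Y) u k (c, Y)) k Y =
      evol X (fun _ Y => Y) (LD Z u) k (c, Y)) : FormallyCommute Z X := by
  have hΦ := generatesFlow_id h0
  rw [formallyCommute_iff]
  intro m
  induction m using Nat.strong_induction_on with
  | _ m ih =>
  intro Y
  refine eq_of_forall_clm fun l => ?_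
  rw [map_zero]
  have hu : Smooth (lead l) := smooth_lead l.contDiff
  -- The quantity studied is Z exp(τX)l - exp(τX)Zl. If the brackets vanish below order m, its
  -- coefficient of order m is τ l([Z, X]_m). By hypothesis it is zero at τ = c ≠ 0.
  set v := evol X (fun _ Y => Y) (lead l)
  have hv : IsSol X (fun _ _ => 0 : ℕ → E → ℝ) v := isSol_evol hΦ hX hu
  set w := evol X (fun _ Y => Y) (LD Z (lead l))
  have hw : IsSol X (fun _ _ => 0 : ℕ → E → ℝ) w := isSol_evol hΦ hX (hZ.LD hu)
  have hq : Smooth (LD (ext Z) v) := hZ.ext.LD hv.smooth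
  have hd : Smooth (fun k P => LD (ext Z) v k P - w k P) := hq.sub hw.smooth
  have hbr : fBracket (tf X) (ext Z) = ext (fBracket Z X) := by
    funext k P
    rw [tf, ext, fBracket_pair hX.neg hZ, fBracket_neg_left, fBracket_swap X Z, neg_neg]
    rfl
  have hres : ∀ k P, LD (tf X) (fun k P => LD (ext Z) v k P - w k P) k P =
      LD (ext (fBracket Z X)) v k P := by
    intro k P
    have e : LD (tf X) v = fun _ _ => 0 := funext fun k => funext fun P => hv.eq k P
    rw [LD_sub hq hw.smooth, hw.eq, sub_zero, ← hbr, ← LD_LD_sub_LD_LD hX.tf hZ.ext hv.smooth, e,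
      LD_zero, sub_zero]
  have hext : ∀ i < m, ∀ P, ext (fBracket Z X) i P = 0 := by
    intro i hi P
    rw [ext, pair, ih i hi]
    rfl
  have hinit : ∀ k Y, LD (ext Z) v k (0, Y) - w k (0, Y) = 0 := by
    intro k Y
    rw [LD_ext_slice Z hv.smooth, sub_eq_zero]
    simp only [v, w, evol_init hΦ]
  have hlow : ∀ k < m, ∀ P, LD (ext Z) v k P - w k P = 0 := by
    refine eq_zero_of_isSol_lt hΦ (hX 0) hd (fun k hk P => ?_) (fun k _ Y => hinit k Y)
    rw [hres, LD_eq_of_field_lt fun i hi => hext i (hi.trans hk) P, hext k hk]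
    exact map_zero _
  have hder : ∀ τ, HasDerivAt (fun τ => LD (ext Z) v m (τ, Y) - w m (τ, Y))
      (l (fBracket Z X m Y)) τ := by
    intro τ
    have h3 := hasDerivAt_slice (hd.differentiable m (τ, Y))
    have h4 := hres m (τ, Y)
    rw [LD_eq_of_lt hlow, LD_eq_of_field_lt fun i hi => hext i hi _] at h4
    have e1 : tf X 0 (τ, Y) = (1, 0) := by simp [tf, pair, h0]
    have e2 : v 0 = fun P => l P.2 := funext fun P => evol_zero_order hΦ _ P
    have e3 : ∀ x : E, fderiv ℝ (fun P : ℝ × E => l P.2) (τ, Y) (0, x) = l x := by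
      intro x
      rw [← fderiv_slice (l.differentiable.comp differentiable_snd _)]
      simp
    have e4 : ext (fBracket Z X) m (τ, Y) = (0, fBracket Z X m Y) := rfl
    rw [e1, e2, e4, e3] at h4
    rw [← h4]
    exact h3
  have h5 := eq_add_smul_of_hasDerivAt hder c
  rw [hinit, zero_add, LD_ext_slice Z hv.smooth, h _ hu, sub_self, eq_comm, smul_eq_mul,
    mul_eq_zero] at h5
  exact h5.resolve_left hc

end Evolution


/-! ### The formal logarithm of an evolution -/

section Logarithm

variable {E : Type} [NormedAddCommGroup E] [NormedSpace ℝ E] [FiniteDimensional ℝ E]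

/-- The formal field `Y`, without leading term, with `exp(c L_Y) = exp(c L_X)`. -/
def logField (X : ℕ → E → E) (Φ : ℝ → E → E) (c : ℝ) (k : ℕ) : E → E := fun Z =>
  -- At order k the evolution of a small field over time c is c times its k-th coefficient plus the
  -- contribution of the lower ones, that is, of the truncated field. The recursion solves for the
  -- k-th coefficient.
  if k = 0 then 0 else c⁻¹ • (evol X Φ (lead fun Y => Y) k (c, Z) -
    evol (fun j Z => if _ : j < k then logField X Φ c j Z else 0) (fun _ Y => Y)
      (lead fun Y => Y) k (c, Z))
termination_by k

variable {X : ℕ → E → E} {Φ : ℝ → E → E}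

lemma logField_zero (X : ℕ → E → E) (Φ : ℝ → E → E) (c : ℝ) (Z : E) : logField X Φ c 0 Z = 0 := by
  rw [logField, if_pos rfl]

lemma smooth_lead_id : Smooth (lead fun Y : E => Y) := smooth_lead contDiff_id

lemma smooth_trunc {Y : ℕ → E → E} {k : ℕ} (h : ∀ j < k, ContDiff ℝ ∞ (Y j)) :
    Smooth (fun j Z => if _ : j < k then Y j Z else 0) := fun j => by
  by_cases hj : j < k
  · simpa [hj] using h j hj
  · simpa [hj] using contDiff_const

lemma smooth_logField (hΦ : GeneratesFlow (X 0) Φ) (hX : Smooth X) (c : ℝ) :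
    Smooth (logField X Φ c) := by
  intro k
  induction k using Nat.strong_induction_on with
  | _ k ih =>
    have hs : ∀ {u : ℕ → ℝ × E → E}, Smooth u → ContDiff ℝ ∞ (fun Z => u k (c, Z)) :=
      fun hu => (hu k).comp (by fun_prop)
    by_cases hk : k = 0
    · subst hk
      exact contDiff_of_eq contDiff_const (logField_zero X Φ c)
    · have h0 : ∀ Z, (fun j Z => if _ : j < k then logField X Φ c j Z else 0) 0 Z = (0 : E) := by
        intro Z
        simp [logField_zero]
      have h1 := (isSol_evol (generatesFlow_id h0) (smooth_trunc ih) smooth_lead_id).smooth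
      have h2 := (isSol_evol hΦ hX smooth_lead_id).smooth
      refine contDiff_of_eq (((hs h2).sub (hs h1)).const_smul c⁻¹) fun Z => ?_
      rw [logField, if_neg hk]

/-- Comparing the field with its truncation by `evol_sub_evol` leaves exactly the term that the
recursion was designed to supply. Order zero is where the leading flow must have period c. -/
lemma evol_logField (hΦ : GeneratesFlow (X 0) Φ) (hX : Smooth X) {c : ℝ} (hc : c ≠ 0)
    (hper : ∀ Y, Φ c Y = Y) (k : ℕ) (Z : E) :
    evol (logField X Φ c) (fun _ Y => Y) (lead fun Y => Y) k (c, Z) =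
      evol X Φ (lead fun Y => Y) k (c, Z) := by
  have h0 := logField_zero X Φ c
  have hs := smooth_logField hΦ hX c
  cases k with
  | zero => rw [evol_zero_order hΦ, evol_zero_order (generatesFlow_id h0), hper]
  | succ m =>
    have h1 := evol_sub_evol hs (smooth_trunc (k := m + 1) fun j _ => hs j) h0 m
      (fun i hi Y => by simp [Nat.lt_succ_of_le hi]) smooth_lead_id c Z
    have h2 : fderiv ℝ (lead (fun Y : E => Y) 0) Z = ContinuousLinearMap.id ℝ E := fderiv_id
    rw [h2, sub_eq_iff_eq_add] at h1
    rw [h1]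
    simp only [lt_self_iff_false, dite_false, sub_zero, ContinuousLinearMap.id_apply]
    conv_lhs => rw [logField, if_neg m.succ_ne_zero, smul_inv_smul₀ hc]
    rw [sub_add_cancel]

/-- At the first order where the fields could differ, the difference of the evolutions of the
coordinates is c times that of the fields, by `evol_sub_evol`. -/
lemma eq_of_evol_eq {Y Y' : ℕ → E → E} (hY : Smooth Y) (hY' : Smooth Y') (h0 : ∀ Z, Y 0 Z = 0)
    (h0' : ∀ Z, Y' 0 Z = 0) {c : ℝ} (hc : c ≠ 0)
    (h : ∀ k Z, evol Y (fun _ Y => Y) (lead fun Y => Y) k (c, Z) =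
      evol Y' (fun _ Y => Y) (lead fun Y => Y) k (c, Z)) (k : ℕ) (Z : E) : Y k Z = Y' k Z := by
  induction k using Nat.strong_induction_on generalizing Z with
  | _ k ih =>
    cases k with
    | zero => rw [h0, h0']
    | succ m =>
      have h1 := evol_sub_evol hY hY' h0 m (fun i hi Z => ih i (Nat.lt_succ_of_le hi) Z)
        smooth_lead_id c Z
      have h2 : fderiv ℝ (lead (fun Y : E => Y) 0) Z = ContinuousLinearMap.id ℝ E := fderiv_id
      rw [h, sub_self, h2, eq_comm, smul_eq_zero] at h1
      exact sub_eq_zero.1 (h1.resolve_left hc)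

lemma evol_lead_clm (hΦ : GeneratesFlow (X 0) Φ) (hX : Smooth X) (l : E →L[ℝ] ℝ) (k : ℕ)
    (P : ℝ × E) : evol X Φ (lead l) k P = l (evol X Φ (lead fun Y => Y) k P) := by
  rw [← evol_clm_comp hΦ hX l smooth_lead_id]
  congr 1
  funext k Y
  by_cases hk : k = 0 <;> simp [lead, hk]

lemma evol_eq_evol_logField (hΦ : GeneratesFlow (X 0) Φ) (hX : Smooth X) {c : ℝ} (hc : c ≠ 0)
    (hper : ∀ Y, Φ c Y = Y) {u : ℕ → E → ℝ} (hu : Smooth u) (k : ℕ) (Z : E) :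
    evol X Φ u k (c, Z) = evol (logField X Φ c) (fun _ Y => Y) u k (c, Z) := by
  have hΨ := generatesFlow_id (logField_zero X Φ c)
  have hs := smooth_logField hΦ hX c
  refine evol_eq_evol hΦ hΨ hX hs c (fun l k Y => ?_) k u hu Z
  rw [evol_lead_clm hΦ hX, evol_lead_clm hΨ hs, evol_logField hΦ hX hc hper]

/-- The logarithm commutes with every field that commutes with `X`. -/
lemma formallyCommute_logField (hΦ : GeneratesFlow (X 0) Φ) (hX : Smooth X) {c : ℝ} (hc : c ≠ 0)
    (hper : ∀ Y, Φ c Y = Y) {Z : ℕ → E → E} (hZ : Smooth Z) (h : FormallyCommute X Z) :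
    FormallyCommute Z (logField X Φ c) := by
  -- Z commutes with the evolution of X over c, which is also that of the logarithm; this passes to
  -- the logarithm itself because it has no leading term.
  refine formallyCommute_of_evol (smooth_logField hΦ hX c) hZ (logField_zero X Φ c) hc
    fun u hu k Y => ?_
  have h1 : (fun k Y => evol (logField X Φ c) (fun _ Y => Y) u k (c, Y)) =
      fun k Y => evol X Φ u k (c, Y) :=
    funext fun k => funext fun Y => (evol_eq_evol_logField hΦ hX hc hper hu k Y).symm
  rw [h1, evol_LD hΦ hX hZ h hu, evol_eq_evol_logField hΦ hX hc hper (hZ.LD hu)]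

omit [FiniteDimensional ℝ E] in
lemma IsSol.fix_inner {W : Type} [NormedAddCommGroup W] [NormedSpace ℝ W]
    {H : ℕ → ℝ × ℝ × E → W} (hH : IsSol (ext X) (fun _ _ => 0 : ℕ → ℝ × E → W) H) (τ : ℝ) :
    IsSol X (fun _ _ => 0 : ℕ → E → W) (fun k P => H k (P.1, τ, P.2)) := by
  refine isSol_of_deriv (hH.smooth.comp (by fun_prop)) fun k σ Y => ?_
  rw [(hH.hasDerivAt k σ (τ, Y)).deriv,
    LD_ext_slice X (u := fun k P => H k (σ, P)) (hH.smooth.comp (by fun_prop))]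

omit [FiniteDimensional ℝ E] in
lemma isSol_fix_outer {W : Type} [NormedAddCommGroup W] [NormedSpace ℝ W]
    {H : ℕ → ℝ × ℝ × E → W} (hH : Smooth H) (h : ∀ k P, LD (ext (tf X)) H k P = 0) (σ : ℝ) :
    IsSol X (fun _ _ => 0 : ℕ → E → W) (fun k P => H k (σ, P)) :=
  ⟨hH.comp (by fun_prop), fun k P => by rw [← LD_ext_slice _ hH, h]⟩

/-- Removing the logarithm from `X` leaves a field with trivial evolution over `c`. -/
theorem evol_sub_logField (hΦ : GeneratesFlow (X 0) Φ) (hX : Smooth X) {c : ℝ} (hc : c ≠ 0)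
    (hper : ∀ Y, Φ c Y = Y) {u : ℕ → E → ℝ} (hu : Smooth u) (k : ℕ) (Z : E) :
    evol (fun k Y => X k Y - logField X Φ c k Y) Φ u k (c, Z) = u k Z := by
  set L := logField X Φ c with hL
  have hΨ := generatesFlow_id (logField_zero X Φ c)
  have hs : Smooth L := smooth_logField hΦ hX c
  have hcomm : FormallyCommute L X :=
    (formallyCommute_logField hΦ hX hc hper hX (formallyCommute_self X)).symm
  -- H(σ, τ) stands for exp(σL)exp(τX)u, so the evolution of X - L over c is H(-c, c).
  obtain ⟨H, hH, hH', hH0⟩ := exists_twoTime hΨ hΦ hs hX hcomm (p := fun _ _ => (0 : ℝ))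
    (q := fun _ _ => 0) (u₀ := u) Smooth.zero Smooth.zero hu
    (fun k Y => by rw [LD_zero, LD_zero])
  have hz := isSol_diagonal hH hH' (-1)
  have e : (fun k Y => X k Y - L k Y) = fun k Y => (-1 : ℝ) • L k Y + X k Y := by
    funext k Y
    rw [neg_one_smul]
    abel
  have hΦ' : GeneratesFlow ((fun k Y => (-1 : ℝ) • L k Y + X k Y) 0) Φ := by
    have : (fun Y => (-1 : ℝ) • L 0 Y + X 0 Y) = X 0 := by
      funext Y
      simp [hL, logField_zero]
    simp only [this]
    exact hΦ
  have hG : Smooth (fun k Y => (-1 : ℝ) • L k Y + X k Y) :=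
    fun k => ((hs k).const_smul (-1 : ℝ)).add (hX k)
  rw [e, ← hz.eq_evol hΦ' hG hu (fun k Y => by rw [mul_zero]; exact hH0 k Y)]
  -- At τ = c and σ = 0 the series H equals exp(cL)u, by the defining property of L. Running σ back
  -- to -c returns u.
  have hv := hH.fix_inner c
  have hw := isSol_fix_outer hH.smooth hH' 0
  have hv0 : ∀ k Y, H k (0, c, Y) = evol L (fun _ Y => Y) u k (c, Y) := fun k Y => by
    rw [← evol_eq_evol_logField hΦ hX hc hper hu]
    exact hw.eq_evol hΦ hX hu hH0 k (c, Y)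
  have ha := (isSol_evol hΨ hs hu).shift c
  have := hv.unique hΨ (hs 0) ha (fun k Y => by rw [zero_add]; exact hv0 k Y) k (-c, Z)
  simp only [neg_add_cancel, evol_init hΨ] at this
  rw [neg_one_mul]
  exact this

/-- If `X = G + Y` with `G`, `Y` commuting and `G` of trivial evolution over `c`, then `Y` is the
logarithm of `X`. -/
theorem evol_eq_of_split {G Y : ℕ → E → E} (hΦ : GeneratesFlow (G 0) Φ) (hG : Smooth G)
    (hY : Smooth Y) (h0 : ∀ Z, Y 0 Z = 0) (hcomm : FormallyCommute G Y)
    (hX : ∀ k Z, X k Z = G k Z + Y k Z) {c : ℝ}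
    (hper : ∀ u : ℕ → E → ℝ, Smooth u → ∀ k Z, evol G Φ u k (c, Z) = u k Z) (k : ℕ) (Z : E) :
    evol Y (fun _ Y => Y) (lead fun Y => Y) k (c, Z) = evol X Φ (lead fun Y => Y) k (c, Z) := by
  have hΨ := generatesFlow_id h0
  -- By commutation exp(cX) is exp(cY) composed with exp(cG), read on the diagonal of H, and the
  -- evolution of G is trivial over c.
  obtain ⟨H, hH, hH', hH0⟩ := exists_twoTime hΨ hΦ hY hG hcomm.symm (p := fun _ _ => (0 : E))
    (q := fun _ _ => 0) (u₀ := lead fun Y => Y) Smooth.zero Smooth.zero smooth_lead_id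
    (fun k Y => by rw [LD_zero, LD_zero])
  have hz := isSol_diagonal hH hH' 1
  have e : X = fun k Z => (1 : ℝ) • Y k Z + G k Z := by
    funext k Z
    rw [one_smul, hX, add_comm]
  have hΦ' : GeneratesFlow ((fun k Z => (1 : ℝ) • Y k Z + G k Z) 0) Φ := by
    have : (fun Z => (1 : ℝ) • Y 0 Z + G 0 Z) = G 0 := by
      funext Z
      simp [h0]
    simp only [this]
    exact hΦ
  have hs : Smooth (fun k Z => (1 : ℝ) • Y k Z + G k Z) :=
    fun k => ((hY k).const_smul (1 : ℝ)).add (hG k)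
  rw [e, ← hz.eq_evol hΦ' hs smooth_lead_id (fun k Y => by rw [mul_zero]; exact hH0 k Y)]
  have h1 := (isSol_fix_outer hH.smooth hH' c).periodic hΦ hG hper k 0 Z
  rw [zero_add] at h1
  rw [one_mul, h1, ← (hH.fix_inner 0).eq_evol hΨ hY smooth_lead_id hH0 k (c, Z)]

end Logarithm

/-! ### Averaged fields -/

section NormalForm

variable {n : ℕ} {w : Space n → ℝ} {G K : Space n → Space n}

/-- The series `Ǧ + ε Ǩ`. -/
def augField (w : Space n → ℝ) (G K : Space n → Space n) : ℕ → ℝ × Space n → ℝ × Space n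
  | 0 => lift (augG G)
  | 1 => lift (augK w K)
  | _ + 2 => fun _ => 0

lemma contDiff_lift {X : Space n → ℝ × Space n} (hX : ContDiff ℝ ∞ X) : ContDiff ℝ ∞ (lift X) :=
  hX.comp contDiff_snd

lemma contDiff_augG (hG : ContDiff ℝ ∞ G) : ContDiff ℝ ∞ (augG G) := contDiff_const.prodMk hG

lemma contDiff_augK (hw : ContDiff ℝ ∞ w) (hw0 : ∀ y, w y ≠ 0) (hK : ContDiff ℝ ∞ K) :
    ContDiff ℝ ∞ (augK w K) := (hw.inv hw0).prodMk ((hw.inv hw0).smul hK)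

lemma smooth_augField (hw : ContDiff ℝ ∞ w) (hw0 : ∀ y, w y ≠ 0) (hG : ContDiff ℝ ∞ G)
    (hK : ContDiff ℝ ∞ K) : Smooth (augField w G K)
  | 0 => contDiff_lift (contDiff_augG hG)
  | 1 => contDiff_lift (contDiff_augK hw hw0 hK)
  | _ + 2 => contDiff_const

lemma generatesFlow_lift_augG {Φ : ℝ → Space n → Space n} (hΦ : GeneratesFlow G Φ) :
    GeneratesFlow (lift (augG G)) (fun t P => (P.1, Φ t P.2)) :=
  ⟨fun P => by simp [hΦ.init], fun t P => (hasDerivAt_const t P.1).prodMk (hΦ.ode t P.2)⟩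

variable {Gε Kε : ℕ → Space n → ℝ × Space n}

lemma IsNormalForm.smooth_lift_G (h : IsNormalForm w G K Gε Kε) : Smooth (fun i => lift (Gε i)) :=
  fun k => contDiff_lift (h.smooth_G k)

lemma IsNormalForm.smooth_lift_K (h : IsNormalForm w G K Gε Kε) : Smooth (fun i => lift (Kε i)) :=
  fun k => contDiff_lift (h.smooth_K k)

lemma IsNormalForm.generatesFlow (h : IsNormalForm w G K Gε Kε) {Φ : ℝ → Space n → Space n}
    (hΦ : GeneratesFlow G Φ) :
    GeneratesFlow (lift (Gε 0)) (fun t P => (P.1, Φ t P.2)) := by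
  have : Gε 0 = augG G := funext h.split_zero
  rw [this]
  exact generatesFlow_lift_augG hΦ

lemma IsNormalForm.split (h : IsNormalForm w G K Gε Kε) (k : ℕ) (Z : ℝ × Space n) :
    augField w G K k Z = lift (Gε k) Z + mulEps (fun i => lift (Kε i)) k Z := by
  match k with
  | 0 => simp [augField, mulEps, lift, h.split_zero]
  | 1 => simp [augField, mulEps, lift, h.split_one]
  | k + 2 => simp [augField, mulEps, lift, h.split_succ]

/-- The evolution of the averaged field `Gε` is periodic. -/
lemma IsNormalForm.evol_eq_self (h : IsNormalForm w G K Gε Kε) {Φ : ℝ → Space n → Space n}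
    (hΦ : GeneratesFlow G Φ) (u : ℕ → ℝ × Space n → ℝ) (hu : Smooth u) (k : ℕ)
    (Z : ℝ × Space n) : evol (fun i => lift (Gε i)) (fun t P => (P.1, Φ t P.2)) u k
      (2 * Real.pi, Z) = u k Z := by
  have hΦ' := h.generatesFlow hΦ
  obtain ⟨φ, hφ, hper⟩ := h.periodic
  have hsol : IsSol (fun i => lift (Gε i)) (fun _ _ => 0 : ℕ → ℝ × Space n → ℝ × Space n)
      (fun k P => φ k P.1 P.2) :=
    isSol_of_deriv hφ.smooth fun k τ Y => by rw [hφ.eq, add_zero]; rfl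
  have hinit : ∀ k Y, φ k 0 Y = lead (fun Y => Y) k Y := by
    intro k Y
    cases k
    exacts [hφ.init_zero Y, hφ.init_succ _ Y]
  refine HighOsc.evol_eq_self hΦ' h.smooth_lift_G _ (fun l k Y => ?_) u hu k Z
  rw [evol_lead_clm hΦ' h.smooth_lift_G,
    ← hsol.eq_evol hΦ' h.smooth_lift_G smooth_lead_id hinit k (2 * Real.pi, Y)]
  have := hper k 0 Y
  rw [zero_add] at this
  simp only [this, hinit]
  by_cases hk : k = 0 <;> simp [lead, hk]

lemma formallyCommute_mulEps {E : Type} [NormedAddCommGroup E] [NormedSpace ℝ E]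
    {X Z : ℕ → E → E} : FormallyCommute X (mulEps Z) ↔ FormallyCommute X Z := by
  have h0 : ∀ k Y, VectorField.lieBracket ℝ (X k) (mulEps Z 0) Y = 0 := by
    intro k Y
    have : mulEps Z 0 = fun _ => 0 := rfl
    simp [VectorField.lieBracket, this]
  have h1 : ∀ k Y, fBracket X (mulEps Z) (k + 1) Y = fBracket X Z k Y := by
    intro k Y
    rw [fBracket, Finset.Nat.sum_antidiagonal_succ', h0, zero_add]
    rfl
  rw [formallyCommute_iff, formallyCommute_iff]
  refine ⟨fun h k Y => by rw [← h1, h], fun h k Y => ?_⟩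
  cases k with
  | zero => simp [fBracket, h0]
  | succ k => rw [h1, h]

/-- For every pair of averaged fields, εK^ε has the same evolution over 2π as Ǧ + εǨ, and a field
without leading term is determined by its evolution. The splitting then determines G^ε. -/
lemma IsNormalForm.unique {Φ : ℝ → Space n → Space n} (hΦ : GeneratesFlow G Φ)
    {Gε' Kε' : ℕ → Space n → ℝ × Space n} (h : IsNormalForm w G K Gε Kε)
    (h' : IsNormalForm w G K Gε' Kε') : Gε = Gε' ∧ Kε = Kε' := by
  have key : ∀ {Gε Kε : ℕ → Space n → ℝ × Space n}, IsNormalForm w G K Gε Kε → ∀ k Z,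
      evol (mulEps fun i => lift (Kε i)) (fun _ Y => Y) (lead fun Y => Y) k (2 * Real.pi, Z) =
      evol (augField w G K) (fun t P => (P.1, Φ t P.2)) (lead fun Y => Y) k (2 * Real.pi, Z) :=
    fun h => evol_eq_of_split (h.generatesFlow hΦ) h.smooth_lift_G h.smooth_lift_K.mulEps
      (fun _ => rfl) (formallyCommute_mulEps.2 h.commute) h.split (h.evol_eq_self hΦ)
  have hK' : ∀ k Z, mulEps (fun i => lift (Kε i)) k Z = mulEps (fun i => lift (Kε' i)) k Z :=
    eq_of_evol_eq h.smooth_lift_K.mulEps h'.smooth_lift_K.mulEps (fun _ => rfl) (fun _ => rfl)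
      Real.two_pi_pos.ne' (fun k Z => by rw [key h, key h'])
  constructor
  · funext k y
    have h1 := h.split k (0, y)
    rw [h'.split, hK'] at h1
    exact (add_right_cancel h1).symm
  · funext k y
    exact hK' (k + 1) (0, y)

/-- The logarithm L of Ǧ + εǨ over 2π has no leading term, so it can be divided by ε to give K^ε;
the remainder Ǧ + εǨ - L is G^ε. Neither depends on t, because translations in t commute with the
augmented field and hence with its logarithm. -/
theorem exists_isNormalForm (hw : ContDiff ℝ ∞ w) (hw0 : ∀ y, w y ≠ 0) (hG : ContDiff ℝ ∞ G)
    (hK : ContDiff ℝ ∞ K) {Φ : ℝ → Space n → Space n} (hΦ : GeneratesFlow G Φ)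
    (hper : ∀ y, Φ (2 * Real.pi) y = y) :
    ∃ Gε Kε : ℕ → Space n → ℝ × Space n, IsNormalForm w G K Gε Kε := by
  set X := augField w G K with hXdef
  set Φ' : ℝ → ℝ × Space n → ℝ × Space n := fun t P => (P.1, Φ t P.2)
  have hX : Smooth X := smooth_augField hw hw0 hG hK
  have hΦ' : GeneratesFlow (X 0) Φ' := generatesFlow_lift_augG hΦ
  have hc : 2 * Real.pi ≠ 0 := Real.two_pi_pos.ne'
  have hper' : ∀ Y, Φ' (2 * Real.pi) Y = Y := fun Y => Prod.ext rfl (hper Y.2)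
  set L := logField X Φ' (2 * Real.pi)
  have hL : Smooth L := smooth_logField hΦ' hX _
  have hL0 : ∀ Z, L 0 Z = 0 := logField_zero _ _ _
  have hcomm : FormallyCommute X L :=
    formallyCommute_logField hΦ' hX hc hper' hX (formallyCommute_self X)
  -- invariance under translations of `t`
  set D : ℕ → ℝ × Space n → ℝ × Space n := lead fun _ => (1, 0)
  have hDk : ∀ k, fderiv ℝ (D k) = 0 := by
    intro k
    have : D k = fun _ => if k = 0 then (1, 0) else 0 := rfl
    funext Z
    simp [this]
  have hD : Smooth D := smooth_lead contDiff_const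
  have hXt : ∀ k Z, fderiv ℝ (X k) Z (1, 0) = 0 := by
    intro k Z
    have key : ∀ {F : Space n → ℝ × Space n}, ContDiff ℝ ∞ F →
        fderiv ℝ (lift F) Z (1, 0) = 0 := by
      intro F hF
      have h1 : HasFDerivAt (lift F) _ Z :=
        (hF.differentiable (by simp) Z.2).hasFDerivAt.comp Z hasFDerivAt_snd
      rw [h1.fderiv]
      simp
    match k with
    | 0 => exact key (contDiff_augG hG)
    | 1 => exact key (contDiff_augK hw hw0 hK)
    | k + 2 =>
      have : X (k + 2) = fun _ => 0 := rfl
      simp [this]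
  have hDbr : ∀ (F : ℕ → ℝ × Space n → ℝ × Space n) k Z, fBracket D F k Z =
      fderiv ℝ (F k) Z (1, 0) := by
    intro F k Z
    rw [fBracket, sum_antidiagonal_eq_add_fin (fun i j => VectorField.lieBracket ℝ (D i) (F j) Z),
      Finset.sum_eq_zero]
    · simp [VectorField.lieBracket, hDk, D, lead]
    · intro j _
      have : k - (j : ℕ) ≠ 0 := by have := j.2; omega
      simp [VectorField.lieBracket, hDk, D, lead, this]
  have hDX : FormallyCommute X D :=
    FormallyCommute.symm (formallyCommute_iff.2 fun k Z => by rw [hDbr, hXt])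
  have hDL := formallyCommute_iff.1 (formallyCommute_logField hΦ' hX hc hper' hD hDX)
  have hLt : ∀ k Z, L k Z = L k (0, Z.2) := by
    intro k Z
    have hd : ∀ s, HasDerivAt (fun s => L k (s, Z.2)) 0 s := by
      intro s
      have := hasDerivAt_slice (hL.differentiable k (s, Z.2))
      rwa [← hDbr, hDL] at this
    exact is_const_of_deriv_eq_zero (fun s => (hd s).differentiableAt) (fun s => (hd s).deriv) Z.1 0
  have hXt' : ∀ k Z, X k Z = X k (0, Z.2) := by
    intro k Z
    match k with
    | 0 => rfl
    | 1 => rfl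
    | k + 2 => rfl
  set A : ℕ → ℝ × Space n → ℝ × Space n := fun k Z => X k Z - L k Z
  have hA : Smooth A := hX.sub hL
  have hA0 : A 0 = X 0 := by
    funext Z
    simp [A, hL0]
  have hΦA : GeneratesFlow (A 0) Φ' := hA0 ▸ hΦ'
  have hGl : (fun i => lift fun y => A i (0, y)) = A := by
    funext i Z
    simp only [lift, A]
    rw [← hXt', ← hLt]
  have hKl : mulEps (fun i => lift fun y => L (i + 1) (0, y)) = L := by
    funext i Z
    cases i with
    | zero => exact (hL0 Z).symm
    | succ i => exact (hLt (i + 1) Z).symm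
  have hflow := isSol_evol hΦA hA smooth_lead_id
  refine ⟨fun k y => A k (0, y), fun k y => L (k + 1) (0, y), fun k => (hA k).comp (by fun_prop),
    fun k => (hL (k + 1)).comp (by fun_prop), fun y => ?_, fun y => ?_, fun k y => ?_, ?_, ?_⟩
  · rw [hA0]
    rfl
  · simp [A, X, augField, lift]
  · simp [A, X, augField]
  · rw [← formallyCommute_mulEps, hKl, hGl]
    have e : A = fun k Z => X k Z + -L k Z := by
      funext k Z
      exact sub_eq_add_neg _ _
    rw [e]
    exact FormallyCommute.add hX hL.neg hcomm (formallyCommute_self L).neg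
  · rw [hGl]
    refine ⟨fun k τ Z => evol A Φ' (lead fun Y => Y) k (τ, Z), ⟨hflow.smooth, fun Y => ?_,
      fun k Y => ?_, fun k τ Y => ?_⟩, fun k τ Y => ?_⟩
    · rw [evol_init hΦA]
      rfl
    · rw [evol_init hΦA]
      rfl
    · rw [(hflow.hasDerivAt k τ Y).deriv, add_zero]
      rfl
    · exact hflow.periodic hΦA hA
        (fun u hu k Y => evol_sub_logField hΦ' hX hc hper' hu k Y) k τ Y

end NormalForm


/-! ### Algebra of formal functions -/

section Algebra

variable {E W : Type} [NormedAddCommGroup E] [NormedSpace ℝ E] [NormedAddCommGroup W]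
  [NormedSpace ℝ W]

lemma mk_mulSeries (a b : ℕ → ℝ) :
    PowerSeries.mk (mulSeries a b) = PowerSeries.mk a * PowerSeries.mk b := by
  ext k
  simp [PowerSeries.coeff_mul, mulSeries]

lemma mk_add (a b : ℕ → ℝ) :
    (PowerSeries.mk fun k => a k + b k) = PowerSeries.mk a + PowerSeries.mk b := by
  ext k
  simp

lemma mk_sub (a b : ℕ → ℝ) :
    (PowerSeries.mk fun k => a k - b k) = PowerSeries.mk a - PowerSeries.mk b := by
  ext k
  simp

lemma mk_injective {a b : ℕ → ℝ} (h : PowerSeries.mk a = PowerSeries.mk b) (k : ℕ) :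
    a k = b k := by
  simpa using congrArg (PowerSeries.coeff k) h

lemma mk_mulS (u v : ℕ → E → ℝ) (Y : E) : (PowerSeries.mk fun k => mulS u v k Y) =
    (PowerSeries.mk fun k => u k Y) * PowerSeries.mk fun k => v k Y :=
  mk_mulSeries _ _

/-- Product of a scalar and a vector valued formal function. -/
def smulS (c : ℕ → E → ℝ) (X : ℕ → E → W) (k : ℕ) (Y : E) : W :=
  mulSeries (fun i => c i Y) (fun i => X i Y) k

lemma Smooth.smulS {c : ℕ → E → ℝ} {X : ℕ → E → W} (hc : Smooth c) (hX : Smooth X) :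
    Smooth (smulS c X) :=
  fun k => ContDiff.sum (s := Finset.HasAntidiagonal.antidiagonal k)
    fun p _ => (hc p.1).smul (hX p.2)

lemma applySeries_mulSeries (c : ℕ → ℝ) (v : ℕ → E) (L : ℕ → E →L[ℝ] ℝ) (k : ℕ) :
    applySeries (mulSeries c v) L k = mulSeries c (applySeries v L) k := by
  simp only [applySeries, mulSeries, map_sum, map_smul, Finset.smul_sum]
  exact (sum_antidiagonal_assoc (fun i j l => c i • L l (v j)) k).symm

lemma mk_applySeries_mulSeries (c : ℕ → ℝ) (v : ℕ → E) (L : ℕ → E →L[ℝ] ℝ) :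
    PowerSeries.mk (applySeries (mulSeries c v) L) =
      PowerSeries.mk c * PowerSeries.mk (applySeries v L) := by
  rw [← mk_mulSeries]
  congr 1
  funext k
  exact applySeries_mulSeries c v L k

lemma applySeries_sub (v v' : ℕ → E) (L : ℕ → E →L[ℝ] ℝ) (k : ℕ) :
    applySeries (fun k => v k - v' k) L k = applySeries v L k - applySeries v' L k := by
  simp [applySeries, Finset.sum_sub_distrib]

lemma mk_LD_smulS (c : ℕ → E → ℝ) (X : ℕ → E → E) (u : ℕ → E → ℝ) (Y : E) :
    (PowerSeries.mk fun k => LD (smulS c X) u k Y) =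
      (PowerSeries.mk fun k => c k Y) * PowerSeries.mk fun k => LD X u k Y :=
  mk_applySeries_mulSeries _ _ _

/-- The inverse of a formal function. -/
def invS (c : ℕ → E → ℝ) (k : ℕ) (Y : E) : ℝ :=
  PowerSeries.coeff k (PowerSeries.mk fun k => c k Y)⁻¹

lemma mk_invS (c : ℕ → E → ℝ) (Y : E) :
    (PowerSeries.mk fun k => invS c k Y) = (PowerSeries.mk fun k => c k Y)⁻¹ := by
  ext k
  simp [invS]

lemma mul_mk_invS {c : ℕ → E → ℝ} {Y : E} (h : c 0 Y ≠ 0) :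
    ((PowerSeries.mk fun k => c k Y) * PowerSeries.mk fun k => invS c k Y) = 1 := by
  rw [mk_invS, PowerSeries.mul_inv_cancel]
  rwa [← PowerSeries.coeff_zero_eq_constantCoeff_apply, PowerSeries.coeff_mk]

lemma invS_zero (c : ℕ → E → ℝ) (Y : E) : invS c 0 Y = (c 0 Y)⁻¹ := by
  rw [invS, PowerSeries.coeff_inv, if_pos rfl, ← PowerSeries.coeff_zero_eq_constantCoeff_apply,
    PowerSeries.coeff_mk]

lemma Smooth.invS {c : ℕ → E → ℝ} (hc : Smooth c) (h : ∀ Y, c 0 Y ≠ 0) : Smooth (invS c) := by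
  intro k
  induction k using Nat.strong_induction_on with
  | _ k ih =>
    by_cases hk : k = 0
    · subst hk
      exact contDiff_of_eq ((hc 0).inv h) (invS_zero c)
    · have h1 : ∀ x ∈ Finset.HasAntidiagonal.antidiagonal k,
          ContDiff ℝ ∞ fun Y => if x.2 < k then c x.1 Y * HighOsc.invS c x.2 Y else 0 := by
        intro x _
        by_cases hx : x.2 < k
        · simp only [if_pos hx]
          exact (hc _).mul (ih _ hx)
        · simp only [if_neg hx]
          exact contDiff_const
      refine contDiff_of_eq (((hc 0).inv h).neg.mul (ContDiff.sum h1)) fun Y => ?_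
      rw [HighOsc.invS, PowerSeries.coeff_inv, if_neg hk,
        ← PowerSeries.coeff_zero_eq_constantCoeff_apply]
      simp [HighOsc.invS]

lemma smulS_zero (c : ℕ → E → ℝ) (X : ℕ → E → W) (Y : E) : smulS c X 0 Y = c 0 Y • X 0 Y := by
  simp [smulS, mulSeries]

/-- Linear functions suffice: on l, viewed as a series of order zero, the commutator of the
derivations has coefficients l([X, Z]_k). -/
lemma formallyCommute_of_LD [FiniteDimensional ℝ E] {X Z : ℕ → E → E} (hX : Smooth X)
    (hZ : Smooth Z)
    (h : ∀ u : ℕ → E → ℝ, Smooth u → ∀ k Y, LD X (LD Z u) k Y = LD Z (LD X u) k Y) :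
    FormallyCommute X Z := by
  rw [formallyCommute_iff]
  intro k Y
  refine eq_of_forall_clm fun l => ?_
  have hl : Smooth (lead l) := smooth_lead l.contDiff
  have h1 := LD_LD_sub_LD_LD hX hZ hl k Y
  rw [h _ hl, sub_self, LD_apply, sum_antidiagonal_swap
    (fun i j => fderiv ℝ (lead l j) Y (fBracket X Z i Y)),
    Finset.Nat.sum_antidiagonal_eq_sum_range_succ
      (fun i j => fderiv ℝ (lead l i) Y (fBracket X Z j Y)), Finset.sum_range_succ'] at h1
  have h0 : lead (⇑l) 0 = l := rfl
  rw [Finset.sum_eq_zero, zero_add, h0, l.fderiv] at h1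
  · simpa using h1.symm
  · intro i _
    have : lead (⇑l) (i + 1) = fun _ => 0 := rfl
    simp [this]

/-- The quotient fields `a = K / κ` and `b = G - g a` commute if `(g, G)` and `(κ, K)` do. -/
lemma formallyCommute_quotient [FiniteDimensional ℝ E] {κ g : ℕ → E → ℝ} {G₂ K₂ a b : ℕ → E → E}
    (hκ : Smooth κ) (hg : Smooth g) (ha : Smooth a) (hb : Smooth b)
    (hκ0 : ∀ Y, κ 0 Y ≠ 0) (hK : smulS κ a = K₂) (hG : (fun k Y => b k Y + smulS g a k Y) = G₂)
    (h1 : FormallyCommute G₂ K₂) (h2 : ∀ k Y, LD G₂ κ k Y = LD K₂ g k Y) :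
    FormallyCommute a b := by
  have hK₂ : Smooth K₂ := hK ▸ hκ.smulS ha
  have hG₂ : Smooth G₂ := hG ▸ hb.add (hg.smulS ha)
  have eK : ∀ (u : ℕ → E → ℝ) Y, (PowerSeries.mk fun k => LD K₂ u k Y) =
      (PowerSeries.mk fun k => κ k Y) * PowerSeries.mk fun k => LD a u k Y := by
    intro u Y
    rw [← hK, mk_LD_smulS]
  have eG : ∀ (u : ℕ → E → ℝ) Y, (PowerSeries.mk fun k => LD G₂ u k Y) =
      (PowerSeries.mk fun k => LD b u k Y) +
        (PowerSeries.mk fun k => g k Y) * PowerSeries.mk fun k => LD a u k Y := by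
    intro u Y
    rw [← hG, ← mk_LD_smulS, ← mk_add]
    simp only [LD_add_field]
  have eM : ∀ (Z : ℕ → E → E) {u v : ℕ → E → ℝ} (_ : Smooth u) (_ : Smooth v) Y,
      (PowerSeries.mk fun k => LD Z (mulS u v) k Y) =
      (PowerSeries.mk fun k => LD Z u k Y) * (PowerSeries.mk fun k => v k Y) +
      (PowerSeries.mk fun k => u k Y) * (PowerSeries.mk fun k => LD Z v k Y) := by
    intro Z u v hu hv Y
    rw [← mk_mulS, ← mk_mulS, ← mk_add]
    simp only [LD_mulS hu hv]
  -- As derivations K₂ = κa and G₂ = b + ga, so [G₂, K₂] = κ[b, a] + (G₂κ - K₂g)a. The parenthesis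
  -- vanishes by `h2`, and κ is invertible as a power series at each point.
  refine formallyCommute_of_LD ha hb fun u hu k Y => ?_
  have hau := ha.LD hu
  have hbu := hb.LD hu
  have fK : LD K₂ u = mulS κ (LD a u) := by
    funext k Y
    refine mk_injective (a := fun k => LD K₂ u k Y) (b := fun k => mulS κ (LD a u) k Y) ?_ k
    rw [eK, mk_mulS]
  have fG : LD G₂ u = fun k Y => LD b u k Y + mulS g (LD a u) k Y := by
    funext k Y
    refine mk_injective (a := fun k => LD G₂ u k Y)
      (b := fun k => LD b u k Y + mulS g (LD a u) k Y) ?_ k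
    rw [eG, mk_add, mk_mulS]
  have c1 : (PowerSeries.mk fun k => LD G₂ (LD K₂ u) k Y) =
      PowerSeries.mk fun k => LD K₂ (LD G₂ u) k Y := by
    congr 1
    funext k
    exact LD_comm hG₂ hK₂ hu h1 k Y
  have c2 : (PowerSeries.mk fun k => LD G₂ κ k Y) = PowerSeries.mk fun k => LD K₂ g k Y := by
    congr 1
    funext k
    exact h2 k Y
  have e3 : (PowerSeries.mk fun k => LD a (fun k Y => LD b u k Y + mulS g (LD a u) k Y) k Y) =
      (PowerSeries.mk fun k => LD a (LD b u) k Y) +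
        PowerSeries.mk fun k => LD a (mulS g (LD a u)) k Y := by
    rw [← mk_add]
    simp only [LD_add hbu (hg.mulS hau)]
  rw [fK, fG, eG, eK, e3, eM _ hκ hau, eM _ hκ hau, eM _ hg hau] at c1
  rw [eG, eK] at c2
  have hinv := mul_mk_invS (hκ0 Y)
  refine mk_injective (a := fun k => LD a (LD b u) k Y) (b := fun k => LD b (LD a u) k Y) ?_ k
  linear_combination (-(PowerSeries.mk fun k => invS κ k Y)) * c1 +
    (PowerSeries.mk fun k => invS κ k Y) * (PowerSeries.mk fun k => LD a u k Y) * c2 +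
    ((PowerSeries.mk fun k => LD b (LD a u) k Y) - (PowerSeries.mk fun k => LD a (LD b u) k Y)) * hinv

end Algebra


/-! ### The systems for the profile and the phase -/

section Systems

variable {n : ℕ} {w : Space n → ℝ} {G K : Space n → Space n} {Gε Kε : ℕ → Space n → ℝ × Space n}

/-- Common form of the systems for the profile (`σ = 0`) and for the phase (`σ = 1`). -/
structure IsSystemSol (Gε Kε : ℕ → Space n → ℝ × Space n) (σ : ℝ) (u₀ : Space n → ℝ)
    (h : ℕ → ℝ → ℝ → Space n → ℝ) : Prop where
  smooth : SmoothSeries h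
  eq_t : ∀ t τ y k, tOperator Kε h t τ y k = if k = 0 then σ else 0
  eq_tau : ∀ t τ y k, tauOperator Gε Kε h t τ y k = -(σ * (Gε k y).1)
  init : ∀ k y, h k 0 0 y = lead u₀ k y

lemma isProfile_iff {f₀ : Space n → ℝ} {h : ℕ → ℝ → ℝ → Space n → ℝ} :
    IsProfile Gε Kε f₀ h ↔ IsSystemSol Gε Kε 0 f₀ h := by
  constructor
  · refine fun H => ⟨H.smooth, fun t τ y k => by simp [H.eq_t], fun t τ y k => by simp [H.eq_tau],
      fun k y => ?_⟩
    cases k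
    exacts [H.init_zero y, H.init_succ _ y]
  · exact fun H => ⟨H.smooth, fun t τ y k => by simp [H.eq_t], fun t τ y k => by simp [H.eq_tau],
      fun y => H.init 0 y, fun k y => H.init (k + 1) y⟩

lemma isPhase_iff {S : ℕ → ℝ → ℝ → Space n → ℝ} :
    IsPhase Gε Kε S ↔ IsSystemSol Gε Kε 1 (fun _ => 0) S :=
  ⟨fun H => ⟨H.smooth, H.eq_t, fun t τ y k => by rw [H.eq_tau, one_mul],
      fun k y => by rw [H.init, lead, ite_self]⟩,
    fun H => ⟨H.smooth, H.eq_t, fun t τ y k => by rw [H.eq_tau, one_mul],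
      fun k y => by rw [H.init, lead, ite_self]⟩⟩

/-- The formal field `Kε₂ / Kε₁`. -/
def quotK (Kε : ℕ → Space n → ℝ × Space n) : ℕ → Space n → Space n :=
  smulS (invS fun k y => (Kε k y).1) (fun k y => (Kε k y).2)

/-- The formal field `Gε₂ - (Gε₁ / Kε₁) Kε₂`. -/
def quotG (Gε Kε : ℕ → Space n → ℝ × Space n) (k : ℕ) (y : Space n) : Space n :=
  (Gε k y).2 - smulS (fun k y => (Gε k y).1) (quotK Kε) k y

lemma smulS_smulS_invS {E W : Type} [NormedAddCommGroup E] [NormedSpace ℝ E]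
    [NormedAddCommGroup W] [NormedSpace ℝ W] {c : ℕ → E → ℝ} (h : ∀ Y, c 0 Y ≠ 0)
    (X : ℕ → E → W) : smulS c (smulS (invS c) X) = X := by
  funext k Y
  have h1 : ∀ j, ∑ q ∈ Finset.HasAntidiagonal.antidiagonal j, c q.1 Y * invS c q.2 Y =
      if j = 0 then 1 else 0 := by
    intro j
    have := congrArg (PowerSeries.coeff j) (mul_mk_invS (h Y))
    rw [PowerSeries.coeff_mul, PowerSeries.coeff_one] at this
    simpa using this
  simp only [smulS, mulSeries, Finset.smul_sum, smul_smul]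
  rw [sum_antidiagonal_assoc (fun i j l => (c i Y * invS c j Y) • X l Y)]
  simp only [← Finset.sum_smul, h1]
  rw [Finset.Nat.sum_antidiagonal_eq_sum_range_succ
    (fun i j => (if i = 0 then (1 : ℝ) else 0) • X j Y), Finset.sum_range_succ']
  simp

/-- Nothing depends on t, so the bracket in (t, y) splits: its y-component is the bracket of the
y-components, and its t-component is the difference of two derivatives in y. -/
lemma formallyCommute_lift (hG : ∀ k, ContDiff ℝ ∞ (Gε k)) (hK : ∀ k, ContDiff ℝ ∞ (Kε k))
    (h : FormallyCommute (fun i => lift (Gε i)) (fun i => lift (Kε i))) :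
    FormallyCommute (fun k y => (Gε k y).2) (fun k y => (Kε k y).2) ∧
    ∀ k y, LD (fun k y => (Gε k y).2) (fun k y => (Kε k y).1) k y =
      LD (fun k y => (Kε k y).2) (fun k y => (Gε k y).1) k y := by
  have h1 : ∀ {X : Space n → ℝ × Space n} (_ : ContDiff ℝ ∞ X) (Y v : ℝ × Space n),
      fderiv ℝ (lift X) Y v = (fderiv ℝ (fun y => (X y).1) Y.2 v.2,
        fderiv ℝ (fun y => (X y).2) Y.2 v.2) := by
    intro X hX Y v
    have hd := (hX.differentiable (by simp) Y.2).hasFDerivAt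
    have h0 : HasFDerivAt (lift X) _ Y := hd.comp Y hasFDerivAt_snd
    have h1 : HasFDerivAt (fun y => (X y).1) _ Y.2 := hasFDerivAt_fst.comp Y.2 hd
    have h2 : HasFDerivAt (fun y => (X y).2) _ Y.2 := hasFDerivAt_snd.comp Y.2 hd
    rw [h0.fderiv, h1.fderiv, h2.fderiv]
    rfl
  have h2 : ∀ k y, _ := fun k (y : Space n) => h k (0, y)
  simp only [VectorField.lieBracket, h1 (hG _), h1 (hK _)] at h2
  refine ⟨fun k y => ?_, fun k y => ?_⟩
  · have := congrArg Prod.snd (h2 k y)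
    rw [Prod.snd_sum] at this
    exact this
  · have := congrArg Prod.fst (h2 k y)
    rw [Prod.fst_sum] at this
    simp only [Prod.fst_sub, Finset.sum_sub_distrib, Prod.fst_zero, sub_eq_zero] at this
    rw [LD_apply, LD_apply, sum_antidiagonal_swap
      (fun i j => fderiv ℝ (fun y => (Gε j y).1) y ((Kε i y).2))]
    exact this

variable (h : IsNormalForm w G K Gε Kε) (hκ : ∀ y, (Kε 0 y).1 ≠ 0)

include h hκ

lemma IsNormalForm.smooth_quotK : Smooth (quotK Kε) :=
  Smooth.smulS (Smooth.invS (fun k => (h.smooth_K k).fst) hκ) fun k => (h.smooth_K k).snd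

lemma IsNormalForm.smooth_quotG : Smooth (quotG Gε Kε) :=
  Smooth.sub (u := fun k y => (Gε k y).2) (fun k => (h.smooth_G k).snd)
    (Smooth.smulS (fun k => (h.smooth_G k).fst) (h.smooth_quotK hκ))

lemma IsNormalForm.formallyCommute_quot : FormallyCommute (quotK Kε) (quotG Gε Kε) := by
  obtain ⟨h1, h2⟩ := formallyCommute_lift h.smooth_G h.smooth_K h.commute
  refine formallyCommute_quotient (κ := fun k y => (Kε k y).1) (g := fun k y => (Gε k y).1)
    (fun k => (h.smooth_K k).fst) (fun k => (h.smooth_G k).fst) (h.smooth_quotK hκ)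
    (h.smooth_quotG hκ) hκ (smulS_smulS_invS hκ _) ?_ h1 h2
  funext k y
  exact sub_add_cancel _ _

omit h in
lemma mk_LD_quotK (u : ℕ → Space n → ℝ) (y : Space n) :
    (PowerSeries.mk fun k => LD (fun k y => (Kε k y).2) u k y) =
      (PowerSeries.mk fun k => (Kε k y).1) * PowerSeries.mk fun k => LD (quotK Kε) u k y := by
  rw [← mk_LD_smulS (fun k y => (Kε k y).1), quotK, smulS_smulS_invS hκ]

omit h hκ in
lemma mk_LD_quotG (u : ℕ → Space n → ℝ) (y : Space n) :
    (PowerSeries.mk fun k => LD (fun k y => (Gε k y).2) u k y) =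
      (PowerSeries.mk fun k => LD (quotG Gε Kε) u k y) +
      (PowerSeries.mk fun k => (Gε k y).1) * PowerSeries.mk fun k => LD (quotK Kε) u k y := by
  rw [← mk_LD_smulS (fun k y => (Gε k y).1), ← mk_add]
  simp only [← LD_add_field, quotG, sub_add_cancel]

omit h hκ in
lemma mk_tOperator (u : ℕ → ℝ → ℝ → Space n → ℝ) (t τ : ℝ) (y : Space n) :
    PowerSeries.mk (tOperator Kε u t τ y) =
      (PowerSeries.mk fun k => (Kε k y).1) * (PowerSeries.mk fun k => deriv (u k · τ y) t) +
      PowerSeries.mk fun k => LD (fun k y => (Kε k y).2) (fun k y => u k t τ y) k y := by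
  rw [← mk_mulSeries, ← mk_add]
  rfl

omit h hκ in
lemma mk_tauOperator (u : ℕ → ℝ → ℝ → Space n → ℝ) (t τ : ℝ) (y : Space n) :
    PowerSeries.mk (tauOperator Gε Kε u t τ y) =
      (PowerSeries.mk fun k => (Kε k y).1) * ((PowerSeries.mk fun k => deriv (u k t · y) τ) +
        PowerSeries.mk fun k => LD (fun k y => (Gε k y).2) (fun k y => u k t τ y) k y) -
      (PowerSeries.mk fun k => (Gε k y).1) *
        PowerSeries.mk fun k => LD (fun k y => (Kε k y).2) (fun k y => u k t τ y) k y := by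
  have e : crossField Gε Kε y = fun k => mulSeries (fun i => (Kε i y).1) (fun j => (Gε j y).2) k -
    mulSeries (fun i => (Gε i y).1) (fun j => (Kε j y).2) k := rfl
  have e2 : ∀ X : ℕ → Space n → Space n, (fun k => LD X (fun k y => u k t τ y) k y) =
      applySeries (fun i => X i y) (fun j => fderiv ℝ (u j t τ) y) := fun _ => rfl
  rw [mul_add, add_sub_assoc, e2, e2, ← mk_applySeries_mulSeries, ← mk_applySeries_mulSeries,
    ← mk_mulSeries, ← mk_sub, ← mk_add]
  congr 1
  funext k
  rw [tauOperator, e, applySeries_sub]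

omit h hκ in
lemma mk_ite (σ : ℝ) : (PowerSeries.mk fun k => if k = 0 then σ else 0) = PowerSeries.C σ := by
  ext k
  simp [PowerSeries.coeff_C]

-- Division by the invertible series K₁ gives ∂ₜu + a·∇u = σ/K₁. The minus sign is due to the
-- convention ∂ - X for transport fields.
omit h in
lemma tOperator_eq_iff {H : ℕ → ℝ × ℝ × Space n → ℝ} (hH : Smooth H) (σ t τ : ℝ) (y : Space n) :
    (∀ k, tOperator Kε (fun k t τ y => H k (t, τ, y)) t τ y k = if k = 0 then σ else 0) ↔
      ∀ k, LD (tf (ext fun k y => -quotK Kε k y)) H k (t, τ, y) =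
        σ * invS (fun k y => (Kε k y).1) k y := by
  have h1 : ∀ k, LD (tf (ext fun k y => -quotK Kε k y)) H k (t, τ, y) =
      deriv (fun s => H k (s, τ, y)) t + LD (quotK Kε) (fun k y => H k (t, τ, y)) k y := by
    intro k
    rw [LD_tf_slice _ hH, LD_ext_slice _ (u := fun k P => H k (t, P)) (hH.comp (by fun_prop)),
      LD_neg_field, sub_neg_eq_add]
  have h2 := mk_tOperator (Kε := Kε) (fun k t τ y => H k (t, τ, y)) t τ y
  rw [mk_LD_quotK hκ, ← mul_add, ← mk_add] at h2
  have hinv := mul_mk_invS (c := fun k y => (Kε k y).1) (hκ y)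
  have h3 : (PowerSeries.mk fun k => σ * invS (fun k y => (Kε k y).1) k y) =
      PowerSeries.C σ * PowerSeries.mk fun k => invS (fun k y => (Kε k y).1) k y := by
    ext k
    simp
  simp only [h1]
  constructor
  · intro H1 k
    rw [funext H1, mk_ite] at h2
    refine mk_injective (b := fun k => σ * invS (fun k y => (Kε k y).1) k y)
      (a := fun k => deriv (fun s => H k (s, τ, y)) t +
        LD (quotK Kε) (fun k y => H k (t, τ, y)) k y) ?_ k
    rw [h3]
    linear_combination (-(PowerSeries.mk fun k => invS (fun k y => (Kε k y).1) k y)) * h2 -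
      (PowerSeries.mk fun k => deriv (fun s => H k (s, τ, y)) t +
        LD (quotK Kε) (fun k y => H k (t, τ, y)) k y) * hinv
  · intro H1
    rw [funext H1, h3] at h2
    refine mk_injective (b := fun k => if k = 0 then σ else 0) ?_
    rw [mk_ite]
    linear_combination h2 + PowerSeries.C σ * hinv

-- The field K₁G₂ - G₁K₂ is K₁ times b, so dividing by K₁ leaves transport along b.
omit h in
lemma tauOperator_eq_iff {H : ℕ → ℝ × ℝ × Space n → ℝ} (hH : Smooth H) (σ t τ : ℝ) (y : Space n) :
    (∀ k, tauOperator Gε Kε (fun k t τ y => H k (t, τ, y)) t τ y k = -(σ * (Gε k y).1)) ↔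
      ∀ k, LD (ext (tf fun k y => -quotG Gε Kε k y)) H k (t, τ, y) =
        -σ * mulS (fun k y => (Gε k y).1) (invS (fun k y => (Kε k y).1)) k y := by
  have h1 : ∀ k, LD (ext (tf fun k y => -quotG Gε Kε k y)) H k (t, τ, y) =
      deriv (fun s => H k (t, s, y)) τ + LD (quotG Gε Kε) (fun k y => H k (t, τ, y)) k y := by
    intro k
    rw [LD_ext_slice _ hH, LD_tf_slice _ (u := fun k P => H k (t, P)) (hH.comp (by fun_prop)),
      LD_neg_field, sub_neg_eq_add]
  have h2 := mk_tauOperator (Gε := Gε) (Kε := Kε) (fun k t τ y => H k (t, τ, y)) t τ y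
  rw [mk_LD_quotK hκ, mk_LD_quotG (Kε := Kε)] at h2
  have hinv := mul_mk_invS (c := fun k y => (Kε k y).1) (hκ y)
  have h3 : (PowerSeries.mk fun k => -σ * mulS (fun k y => (Gε k y).1)
      (invS (fun k y => (Kε k y).1)) k y) = -PowerSeries.C σ * ((PowerSeries.mk fun k => (Gε k y).1) *
        PowerSeries.mk fun k => invS (fun k y => (Kε k y).1) k y) := by
    rw [← mk_mulS (fun k y => (Gε k y).1)]
    ext k
    simp
  have h4 : (PowerSeries.mk fun k => -(σ * (Gε k y).1)) =
      -(PowerSeries.C σ * PowerSeries.mk fun k => (Gε k y).1) := by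
    ext k
    simp
  simp only [h1]
  constructor
  · intro H1 k
    rw [funext H1, h4] at h2
    refine mk_injective (b := fun k => -σ * mulS (fun k y => (Gε k y).1)
      (invS (fun k y => (Kε k y).1)) k y) (a := fun k => deriv (fun s => H k (t, s, y)) τ +
        LD (quotG Gε Kε) (fun k y => H k (t, τ, y)) k y) ?_ k
    rw [h3, mk_add]
    linear_combination (-(PowerSeries.mk fun k => invS (fun k y => (Kε k y).1) k y)) * h2 -
      ((PowerSeries.mk fun k => deriv (fun s => H k (t, s, y)) τ) +
        PowerSeries.mk fun k => LD (quotG Gε Kε) (fun k y => H k (t, τ, y)) k y) * hinv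
  · intro H1
    have h5 := congrArg PowerSeries.mk (funext H1)
    rw [h3, mk_add] at h5
    refine mk_injective (b := fun k => -(σ * (Gε k y).1)) ?_
    rw [h4]
    linear_combination h2 + (PowerSeries.mk fun k => (Kε k y).1) * h5 -
      (PowerSeries.C σ * PowerSeries.mk fun k => (Gε k y).1) * hinv

omit h hκ in
lemma LD_const_mul {E : Type} [NormedAddCommGroup E] [NormedSpace ℝ E] (σ : ℝ) (X : ℕ → E → E)
    {u : ℕ → E → ℝ} (hu : Smooth u) (k : ℕ) (y : E) :
    LD X (fun k y => σ * u k y) k y = σ * LD X u k y :=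
  LD_clm_comp (σ • ContinuousLinearMap.id ℝ ℝ) X hu k y

/-- Compatibility of the two equations of the system for the phase. -/
lemma IsNormalForm.compatible (k : ℕ) (y : Space n) :
    -LD (quotK Kε) (mulS (fun k y => (Gε k y).1) (invS fun k y => (Kε k y).1)) k y =
      LD (quotG Gε Kε) (invS fun k y => (Kε k y).1) k y := by
  obtain ⟨-, h2⟩ := formallyCommute_lift h.smooth_G h.smooth_K h.commute
  have hκs : Smooth (fun k y => (Kε k y).1) := fun k => (h.smooth_K k).fst
  have hgs : Smooth (fun k y => (Gε k y).1) := fun k => (h.smooth_G k).fst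
  have his := hκs.invS hκ
  have hinv := mul_mk_invS (c := fun k y => (Kε k y).1) (hκ y)
  have e0 : mulS (fun k y => (Kε k y).1) (invS fun k y => (Kε k y).1) = lead fun _ => 1 := by
    funext k y
    have := congrArg (PowerSeries.coeff k) (mul_mk_invS (c := fun k y => (Kε k y).1) (hκ y))
    rw [← mk_mulS (fun k y => (Kε k y).1), PowerSeries.coeff_mk, PowerSeries.coeff_one] at this
    exact this
  -- Differentiating κ κ⁻¹ = 1 expresses the derivatives of κ⁻¹. The other ingredient, `e2`, is the
  -- t-component of the commutation of the averaged fields.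
  have e1 : ∀ X : ℕ → Space n → Space n,
      (PowerSeries.mk fun k => LD X (fun k y => (Kε k y).1) k y) *
        (PowerSeries.mk fun k => invS (fun k y => (Kε k y).1) k y) +
      (PowerSeries.mk fun k => (Kε k y).1) *
        (PowerSeries.mk fun k => LD X (invS fun k y => (Kε k y).1) k y) = 0 := by
    intro X
    rw [← mk_mulS (LD X fun k y => (Kε k y).1), ← mk_mulS (fun k y => (Kε k y).1), ← mk_add]
    simp only [← LD_mulS hκs his, e0]
    ext k
    rw [PowerSeries.coeff_mk, LD_apply, map_zero]
    refine Finset.sum_eq_zero fun p _ => ?_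
    have : (lead fun _ => 1 : ℕ → Space n → ℝ) p.2 = fun _ => if p.2 = 0 then 1 else 0 := rfl
    simp [this]
  have e2 := congrArg PowerSeries.mk (funext fun k => h2 k y)
  rw [mk_LD_quotG (Kε := Kε), mk_LD_quotK hκ] at e2
  have e3 : (PowerSeries.mk fun k => -LD (quotK Kε)
      (mulS (fun k y => (Gε k y).1) (invS fun k y => (Kε k y).1)) k y) =
      -((PowerSeries.mk fun k => LD (quotK Kε) (fun k y => (Gε k y).1) k y) *
        (PowerSeries.mk fun k => invS (fun k y => (Kε k y).1) k y) +
      (PowerSeries.mk fun k => (Gε k y).1) *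
        (PowerSeries.mk fun k => LD (quotK Kε) (invS fun k y => (Kε k y).1) k y)) := by
    rw [← mk_mulS (LD _ _), ← mk_mulS (fun k y => (Gε k y).1), ← mk_add]
    simp only [← LD_mulS hgs his]
    ext k
    simp
  refine mk_injective (a := fun k => -LD (quotK Kε)
    (mulS (fun k y => (Gε k y).1) (invS fun k y => (Kε k y).1)) k y) (b := fun k => LD (quotG Gε Kε)
    (invS fun k y => (Kε k y).1) k y) ?_ k
  rw [e3]
  have ea := e1 (quotK Kε)
  have eb := e1 (quotG Gε Kε)
  generalize (PowerSeries.mk fun k => LD (quotK Kε) (fun k y => (Gε k y).1) k y) = Ag at *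
  generalize (PowerSeries.mk fun k => LD (quotK Kε) (fun k y => (Kε k y).1) k y) = Ak at *
  generalize (PowerSeries.mk fun k => LD (quotG Gε Kε) (fun k y => (Kε k y).1) k y) = Bk at *
  generalize (PowerSeries.mk fun k => LD (quotK Kε) (invS fun k y => (Kε k y).1) k y) = Ai at *
  generalize (PowerSeries.mk fun k => LD (quotG Gε Kε) (invS fun k y => (Kε k y).1) k y) = Bi at *
  generalize (PowerSeries.mk fun k => invS (fun k y => (Kε k y).1) k y) = i at *
  generalize (PowerSeries.mk fun k => (Kε k y).1) = κ at *
  generalize (PowerSeries.mk fun k => (Gε k y).1) = g at *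
  linear_combination (-i * g) * ea - i * eb + i * i * e2 + (g * Ai + Bi + i * Ag) * hinv

end Systems


/-! ### Solutions of the systems -/

section Solutions

variable {n : ℕ} {w : Space n → ℝ} {G K : Space n → Space n} {Gε Kε : ℕ → Space n → ℝ × Space n}
  {σ : ℝ} {u₀ : Space n → ℝ}

/-- A series of functions of `(t, τ, y)` as a series of functions of one variable. -/
def unc (h : ℕ → ℝ → ℝ → Space n → ℝ) (k : ℕ) (P : ℝ × ℝ × Space n) : ℝ := h k P.1 P.2.1 P.2.2

lemma quotK_zero (y : Space n) : quotK Kε 0 y = ((Kε 0 y).1)⁻¹ • (Kε 0 y).2 := by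
  rw [quotK, smulS_zero, invS_zero]

lemma IsNormalForm.G_zero (h : IsNormalForm w G K Gε Kε) (y : Space n) : Gε 0 y = (0, G y) :=
  h.split_zero y

lemma IsNormalForm.quotG_zero (h : IsNormalForm w G K Gε Kε) (y : Space n) :
    quotG Gε Kε 0 y = G y := by
  rw [quotG, smulS_zero, h.G_zero]
  simp

variable (h : IsNormalForm w G K Gε Kε) (hκ : ∀ y, (Kε 0 y).1 ≠ 0)
  {Φ Ψ : ℝ → Space n → Space n} (hΦ : GeneratesFlow G Φ)
  (hΨ : GeneratesFlow (fun y => ((Kε 0 y).1)⁻¹ • (Kε 0 y).2) Ψ)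

include hΨ in
lemma generatesFlow_neg_quotK :
    GeneratesFlow ((fun k y => -quotK Kε k y) 0) (fun t y => Ψ (-t) y) := by
  have e : (fun k y => -quotK Kε k y) 0 = fun y => -(((Kε 0 y).1)⁻¹ • (Kε 0 y).2) :=
    funext fun y => by simp only [quotK_zero]
  rw [e]
  exact hΨ.neg

include h hΦ in
lemma IsNormalForm.generatesFlow_neg_quotG :
    GeneratesFlow ((fun k y => -quotG Gε Kε k y) 0) (fun t y => Φ (-t) y) := by
  have e : (fun k y => -quotG Gε Kε k y) 0 = fun y => -G y :=
    funext fun y => by simp only [h.quotG_zero]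
  rw [e]
  exact hΦ.neg

include h hκ hΦ hΨ

/-- After division the two equations are evolutions in t and τ along the commuting fields -a and -b.
Their leading terms -K₂,₀/K₁,₀ and -G have global flows. -/
theorem exists_isSystemSol (σ : ℝ) (hu₀ : ContDiff ℝ ∞ u₀) :
    ∃ H, IsSystemSol Gε Kε σ u₀ H := by
  have his : Smooth (invS fun k y => (Kε k y).1) := Smooth.invS (fun k => (h.smooth_K k).fst) hκ
  have hm : Smooth (mulS (fun k y => (Gε k y).1) (invS fun k y => (Kε k y).1)) :=
    Smooth.mulS (fun k => (h.smooth_G k).fst) his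
  obtain ⟨H, hH, hH', hH0⟩ := exists_twoTime (X := fun k y => -quotK Kε k y)
    (Z := fun k y => -quotG Gε Kε k y) (generatesFlow_neg_quotK hΨ)
    (h.generatesFlow_neg_quotG hΦ) (h.smooth_quotK hκ).neg (h.smooth_quotG hκ).neg
    (FormallyCommute.neg (FormallyCommute.neg (h.formallyCommute_quot hκ).symm).symm)
    (p := fun k y => σ * invS (fun k y => (Kε k y).1) k y)
    (q := fun k y => -σ * mulS (fun k y => (Gε k y).1) (invS fun k y => (Kε k y).1) k y)
    (fun k => contDiff_const.mul (his k)) (fun k => contDiff_const.mul (hm k)) (smooth_lead hu₀)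
    (fun k y => by
      rw [LD_neg_field, LD_neg_field, LD_const_mul _ _ hm, LD_const_mul _ _ his,
        ← h.compatible hκ]
      ring)
  refine ⟨fun k t τ y => H k (t, τ, y), hH.smooth, fun t τ y => ?_, fun t τ y => ?_,
    fun k y => hH0 k y⟩
  · exact (tOperator_eq_iff hκ hH.smooth σ t τ y).2 fun k => hH.eq k _
  · exact (tauOperator_eq_iff hκ hH.smooth σ t τ y).2 fun k => hH' k _

/-- The difference of two solutions satisfies the homogeneous equations. It vanishes at t = 0 by the
τ-equation, then for all t by the t-equation. -/
theorem IsSystemSol.unique {H H' : ℕ → ℝ → ℝ → Space n → ℝ} (hH : IsSystemSol Gε Kε σ u₀ H)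
    (hH' : IsSystemSol Gε Kε σ u₀ H') : H' = H := by
  set X : ℕ → Space n → Space n := fun k y => -quotK Kε k y
  set Z : ℕ → Space n → Space n := fun k y => -quotG Gε Kε k y
  have hX : Smooth X := (h.smooth_quotK hκ).neg
  have hZ : Smooth Z := (h.smooth_quotG hκ).neg
  have ht : ∀ {H}, IsSystemSol Gε Kε σ u₀ H → IsSol (ext X)
      (fun k P => σ * invS (fun k y => (Kε k y).1) k P.2) (unc H) := fun hH =>
    ⟨hH.smooth, fun k P => (tOperator_eq_iff hκ (H := unc _) hH.smooth σ _ _ _).1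
      (fun k => hH.eq_t _ _ _ k) k⟩
  have hd := (ht hH').sub (ht hH)
  have hτ : ∀ {H}, IsSystemSol Gε Kε σ u₀ H → ∀ k P, LD (ext (tf Z)) (unc H) k P =
      -σ * mulS (fun k y => (Gε k y).1) (invS (fun k y => (Kε k y).1)) k P.2.2 := fun hH k P =>
    (tauOperator_eq_iff hκ (H := unc _) hH.smooth σ _ _ _).1 (fun k => hH.eq_tau _ _ _ k) k
  have hd' : ∀ k P, LD (ext (tf Z)) (fun k P => unc H' k P - unc H k P) k P = 0 := fun k P => by
    rw [LD_sub (u := unc H') (v := unc H) hH'.smooth hH.smooth, hτ hH', hτ hH, sub_self]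
  have h0 : ∀ k P, unc H' k (0, P) - unc H k (0, P) = 0 := by
    refine fun k P => (isSol_fix_outer hd.smooth hd' 0).unique (h.generatesFlow_neg_quotG hΦ)
      (hZ 0) (v := fun _ _ => 0) ⟨Smooth.zero, fun k P => LD_zero _ k P⟩ (fun k y => ?_) k P
    rw [unc, unc, hH.init, hH'.init, sub_self]
  have h1 := hd.unique (generatesFlow_neg_quotK hΨ).ext (hX.ext 0) (v := fun _ _ => 0)
    ⟨Smooth.zero, fun k P => LD_zero _ k P⟩ h0
  funext k t τ y
  exact sub_eq_zero.1 (h1 k (t, τ, y))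

end Solutions

/-! ### The transport equation for the sum of a solution -/

section Transport

variable {n : ℕ} {w : Space n → ℝ} {G K : Space n → Space n} {Gε Kε : ℕ → Space n → ℝ × Space n}
  {σ : ℝ} {u₀ : Space n → ℝ}

/-- A field in `(t, y)`, independent of `t`, as a field in `(t, τ, y)`. -/
def lift₃ (X : Space n → ℝ × Space n) (P : ℝ × ℝ × Space n) : ℝ × ℝ × Space n :=
  ((X P.2.2).1, 0, (X P.2.2).2)

lemma hasFDerivAt_unc {h : ℕ → ℝ → ℝ → Space n → ℝ} (hh : SmoothSeries h) (k : ℕ)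
    (P : ℝ × ℝ × Space n) : HasFDerivAt (unc h k) (fderiv ℝ (unc h k) P) P :=
  ((hh k).differentiable (by simp) P).hasFDerivAt

lemma hasDerivAt_t {h : ℕ → ℝ → ℝ → Space n → ℝ} (hh : SmoothSeries h) (k : ℕ) (t τ : ℝ)
    (y : Space n) :
    HasDerivAt (fun s => h k s τ y) (fderiv ℝ (unc h k) (t, τ, y) (1, 0, 0)) t :=
  (hasFDerivAt_unc hh k (t, τ, y)).comp_hasDerivAt (f := fun s => (s, τ, y)) t
    ((hasDerivAt_id t).prodMk (hasDerivAt_const t (τ, y)))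

lemma hasDerivAt_tau {h : ℕ → ℝ → ℝ → Space n → ℝ} (hh : SmoothSeries h) (k : ℕ) (t τ : ℝ)
    (y : Space n) :
    HasDerivAt (fun s => h k t s y) (fderiv ℝ (unc h k) (t, τ, y) (0, 1, 0)) τ :=
  (hasFDerivAt_unc hh k (t, τ, y)).comp_hasDerivAt (f := fun s => (t, s, y)) τ
    ((hasDerivAt_const τ t).prodMk ((hasDerivAt_id τ).prodMk (hasDerivAt_const τ y)))

lemma hasFDerivAt_y {h : ℕ → ℝ → ℝ → Space n → ℝ} (hh : SmoothSeries h) (k : ℕ) (t τ : ℝ)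
    (y : Space n) : HasFDerivAt (h k t τ) (fderiv ℝ (unc h k) (t, τ, y) ∘L
      (0 : Space n →L[ℝ] ℝ).prod ((0 : Space n →L[ℝ] ℝ).prod (ContinuousLinearMap.id ℝ _))) y :=
  (hasFDerivAt_unc hh k (t, τ, y)).comp (f := fun y => (t, τ, y)) y
    ((hasFDerivAt_const t y).prodMk ((hasFDerivAt_const τ y).prodMk (hasFDerivAt_id y)))

lemma LD_lift₃ (X : ℕ → Space n → ℝ × Space n) {h : ℕ → ℝ → ℝ → Space n → ℝ}
    (hh : SmoothSeries h) (k : ℕ) (t τ : ℝ) (y : Space n) :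
    LD (fun i => lift₃ (X i)) (unc h) k (t, τ, y) =
      mulSeries (fun i => (X i y).1) (fun j => deriv (fun s => h j s τ y) t) k +
    applySeries (fun i => (X i y).2) (fun j => fderiv ℝ (h j t τ) y) k := by
  rw [LD_apply, mulSeries, applySeries, ← Finset.sum_add_distrib]
  refine Finset.sum_congr rfl fun p _ => ?_
  have e : lift₃ (X p.1) (t, τ, y) =
      (X p.1 y).1 • ((1, 0, 0) : ℝ × ℝ × Space n) + (0, 0, (X p.1 y).2) := by
    simp [lift₃]
  rw [(hasDerivAt_t hh _ _ _ _).deriv, (hasFDerivAt_y hh _ _ _ _).fderiv, e, map_add, map_smul]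
  rfl

lemma IsSystemSol.LD_K {h : ℕ → ℝ → ℝ → Space n → ℝ} (hh : IsSystemSol Gε Kε σ u₀ h) (k : ℕ)
    (P : ℝ × ℝ × Space n) : LD (fun i => lift₃ (Kε i)) (unc h) k P = if k = 0 then σ else 0 :=
  (LD_lift₃ Kε hh.smooth k _ _ _).trans (hh.eq_t _ _ _ k)

/-- Adding G₁ times the t-equation to the τ-equation cancels both the source and the terms in K₂;
the factor K₁ then divides out. -/
lemma IsSystemSol.LD_G (hκ : ∀ y, (Kε 0 y).1 ≠ 0) {h : ℕ → ℝ → ℝ → Space n → ℝ}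
    (hh : IsSystemSol Gε Kε σ u₀ h) (k : ℕ) (P : ℝ × ℝ × Space n) :
    fderiv ℝ (unc h k) P (0, 1, 0) + LD (fun i => lift₃ (Gε i)) (unc h) k P = 0 := by
  obtain ⟨t, τ, y⟩ := P
  have h1 := mk_tOperator (Kε := Kε) h t τ y
  have h2 := mk_tauOperator (Gε := Gε) (Kε := Kε) h t τ y
  have hinv := mul_mk_invS (c := fun k y => (Kε k y).1) (hκ y)
  rw [funext (hh.eq_t t τ y), mk_ite] at h1
  have h4 : (PowerSeries.mk fun k => -(σ * (Gε k y).1)) =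
      -(PowerSeries.C σ * PowerSeries.mk fun k => (Gε k y).1) := by
    ext k
    simp
  rw [funext (hh.eq_tau t τ y), h4] at h2
  simp only [LD_lift₃ Gε hh.smooth, ← (hasDerivAt_tau hh.smooth _ _ _ _).deriv]
  refine mk_injective (b := fun _ => 0) (a := fun k => deriv (fun s => h k t s y) τ +
    (mulSeries (fun i => (Gε i y).1) (fun j => deriv (fun s => h j s τ y) t) k +
      LD (fun k y => (Gε k y).2) (fun k y => h k t τ y) k y)) ?_ k
  have h0 : (PowerSeries.mk fun _ => 0 : PowerSeries ℝ) = 0 := by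
    ext k
    simp
  rw [mk_add, mk_add, mk_mulSeries, h0]
  linear_combination (-(PowerSeries.mk fun k => invS (fun k y => (Kε k y).1) k y)) * h2 -
    (PowerSeries.mk fun k => invS (fun k y => (Kε k y).1) k y) *
      (PowerSeries.mk fun k => (Gε k y).1) * h1 -
    ((PowerSeries.mk fun k => deriv (fun s => h k t s y) τ) +
      (PowerSeries.mk fun k => (Gε k y).1) * (PowerSeries.mk fun k => deriv (fun s => h k s τ y) t) +
      (PowerSeries.mk fun k => LD (fun k y => (Gε k y).2) (fun k y => h k t τ y) k y)) * hinv

/-- By `IsSystemSol.LD_G`, reversing τ turns the solution into an evolution under G^ε in the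
variables (t, y), and that evolution is trivial over 2π. -/
theorem IsSystemSol.periodic (h : IsNormalForm w G K Gε Kε) (hκ : ∀ y, (Kε 0 y).1 ≠ 0)
    {Φ : ℝ → Space n → Space n} (hΦ : GeneratesFlow G Φ) {u : ℕ → ℝ → ℝ → Space n → ℝ}
    (hu : IsSystemSol Gε Kε σ u₀ u) : PeriodicSeries u := by
  set v : ℕ → ℝ × ℝ × Space n → ℝ := fun k P => unc u k (P.2.1, -P.1, P.2.2)
  have hsol : IsSol (fun i => lift (Gε i)) (fun _ _ => 0 : ℕ → ℝ × Space n → ℝ) v := by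
    refine isSol_of_deriv (Smooth.comp hu.smooth (by fun_prop)) fun k τ Y => ?_
    have hd := fun k => hasFDerivAt_unc hu.smooth k (Y.1, -τ, Y.2)
    have h1 : HasDerivAt (fun s => v k (s, Y))
        (fderiv ℝ (unc u k) (Y.1, -τ, Y.2) (0, -1, 0)) τ :=
      (hd k).comp_hasDerivAt (f := fun s => (Y.1, -s, Y.2)) τ ((hasDerivAt_const τ Y.1).prodMk
        ((hasDerivAt_neg τ).prodMk (hasDerivAt_const τ Y.2)))
    have h2 : LD (fun i => lift (Gε i)) (fun k Z => v k (τ, Z)) k Y =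
        LD (fun i => lift₃ (Gε i)) (unc u) k (Y.1, -τ, Y.2) := by
      rw [LD_apply, LD_apply]
      refine Finset.sum_congr rfl fun p _ => ?_
      have h3 := (hd p.2).comp (f := fun Z : ℝ × Space n => (Z.1, -τ, Z.2)) Y
        (hasFDerivAt_fst.prodMk ((hasFDerivAt_const (-τ) Y).prodMk hasFDerivAt_snd))
      exact congrArg (fun L => L (lift (Gε p.1) Y)) h3.fderiv
    have h4 := hu.LD_G hκ k (Y.1, -τ, Y.2)
    have e : ((0, -1, 0) : ℝ × ℝ × Space n) = -(0, 1, 0) := by simp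
    rw [h1.deriv, h2, add_zero, e, map_neg]
    linarith
  intro k t τ y
  have := hsol.periodic (h.generatesFlow hΦ) h.smooth_lift_G (h.evol_eq_self hΦ) k
    (-τ - 2 * Real.pi) (t, y)
  simp only [v, unc] at this
  rw [sub_add_cancel, neg_neg] at this
  rw [this]
  congr 1
  ring

lemma LD_mulEps_field {E W : Type} [NormedAddCommGroup E] [NormedSpace ℝ E]
    [NormedAddCommGroup W] [NormedSpace ℝ W] (X : ℕ → E → E) (u : ℕ → E → W) :
    LD (mulEps X) u = mulEps (LD X u) := by
  funext k Y
  cases k with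
  | zero => simp [LD_apply, mulEps]
  | succ k =>
    rw [LD_apply, Finset.Nat.sum_antidiagonal_succ]
    simp [mulEps, LD_apply]

/-- The transport equations `∂_τ u + G · ∇ u + ε w⁻¹ (∂ₜ u + K · ∇ u) = ε σ`. -/
lemma IsSystemSol.transport (h : IsNormalForm w G K Gε Kε) (hκ : ∀ y, (Kε 0 y).1 ≠ 0)
    {u : ℕ → ℝ → ℝ → Space n → ℝ} (hu : IsSystemSol Gε Kε σ u₀ u) (P : ℝ × ℝ × Space n) :
    fderiv ℝ (unc u 0) P (0, 1, G P.2.2) = 0 ∧ ∀ k, fderiv ℝ (unc u (k + 1)) P (0, 1, G P.2.2) +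
      (w P.2.2)⁻¹ * fderiv ℝ (unc u k) P (1, 0, K P.2.2) = if k = 0 then σ else 0 := by
  -- The sum G^ε + εK^ε is Ǧ + εǨ, which stops at order one. This is why only two consecutive
  -- coefficients of u appear in each equation.
  set A : ℕ → ℝ × ℝ × Space n → ℝ × ℝ × Space n := fun i P =>
    lift₃ (Gε i) P + mulEps (fun i => lift₃ (Kε i)) i P
  have e : ∀ i P, A i P = lift₃ (fun y => augField w G K i (0, y)) P := by
    intro i P
    simp only [A, lift₃, h.split]
    cases i <;> simp [mulEps, lift, lift₃]
  have e0 : ((0, 1, G P.2.2) : ℝ × ℝ × Space n) = (0, 1, 0) + (0, 0, G P.2.2) := by simp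
  have key : ∀ k, fderiv ℝ (unc u k) P (0, 1, 0) + LD A (unc u) k P =
      mulEps (fun k _ => if k = 0 then σ else 0) k P := by
    intro k
    rw [LD_add_field, ← add_assoc, hu.LD_G hκ, zero_add, LD_mulEps_field]
    cases k
    · rfl
    · exact hu.LD_K _ _
  have hA0 : A 0 P = (0, 0, G P.2.2) := by
    rw [e]
    rfl
  have hA1 : A 1 P = (w P.2.2)⁻¹ • (1, 0, K P.2.2) := by
    rw [e]
    simp [lift₃, augField, lift, augK]
  have hA2 : ∀ i, A (i + 2) P = 0 := fun i => by
    rw [e]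
    rfl
  constructor
  · have := key 0
    rw [LD_apply] at this
    simp only [Finset.HasAntidiagonal.antidiagonal] at this
    rw [e0, map_add, ← hA0]
    simpa [mulEps] using this
  · intro k
    have := key (k + 1)
    rw [LD_apply, Finset.Nat.sum_antidiagonal_eq_sum_range_succ
      (fun i j => fderiv ℝ (unc u j) P (A i P)), Finset.sum_range_succ', Finset.sum_range_succ',
      Finset.sum_eq_zero (fun i _ => by rw [hA2, map_zero]), zero_add, hA0, zero_add, hA1,
      map_smul] at this
    rw [show mulEps (fun k _ => if k = 0 then σ else 0) (k + 1) P = if k = 0 then σ else 0 from rfl]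
      at this
    rw [e0, map_add, ← this]
    simp only [Nat.add_sub_cancel, Nat.sub_zero, smul_eq_mul]
    ring

end Transport


/-! ### The phase relation -/

section Phase

variable {n : ℕ} {w : Space n → ℝ} {G K : Space n → Space n} {Gε Kε : ℕ → Space n → ℝ × Space n}
  {S : ℕ → ℝ → ℝ → Space n → ℝ} {Φ Ψ : ℝ → Space n → Space n}

lemma IsSystemSol.leading {σ : ℝ} {u₀ : Space n → ℝ} {u : ℕ → ℝ → ℝ → Space n → ℝ}
    (hu : IsSystemSol Gε Kε σ u₀ u) (P : ℝ × ℝ × Space n) :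
    fderiv ℝ (unc u 0) P ((Kε 0 P.2.2).1, 0, (Kε 0 P.2.2).2) = σ := by
  have := hu.LD_K 0 P
  rw [LD_eq_of_lt (by simp), if_pos rfl] at this
  exact this

lemma differentiable_unc {u : ℕ → ℝ → ℝ → Space n → ℝ} (hu : SmoothSeries u) (k : ℕ) :
    Differentiable ℝ (unc u k) := (hu k).differentiable (by simp)

/-- `1 - ∑_{1 ≤ k ≤ N} ε^{k-1} ∂_τ S_k`. -/
def phaseSlope (S : ℕ → ℝ → ℝ → Space n → ℝ) (N : ℕ) (ε t τ : ℝ) (y : Space n) : ℝ :=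
  1 - ∑ j ∈ Finset.range N, ε ^ j * fderiv ℝ (unc S (j + 1)) (t, τ, y) (0, 1, 0)

lemma continuous_phaseSlope (hS : SmoothSeries S) (N : ℕ) :
    Continuous fun p : (ℝ × ℝ) × ℝ × Space n => phaseSlope S N p.1.1 p.1.2 p.2.1 p.2.2 := by
  have h1 : ∀ k, Continuous (fun P => fderiv ℝ (unc S k) P (0, 1, 0)) := fun k =>
    ((hS k).continuous_fderiv (by simp)).clm_apply continuous_const
  refine continuous_const.sub (continuous_finsetSum _ fun j _ => ?_)
  exact (by fun_prop : Continuous fun p : (ℝ × ℝ) × ℝ × Space n => p.1.1 ^ j).mul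
    ((h1 (j + 1)).comp (by fun_prop :
      Continuous fun p : (ℝ × ℝ) × ℝ × Space n => (p.1.2, p.2.1, p.2.2)))

lemma continuous_partialSum (hS : SmoothSeries S) (N : ℕ) (ε t : ℝ) (y : Space n) :
    Continuous fun τ => partialSum S N ε t τ y :=
  continuous_finsetSum _ fun k _ => continuous_const.mul
    ((hS k).continuous.comp (by fun_prop : Continuous fun τ : ℝ => (t, τ, y)))

/-- The truncated phase is continuous and periodic in τ, hence bounded, while ετ takes all real
values: the intermediate value theorem applies. -/
lemma exists_phaseRelation (hS : SmoothSeries S) (hper : PeriodicSeries S) (N : ℕ) {ε : ℝ}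
    (hε : 0 < ε) (t : ℝ) (y : Space n) : ∃ τ, PhaseRelation S N ε t τ y := by
  have hc := continuous_partialSum hS (N + 1) ε t y
  have hp : Function.Periodic (fun τ => partialSum S (N + 1) ε t τ y) (2 * Real.pi) := fun τ => by
    simp only [partialSum, hper _ t τ y]
  obtain ⟨B, hB⟩ := (hp.isBounded_of_continuous Real.two_pi_pos.ne' hc).exists_norm_le
  have hB' : ∀ τ, |partialSum S (N + 1) ε t τ y| ≤ B := fun τ => hB _ ⟨τ, rfl⟩
  obtain ⟨τ, hτ⟩ := mem_range_of_exists_le_of_exists_ge (c := 0)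
    (f := fun τ => ε * τ - partialSum S (N + 1) ε t τ y) (by fun_prop)
    ⟨-B / ε, by
      have := (abs_le.1 (hB' (-B / ε))).1
      rw [mul_div_cancel₀ _ hε.ne']
      linarith⟩
    ⟨B / ε, by
      have := (abs_le.1 (hB' (B / ε))).2
      rw [mul_div_cancel₀ _ hε.ne']
      linarith⟩
  exact ⟨τ, sub_eq_zero.1 hτ⟩

variable (h : IsNormalForm w G K Gε Kε) (hκ : ∀ y, (Kε 0 y).1 ≠ 0) (hΦ : GeneratesFlow G Φ)
  (hΨ : GeneratesFlow (fun y => ((Kε 0 y).1)⁻¹ • (Kε 0 y).2) Ψ)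
  (hG : ContDiff ℝ ∞ G) (hS : IsSystemSol Gε Kε 1 (fun _ => 0) S)

include h hκ hΦ hG hS

/-- At t = 0 the leading phase is transported by G in τ, from the value zero at τ = 0. -/
lemma IsSystemSol.phase_zero_apply_zero (τ : ℝ) (y : Space n) : S 0 0 τ y = 0 := by
  refine eq_zero_of_transport (d := fun P : ℝ × Space n => unc S 0 (0, P)) hΦ.neg hG.neg
    ((differentiable_unc hS.smooth 0).comp (by fun_prop)) (fun P => ?_)
    (fun y => ?_) (τ, y)
  · have h1 := (hS.transport h hκ (0, P)).1
    rw [fderiv_slice (differentiable_unc hS.smooth 0 _), neg_neg]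
    exact h1
  · simpa [lead, unc] using hS.init 0 y

-- The difference S₀(t, τ, y) - S₀(t, 0, y) vanishes at t = 0 and is transported in t by a field
-- independent of τ. This is what allows a factor ε to be taken out of the slope of the phase
-- relation.
include hΨ in
lemma IsSystemSol.phase_zero_eq (t τ : ℝ) (y : Space n) : S 0 t τ y = S 0 t 0 y := by
  set a : Space n → Space n := fun y => ((Kε 0 y).1)⁻¹ • (Kε 0 y).2
  have ha : ContDiff ℝ ∞ a := ((h.smooth_K 0).fst.inv hκ).smul (h.smooth_K 0).snd
  have hd := differentiable_unc hS.smooth 0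
  have hflow : GeneratesFlow (fun q : ℝ × Space n => ((0 : ℝ), -a q.2))
      (fun t q => (q.1, Ψ (-t) q.2)) :=
    ⟨fun q => Prod.ext rfl (hΨ.neg.init q.2), fun t q => (hasDerivAt_const t q.1).prodMk (hΨ.neg.ode t q.2)⟩
  have key : ∀ P : ℝ × ℝ × Space n, fderiv ℝ (unc S 0) P (1, 0, a P.2.2) = (((Kε 0 P.2.2).1)⁻¹) := by
    intro P
    have e : ((1, 0, a P.2.2) : ℝ × ℝ × Space n) =
        ((Kε 0 P.2.2).1)⁻¹ • ((Kε 0 P.2.2).1, 0, (Kε 0 P.2.2).2) := by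
      simp [a, inv_mul_cancel₀ (hκ P.2.2)]
    rw [e, map_smul, hS.leading, smul_eq_mul, mul_one]
  refine sub_eq_zero.1 (eq_zero_of_transport
    (d := fun P : ℝ × ℝ × Space n => unc S 0 P - unc S 0 (P.1, 0, P.2.2)) hflow
    (contDiff_const.prodMk (ha.neg.comp contDiff_snd)) (hd.sub (hd.comp (by fun_prop)))
    (fun P => ?_) (fun q => ?_) (t, τ, y))
  · have h1 := (hd (P.1, 0, P.2.2)).hasFDerivAt.comp (f := fun P : ℝ × ℝ × Space n =>
      (P.1, (0 : ℝ), P.2.2)) P (hasFDerivAt_fst.prodMk ((hasFDerivAt_const (0 : ℝ) P).prodMk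
        (hasFDerivAt_snd.comp P hasFDerivAt_snd)))
    have h2 := (hd P).hasFDerivAt.sub h1
    have h3 := congrArg (fun L => L (1, -((0 : ℝ), -a P.2.2))) h2.fderiv
    refine h3.trans ?_
    have e1 := key P
    have e2 := key (P.1, 0, P.2.2)
    simp only [Prod.neg_mk, neg_neg, neg_zero]
    rw [sub_apply, e1]
    exact sub_eq_zero.2 e2.symm
  · have h1 := hS.phase_zero_apply_zero h hκ hΦ hG
    simp only [unc, h1, sub_self]

/-- At t = 0 the only nonzero derivative of S₀ is ∂ₜS₀ = 1/K₁,₀. The equation of order one becomes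
(∂_τ + G·∇)S₁ = 1 - 1/(ωK₁,₀), which integrates along the flow of G. -/
lemma IsSystemSol.hasDerivAt_phase_one (hw : ContDiff ℝ ∞ w) (hw0 : ∀ y, w y ≠ 0) (τ : ℝ)
    (y : Space n) :
    HasDerivAt (fun s => S 1 0 s y) (1 - (w (Φ (-τ) y) * (Kε 0 (Φ (-τ) y)).1)⁻¹) τ := by
  set m : Space n → ℝ := fun y => 1 - (w y * (Kε 0 y).1)⁻¹
  have hm : Continuous m := continuous_const.sub
    ((hw.continuous.mul (h.smooth_K 0).fst.continuous).inv₀ fun y => mul_ne_zero (hw0 y) (hκ y))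
  have hΦc : ∀ y, Continuous fun s => m (Φ s y) := fun y =>
    hm.comp (continuous_iff_continuousAt.2 fun s => (hΦ.ode s y).continuousAt)
  have hd := differentiable_unc hS.smooth
  have h0 : ∀ τ y (v : ℝ × Space n), fderiv ℝ (unc S 0) (0, τ, y) (0, v) = 0 := by
    intro τ y v
    rw [← fderiv_slice (hd 0 _)]
    have : (fun Y : ℝ × Space n => unc S 0 (0, Y)) = fun _ => 0 :=
      funext fun P => hS.phase_zero_apply_zero h hκ hΦ hG _ _
    rw [this]
    simp
  have h1 : ∀ τ y, fderiv ℝ (unc S 1) (0, τ, y) (0, 1, G y) = m y := by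
    intro τ y
    have e1 := (hS.transport h hκ (0, τ, y)).2 0
    have e2 := hS.leading (0, τ, y)
    have e3 : ∀ c (v : ℝ × Space n), fderiv ℝ (unc S 0) (0, τ, y) (c, v) =
        c * fderiv ℝ (unc S 0) (0, τ, y) (1, 0) := by
      intro c v
      have : ((c, v) : ℝ × ℝ × Space n) = c • (1, 0) + (0, v) := by simp
      rw [this, map_add, map_smul, h0, add_zero, smul_eq_mul]
    simp only [zero_add, if_true] at e1
    rw [e3, one_mul] at e1
    rw [e3] at e2
    simp only [m]
    rw [eq_sub_iff_add_eq.2 e1, mul_inv, ← eq_inv_of_mul_eq_one_right e2]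
  have h2 : ∀ z τ, HasDerivAt (fun s => unc S 1 (0, s, Φ s z)) (m (Φ τ z)) τ := by
    intro z τ
    rw [← h1]
    exact (hd 1 (0, τ, Φ τ z)).hasFDerivAt.comp_hasDerivAt (f := fun s => (0, s, Φ s z)) τ
      ((hasDerivAt_const τ _).prodMk ((hasDerivAt_id τ).prodMk (hΦ.ode τ z)))
  -- The shift r = s - τ moves the dependence on τ into the lower limit, so differentiating in τ is
  -- the fundamental theorem of calculus.
  have h3 : ∀ τ y, S 1 0 τ y = ∫ r in (-τ)..0, m (Φ r y) := by
    intro τ y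
    have := intervalIntegral.integral_eq_sub_of_hasDerivAt (a := 0) (b := τ)
      (fun s _ => h2 (Φ (-τ) y) s) ((hΦc _).intervalIntegrable _ _)
    rw [hΦ.apply_apply_neg hG, hΦ.init] at this
    have hi : unc S 1 (0, 0, Φ (-τ) y) = 0 := by simpa [lead, unc] using hS.init 1 (Φ (-τ) y)
    rw [hi, sub_zero] at this
    have e : ∀ s, Φ s (Φ (-τ) y) = Φ (s - τ) y := fun s => by
      rw [sub_eq_add_neg, hΦ.apply_add hG]
    simp only [e] at this
    rw [intervalIntegral.integral_comp_sub_right (fun r => m (Φ r y)) τ, zero_sub, sub_self] at this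
    exact this.symm
  simp only [h3]
  have h4 := intervalIntegral.integral_hasDerivAt_left ((hΦc y).intervalIntegrable (-τ) 0)
    ((hΦc y).stronglyMeasurableAtFilter _ _) (hΦc y).continuousAt
  exact (h4.scomp τ (hasDerivAt_neg τ)).congr_deriv (by rw [neg_one_smul, neg_neg])

/-- Periodicity of S₁ and the mean value theorem over one period show that the slope takes the value
1. It is continuous without zeros along the orbit, so it is positive, with no sign assumed for K₁,₀.
-/
lemma IsSystemSol.phase_one_pos (hw : ContDiff ℝ ∞ w) (hw0 : ∀ y, w y ≠ 0)
    (τ : ℝ) (y : Space n) : 0 < 1 - fderiv ℝ (unc S 1) (0, τ, y) (0, 1, 0) := by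
  have hd := hS.hasDerivAt_phase_one h hκ hΦ hG hw hw0
  set m : ℝ → ℝ := fun τ => (w (Φ (-τ) y) * (Kε 0 (Φ (-τ) y)).1)⁻¹
  have hflow : Continuous fun s => Φ (-s) y :=
    continuous_iff_continuousAt.2 fun s => (hΦ.neg.ode s y).continuousAt
  have hm : Continuous m :=
    ((hw.continuous.comp hflow).mul ((h.smooth_K 0).fst.continuous.comp hflow)).inv₀
      fun s => mul_ne_zero (hw0 _) (hκ _)
  have hne : ∀ s, m s ≠ 0 := fun s => inv_ne_zero (mul_ne_zero (hw0 _) (hκ _))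
  have hper := hS.periodic h hκ hΦ 1 0 0 y
  have hd' : ∀ s, HasDerivAt (fun s => s - S 1 0 s y) (m s) s := fun s => by
    have := (hasDerivAt_id' s).fun_sub (hd s y)
    rwa [sub_sub_cancel] at this
  obtain ⟨c, -, hc⟩ := exists_hasDerivAt_eq_slope (fun s => s - S 1 0 s y) m
    Real.two_pi_pos (fun s _ => (hd' s).continuousAt.continuousWithinAt) (fun s _ => hd' s)
  have hc1 : 0 < m c := by
    rw [zero_add] at hper
    rw [hc, hper]
    have := Real.two_pi_pos
    exact div_pos (by linarith) (by linarith)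
  have e : 1 - fderiv ℝ (unc S 1) (0, τ, y) (0, 1, 0) = m τ := by
    rw [(hasDerivAt_tau hS.smooth 1 0 τ y).unique (hd τ y)]
    simp [m]
  rw [e]
  by_contra hlt
  obtain ⟨s, hs⟩ := mem_range_of_exists_le_of_exists_ge hm ⟨τ, not_lt.1 hlt⟩ ⟨c, hc1.le⟩
  exact hne s hs

lemma IsSystemSol.phaseSlope_pos (hw : ContDiff ℝ ∞ w) (hw0 : ∀ y, w y ≠ 0) (N : ℕ) (τ : ℝ)
    (y : Space n) : 0 < phaseSlope S N 0 0 τ y := by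
  cases N with
  | zero => simp [phaseSlope]
  | succ N =>
    rw [phaseSlope, Finset.sum_range_succ', Finset.sum_eq_zero]
    · simpa using hS.phase_one_pos h hκ hΦ hG hw hw0 τ y
    · intro j _
      simp

/-- The slope of the phase relation is bounded from below near `t = 0` for small `ε`. -/
lemma IsSystemSol.exists_le_phaseSlope (hw : ContDiff ℝ ∞ w) (hw0 : ∀ y, w y ≠ 0) (N : ℕ)
    {Q : Set (Space n)} (hQ : IsCompact Q) : ∃ c > 0, ∃ r > 0, ∀ ε t, |ε| < r → |t| < r →
      ∀ y ∈ Q, ∀ τ, c ≤ phaseSlope S N ε t τ y := by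
  have hper := hS.periodic h hκ hΦ
  have hc := continuous_phaseSlope hS.smooth N
  have hcomp : IsCompact (Icc 0 (2 * Real.pi) ×ˢ Q) := isCompact_Icc.prod hQ
  have hc0 : Continuous fun q : ℝ × Space n => phaseSlope S N 0 0 q.1 q.2 :=
    hc.comp (continuous_const.prodMk continuous_id :
      Continuous fun q : ℝ × Space n => (((0 : ℝ), (0 : ℝ)), q))
  obtain ⟨c, hc0, hcle⟩ := hcomp.exists_forall_le' hc0.continuousOn fun q _ =>
    hS.phaseSlope_pos h hκ hΦ hG hw hw0 N q.1 q.2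
  -- Positivity at ε = t = 0, over one period and the compact set Q, persists uniformly for (ε, t)
  -- near the origin; periodicity then covers all τ.
  have hP : ∀ q ∈ Icc 0 (2 * Real.pi) ×ˢ Q, ∀ᶠ z : (ℝ × ℝ) × ℝ × Space n in 𝓝 ((0, 0), q),
      c / 2 < phaseSlope S N z.1.1 z.1.2 z.2.1 z.2.2 := fun q hq =>
    (hc.tendsto ((0, 0), q)).eventually (lt_mem_nhds ((half_lt_self hc0).trans_le (hcle q hq)))
  have hev := hcomp.eventually_forall_of_forall_eventually
    (P := fun (x : ℝ × ℝ) (q : ℝ × Space n) => c / 2 < phaseSlope S N x.1 x.2 q.1 q.2) hP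
  obtain ⟨r, hr, hr'⟩ := Metric.eventually_nhds_iff.1 hev
  refine ⟨c / 2, by positivity, r, hr, fun ε t hε ht y hy τ => ?_⟩
  have hp : Function.Periodic (fun τ => phaseSlope S N ε t τ y) (2 * Real.pi) := fun τ => by
    have h1 : ∀ k, fderiv ℝ (unc S k) (t, τ + 2 * Real.pi, y) (0, 1, 0) =
        fderiv ℝ (unc S k) (t, τ, y) (0, 1, 0) := fun k => by
      have h2 := (hasDerivAt_tau hS.smooth k t (τ + 2 * Real.pi) y).comp_add_const τ (2 * Real.pi)
      simp only [hper _ t _ y] at h2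
      exact h2.unique (hasDerivAt_tau hS.smooth k t τ y)
    simp only [phaseSlope, h1]
  obtain ⟨s, hs, hs'⟩ := hp.exists_mem_Ico₀ Real.two_pi_pos τ
  rw [hs']
  refine (hr' (y := (ε, t)) ?_ (s, y) ⟨Ico_subset_Icc_self hs, hy⟩).le
  rw [Prod.dist_eq, Real.dist_eq, Real.dist_eq, sub_zero, sub_zero]
  exact max_lt hε ht

-- The leading phase does not contribute, so every remaining term carries a factor ε.
include hΨ in
lemma IsSystemSol.hasDerivAt_phaseRelation (N : ℕ) (ε t τ : ℝ) (y : Space n) :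
    HasDerivAt (fun τ => ε * τ - partialSum S (N + 1) ε t τ y) (ε * phaseSlope S N ε t τ y) τ := by
  have h0 : HasDerivAt (fun τ => S 0 t τ y) 0 τ := by
    simp only [hS.phase_zero_eq h hκ hΦ hΨ hG t _ y]
    exact hasDerivAt_const _ _
  have h1 : HasDerivAt (fun τ => partialSum S (N + 1) ε t τ y)
      (∑ k ∈ Finset.range (N + 1), ε ^ k * fderiv ℝ (unc S k) (t, τ, y) (0, 1, 0)) τ :=
    HasDerivAt.fun_sum fun k _ => (hasDerivAt_tau hS.smooth k t τ y).const_mul _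
  have h2 := ((hasDerivAt_id' τ).const_mul ε).fun_sub h1
  rw [Finset.sum_range_succ', (hasDerivAt_tau hS.smooth 0 t τ y).unique h0, mul_zero, add_zero] at h2
  refine h2.congr_deriv ?_
  rw [phaseSlope, mul_sub, Finset.mul_sum]
  congr 1
  exact Finset.sum_congr rfl fun j _ => by ring

-- Near t = 0 and for small ε the relation is strictly increasing in τ, which gives uniqueness. The
-- solution therefore coincides locally with the smooth implicit function.
include hΨ in
theorem IsSystemSol.phaseSolvable (hw : ContDiff ℝ ∞ w) (hw0 : ∀ y, w y ≠ 0) :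
    PhaseSolvable S := by
  intro N
  refine ⟨fun ε hε t y => exists_phaseRelation hS.smooth (hS.periodic h hκ hΦ) N hε t y,
    fun y₀ => ?_⟩
  obtain ⟨c, hc, r, hr, hle⟩ := hS.exists_le_phaseSlope h hκ hΦ hG hw hw0 N
    (isCompact_closedBall y₀ 1)
  refine ⟨min r 1, by positivity, r, hr, fun ε hε => ?_⟩
  choose T hT using fun p : ℝ × Space n =>
    exists_phaseRelation hS.smooth (hS.periodic h hκ hΦ) N hε.1 p.1 p.2
  have hder := hS.hasDerivAt_phaseRelation h hκ hΦ hΨ hG N ε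
  have hpos : ∀ p ∈ Metric.ball ((0 : ℝ), y₀) (min r 1), ∀ τ,
      0 < ε * phaseSlope S N ε p.1 τ p.2 := by
    intro p hp τ
    rw [Metric.mem_ball, Prod.dist_eq, max_lt_iff, Real.dist_eq, sub_zero] at hp
    refine mul_pos hε.1 (hc.trans_le (hle ε p.1 ?_ (hp.1.trans_le (min_le_left _ _)) p.2 ?_ τ))
    · rw [abs_of_pos hε.1]
      exact hε.2
    · exact (hp.2.trans_le (min_le_right _ _)).le
  have huniq : ∀ p ∈ Metric.ball ((0 : ℝ), y₀) (min r 1), ∀ τ : ℝ,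
      PhaseRelation S N ε p.1 τ p.2 ↔ τ = T p := by
    intro p hp τ
    have hmono : StrictMono fun τ => ε * τ - partialSum S (N + 1) ε p.1 τ p.2 :=
      strictMono_of_deriv_pos fun τ => by
        rw [(hder p.1 τ p.2).deriv]
        exact hpos p hp τ
    refine ⟨fun hτ => hmono.injective ?_, fun hτ => hτ ▸ hT p⟩
    rw [sub_eq_zero.2 hτ, sub_eq_zero.2 (hT p)]
  refine ⟨T, fun p hp => ContDiffAt.contDiffWithinAt ?_, huniq⟩
  set F : (ℝ × Space n) × ℝ → ℝ := fun q => ε * q.2 - partialSum S (N + 1) ε q.1.1 q.2 q.1.2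
  have hF : ContDiff ℝ ∞ F := (contDiff_const.mul contDiff_snd).sub
    (ContDiff.sum fun k _ => contDiff_const.mul ((hS.smooth k).comp
      (by fun_prop : ContDiff ℝ ∞ fun q : (ℝ × Space n) × ℝ => (q.1.1, q.2, q.1.2))))
  have hFat : ContDiffAt ℝ ∞ F (p, T p) := hF.contDiffAt
  have hinv : (fderiv ℝ F (p, T p) ∘L .inr ℝ (ℝ × Space n) ℝ).IsInvertible := by
    have h1 : HasDerivAt (fun τ => F (p, τ)) (fderiv ℝ F (p, T p) (0, 1)) (T p) :=
      (hF.differentiable (by simp) (p, T p)).hasFDerivAt.comp_hasDerivAt (f := fun τ => (p, τ))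
        (T p) ((hasDerivAt_const _ p).prodMk (hasDerivAt_id _))
    have h2 := h1.unique (hder p.1 (T p) p.2)
    have hne := (hpos p hp (T p)).ne'
    refine ⟨ContinuousLinearEquiv.unitsEquivAut ℝ (Units.mk0 _ hne), ?_⟩
    ext
    simp [h2]
  have hev := hFat.eventually_apply_implicitFunction (by simp) hinv
  refine (hFat.contDiffAt_implicitFunction (by simp) hinv).congr_of_eventuallyEq ?_
  filter_upwards [hev, Metric.isOpen_ball.mem_nhds hp] with q hq hqb
  refine ((huniq q hqb _).1 ?_).symm
  have h0 : F (p, T p) = 0 := sub_eq_zero.2 (hT p)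
  rw [h0] at hq
  exact sub_eq_zero.1 hq

end Phase


/-! ### Characteristics -/

section Curves

/-- A compactly supported smooth vector field has integral curves on `[0, 1]`. -/
lemma exists_integralCurve {E : Type} [NormedAddCommGroup E] [NormedSpace ℝ E] [CompleteSpace E]
    {X : E → E} {C L : NNReal} (hX : LipschitzWith C X) (hL : ∀ x, ‖X x‖ ≤ L) (x : E) :
    ∃ α : ℝ → E, α 0 = x ∧ ∀ θ ∈ Icc (0 : ℝ) 1, HasDerivWithinAt α (X (α θ)) (Icc 0 1) θ := by
  -- A curve of speed at most L stays within distance L of x during unit time, so the radius L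
  -- suffices.
  have hp : IsPicardLindelof (fun _ : ℝ => X) (⟨0, by simp⟩ : Icc (0 : ℝ) 1) x L 0 L C :=
    ⟨fun _ _ => hX.lipschitzOnWith, fun _ _ => continuousOn_const, fun _ _ y _ => hL y, by simp⟩
  exact hp.exists_eq_forall_mem_Icc_hasDerivWithinAt₀

/-- A continuous function on `[0, 1]` which is `< 1` as long as it is `≤ 1` stays `< 1`. -/
lemma lt_one_of_bootstrap {g : ℝ → ℝ} (hg : ContinuousOn g (Icc 0 1)) (h0 : g 0 < 1)
    (h : ∀ b ∈ Icc (0 : ℝ) 1, (∀ θ ∈ Icc 0 b, g θ ≤ 1) → g b < 1) :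
    ∀ θ ∈ Icc (0 : ℝ) 1, g θ < 1 := by
  by_contra hcon
  push Not at hcon
  have hivt : ∀ θ ∈ Icc (0 : ℝ) 1, 1 ≤ g θ → ∃ θ' ∈ Icc 0 θ, g θ' = 1 := fun θ hθ h1 =>
    intermediate_value_Icc hθ.1 (hg.mono (Icc_subset_Icc_right hθ.2)) ⟨h0.le, h1⟩
  have hA : IsCompact (Icc (0 : ℝ) 1 ∩ g ⁻¹' {1}) :=
    isCompact_Icc.of_isClosed_subset (hg.preimage_isClosed_of_isClosed isClosed_Icc
      isClosed_singleton) inter_subset_left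
  obtain ⟨θ₁, hθ₁, h1⟩ := hcon
  obtain ⟨θ₂, hθ₂, h2⟩ := hivt θ₁ hθ₁ h1
  -- At the first point b where g equals 1, the function has stayed at most 1 before, so the
  -- hypothesis contradicts g(b) = 1.
  obtain ⟨b, ⟨hb, hb1⟩, hmin⟩ := hA.exists_isLeast ⟨θ₂, ⟨hθ₂.1, hθ₂.2.trans hθ₁.2⟩, h2⟩
  refine (h b hb fun θ hθ => ?_).ne hb1
  by_contra hlt
  have hθ1 : θ ∈ Icc (0 : ℝ) 1 := ⟨hθ.1, hθ.2.trans hb.2⟩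
  obtain ⟨θ', hθ', h'⟩ := hivt θ hθ1 (not_le.1 hlt).le
  have hle : b ≤ θ' := hmin ⟨⟨hθ'.1, hθ'.2.trans hθ1.2⟩, h'⟩
  have : θ = b := le_antisymm hθ.2 (hle.trans hθ'.2)
  rw [this] at hlt
  exact hlt (le_of_eq hb1)

lemma norm_le_sum_abs {n : ℕ} (x : Space n) : ‖x‖ ≤ ∑ i, |x i| := by
  rw [EuclideanSpace.norm_eq]
  refine Real.sqrt_le_iff.2 ⟨by positivity, ?_⟩
  exact Finset.sum_sq_le_sq_sum_of_nonneg fun i _ => norm_nonneg _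

end Curves

/-! ### Bounds and transport along the characteristics -/

section Recovery

variable {n : ℕ} {w : Space n → ℝ} {G K : Space n → Space n} {Gε Kε : ℕ → Space n → ℝ × Space n}
  {Φ Ψ : ℝ → Space n → Space n} {σ : ℝ} {u₀ : Space n → ℝ} {u : ℕ → ℝ → ℝ → Space n → ℝ}

/-- The field `(1, w / ε, F^ε)`. -/
def charField (w : Space n → ℝ) (G K : Space n → Space n) (ε : ℝ) (y : Space n) :
    ℝ × ℝ × Space n := (1, ε⁻¹ * w y, oscField w G K ε y)

/-- The operator `∂ₜ + K · ∇`. -/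
def slowDeriv (K : Space n → Space n) (u : ℕ → ℝ → ℝ → Space n → ℝ) (k : ℕ)
    (P : ℝ × ℝ × Space n) : ℝ := fderiv ℝ (unc u k) P (1, 0, K P.2.2)

/-- The sum telescopes: the fast derivative of each coefficient cancels the slow derivative of the
previous one. Only the last slow derivative survives, together with the source, which enters at
order one and so is absent for N = 0. -/
lemma IsSystemSol.sum_charField (h : IsNormalForm w G K Gε Kε) (hκ : ∀ y, (Kε 0 y).1 ≠ 0)
    (hw0 : ∀ y, w y ≠ 0) (hu : IsSystemSol Gε Kε σ u₀ u) {ε : ℝ} (hε : ε ≠ 0) (N : ℕ)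
    (P : ℝ × ℝ × Space n) :
    ∑ k ∈ Finset.range (N + 1), ε ^ k * fderiv ℝ (unc u k) P (charField w G K ε P.2.2) =
      ε ^ N * slowDeriv K u N P + if N = 0 then 0 else σ * w P.2.2 := by
  obtain ⟨h0, h1⟩ := hu.transport h hκ P
  have e : charField w G K ε P.2.2 =
      (ε⁻¹ * w P.2.2) • (0, 1, G P.2.2) + (1, 0, K P.2.2) := by
    simp [charField, oscField]
  have hw := hw0 P.2.2
  induction N with
  | zero =>
    rw [Finset.sum_range_one, e, map_add, map_smul, h0]
    simp [slowDeriv]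
  | succ N ih =>
    rw [Finset.sum_range_succ, ih, e, map_add, map_smul, eq_sub_of_add_eq (h1 N), if_neg N.succ_ne_zero,
      pow_succ, slowDeriv, slowDeriv, smul_eq_mul]
    by_cases hN : N = 0
    · subst hN
      simp only [if_true]
      field_simp
      ring
    · simp only [if_neg hN]
      field_simp
      ring

lemma continuous_slowDeriv (hK : ContDiff ℝ ∞ K) (hu : SmoothSeries u) (k : ℕ) :
    Continuous (slowDeriv K u k) :=
  ((hu k).continuous_fderiv (by simp)).clm_apply
    (continuous_const.prodMk (continuous_const.prodMk (hK.continuous.comp (by fun_prop))))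

lemma fderiv_add_two_pi (hper : PeriodicSeries u) (k : ℕ) (t τ : ℝ) (y : Space n) :
    fderiv ℝ (unc u k) (t, τ + 2 * Real.pi, y) = fderiv ℝ (unc u k) (t, τ, y) := by
  have e : (fun P => unc u k (P + (0, 2 * Real.pi, 0))) = unc u k := funext fun P => by
    simpa [unc] using hper k P.1 P.2.1 P.2.2
  have := fderiv_comp_add_right (𝕜 := ℝ) (f := unc u k) (x := (t, τ, y)) (0, 2 * Real.pi, 0)
  rw [e] at this
  rw [this]
  simp

lemma exists_bound {g : ℝ × ℝ × Space n → ℝ} (hg : Continuous g)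
    (hper : ∀ t τ y, g (t, τ + 2 * Real.pi, y) = g (t, τ, y)) (T : ℝ) {Q : Set (Space n)}
    (hQ : IsCompact Q) : ∃ B, ∀ t τ y, |t| ≤ T → y ∈ Q → |g (t, τ, y)| ≤ B := by
  obtain ⟨B, hB⟩ := ((isCompact_Icc (a := -T) (b := T)).prod
    ((isCompact_Icc (a := 0) (b := 2 * Real.pi)).prod hQ)).exists_bound_of_continuousOn
      hg.continuousOn
  refine ⟨B, fun t τ y ht hy => ?_⟩
  have hp : Function.Periodic (fun τ => g (t, τ, y)) (2 * Real.pi) := fun τ => hper t τ y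
  obtain ⟨s, hs, hs'⟩ := hp.exists_mem_Ico₀ Real.two_pi_pos τ
  rw [hs']
  exact hB _ ⟨abs_le.1 ht, Ico_subset_Icc_self hs, hy⟩

/-- Uniform bounds for the first coefficients of a solution. -/
lemma exists_bound_series (hK : ContDiff ℝ ∞ K) (hu : SmoothSeries u) (hper : PeriodicSeries u)
    (N : ℕ) (T : ℝ) {Q : Set (Space n)} (hQ : IsCompact Q) :
    ∃ B ≥ 0, ∀ k ≤ N, ∀ t τ y, |t| ≤ T → y ∈ Q → |u k t τ y| ≤ B ∧
      |slowDeriv K u k (t, τ, y)| ≤ B ∧ |fderiv ℝ (unc u k) (t, τ, y) (0, 1, 0)| ≤ B := by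
  have h1 : ∀ k, ∃ B, ∀ t τ y, |t| ≤ T → y ∈ Q → |unc u k (t, τ, y)| ≤ B := fun k =>
    exists_bound (hu k).continuous (fun t τ y => hper k t τ y) T hQ
  have h2 : ∀ k, ∃ B, ∀ t τ y, |t| ≤ T → y ∈ Q → |slowDeriv K u k (t, τ, y)| ≤ B := fun k =>
    exists_bound (continuous_slowDeriv hK hu k) (fun t τ y => by
      rw [slowDeriv, fderiv_add_two_pi hper]; rfl) T hQ
  have h3 : ∀ k, ∃ B, ∀ t τ y, |t| ≤ T → y ∈ Q →
      |fderiv ℝ (unc u k) (t, τ, y) (0, 1, 0)| ≤ B := fun k =>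
    exists_bound (g := fun P => fderiv ℝ (unc u k) P (0, 1, 0))
      (((hu k).continuous_fderiv (by simp)).clm_apply continuous_const)
      (fun t τ y => by rw [fderiv_add_two_pi hper]) T hQ
  choose B₁ hB₁ using h1
  choose B₂ hB₂ using h2
  choose B₃ hB₃ using h3
  have hle : ∀ k ≤ N, ∀ f : ℕ → ℝ, (∀ j, 0 ≤ f j) → f k ≤ ∑ j ∈ Finset.range (N + 1), f j :=
    fun k hk f hf => Finset.single_le_sum (fun j _ => hf j)
      (Finset.mem_range.2 (Nat.lt_succ_of_le hk))
  refine ⟨∑ j ∈ Finset.range (N + 1), (|B₁ j| + |B₂ j| + |B₃ j|),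
    Finset.sum_nonneg fun j _ => by positivity, fun k hk t τ y ht hy => ?_⟩
  have := hle k hk (fun j => |B₁ j| + |B₂ j| + |B₃ j|) fun j => by positivity
  have a1 := (hB₁ k t τ y ht hy).trans (le_abs_self _)
  have a2 := (hB₂ k t τ y ht hy).trans (le_abs_self _)
  have a3 := (hB₃ k t τ y ht hy).trans (le_abs_self _)
  have p1 := abs_nonneg (B₁ k)
  have p2 := abs_nonneg (B₂ k)
  have p3 := abs_nonneg (B₃ k)
  refine ⟨a1.trans ?_, a2.trans ?_, a3.trans ?_⟩ <;> linarith

/-- The leading profile is constant in t along Ψ and, at t = 0, constant in τ along Φ. With the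
coordinates as initial data it gives the components of the slow variable Φ_{-τ}Ψ_{-t}y. -/
lemma IsSystemSol.leading_eq (h : IsNormalForm w G K Gε Kε) (hκ : ∀ y, (Kε 0 y).1 ≠ 0)
    (hΦ : GeneratesFlow G Φ) (hΨ : GeneratesFlow (fun y => ((Kε 0 y).1)⁻¹ • (Kε 0 y).2) Ψ)
    (hG : ContDiff ℝ ∞ G) (hu : IsSystemSol Gε Kε 0 u₀ u) (t τ : ℝ) (y : Space n) :
    u 0 t τ y = u₀ (Φ (-τ) (Ψ (-t) y)) := by
  have ha : ContDiff ℝ ∞ (fun y => ((Kε 0 y).1)⁻¹ • (Kε 0 y).2) :=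
    ((h.smooth_K 0).fst.inv hκ).smul (h.smooth_K 0).snd
  have h1 : ∀ z s, HasDerivAt (fun s => unc u 0 (s, τ, Ψ s z)) 0 s := fun z s => by
    have h2 := (hasFDerivAt_unc hu.smooth 0 (s, τ, Ψ s z)).comp_hasDerivAt
      (f := fun s => (s, τ, Ψ s z)) s
      ((hasDerivAt_id s).prodMk ((hasDerivAt_const s τ).prodMk (hΨ.ode s z)))
    refine h2.congr_deriv ?_
    have e : ((1, 0, ((Kε 0 (Ψ s z)).1)⁻¹ • (Kε 0 (Ψ s z)).2) : ℝ × ℝ × Space n) =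
        ((Kε 0 (Ψ s z)).1)⁻¹ • ((Kε 0 (Ψ s z)).1, 0, (Kε 0 (Ψ s z)).2) := by
      simp [inv_mul_cancel₀ (hκ (Ψ s z))]
    rw [e, map_smul, hu.leading (s, τ, Ψ s z), smul_zero]
  have h2 : ∀ z s, HasDerivAt (fun s => unc u 0 (0, s, Φ s z)) 0 s := fun z s => by
    have h2 := (hasFDerivAt_unc hu.smooth 0 (0, s, Φ s z)).comp_hasDerivAt
      (f := fun s => (0, s, Φ s z)) s
      ((hasDerivAt_const s (0 : ℝ)).prodMk ((hasDerivAt_id s).prodMk (hΦ.ode s z)))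
    exact h2.congr_deriv (hu.transport h hκ (0, s, Φ s z)).1
  have c1 := is_const_of_deriv_eq_zero (fun s => (h1 (Ψ (-t) y) s).differentiableAt)
    (fun s => (h1 (Ψ (-t) y) s).deriv) t 0
  have c2 := is_const_of_deriv_eq_zero (fun s => (h2 (Φ (-τ) (Ψ (-t) y)) s).differentiableAt)
    (fun s => (h2 (Φ (-τ) (Ψ (-t) y)) s).deriv) τ 0
  rw [hΨ.apply_apply_neg ha, hΨ.init] at c1
  rw [hΦ.apply_apply_neg hG, hΦ.init] at c2
  exact c1.trans (c2.trans (hu.init 0 _))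

lemma contDiff_oscField (hw : ContDiff ℝ ∞ w) (hG : ContDiff ℝ ∞ G) (hK : ContDiff ℝ ∞ K)
    (ε : ℝ) : ContDiff ℝ ∞ (oscField w G K ε) :=
  ((contDiff_const.mul hw).smul hG).add hK

/-- Backward characteristics, as long as they stay in a given ball. -/
lemma exists_characteristic (hw : ContDiff ℝ ∞ w) (hG : ContDiff ℝ ∞ G) (hK : ContDiff ℝ ∞ K)
    {R : ℝ} (hR : 0 < R) (ε t τ : ℝ) (y : Space n) :
    ∃ γ : ℝ → ℝ × ℝ × Space n, γ 0 = (t, τ, y) ∧ (∀ θ, (γ θ).1 = t * (1 - θ)) ∧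
      ContinuousOn γ (Icc 0 1) ∧ ∀ θ ∈ Icc (0 : ℝ) 1, ‖(γ θ).2.2‖ ≤ R →
        HasDerivWithinAt γ (-t • charField w G K ε (γ θ).2.2) (Icc 0 1) θ := by
  -- The cutoff makes the field bounded and Lipschitz without changing it in the ball of radius R.
  -- The factor -t lets θ in [0, 1] run time from t back to 0.
  let χ : ContDiffBump (0 : Space n) := ⟨R, R + 1, hR, by linarith⟩
  set X : Space n → ℝ × Space n := fun y =>
    χ y • (-t * (ε⁻¹ * w y), -t • oscField w G K ε y) with hXdef
  have hXs : ContDiff ℝ ∞ X := χ.contDiff.smul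
    ((contDiff_const.mul (contDiff_const.mul hw)).prodMk
      ((contDiff_oscField hw hG hK ε).const_smul (-t)))
  have hXc : HasCompactSupport X := χ.hasCompactSupport.smul_right
  obtain ⟨C, hC⟩ := ContDiff.lipschitzWith_of_hasCompactSupport hXc hXs (by simp)
  obtain ⟨L, hL⟩ := hXc.exists_bound_of_continuous hXs.continuous
  obtain ⟨α, hα0, hα⟩ := exists_integralCurve (X := fun q : ℝ × Space n => X q.2)
    (C := C * 1) (L := L.toNNReal) (hC.comp LipschitzWith.prod_snd)
    (fun q => (hL q.2).trans (Real.le_coe_toNNReal L)) (τ, y)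
  have hd : ∀ θ ∈ Icc (0 : ℝ) 1, HasDerivWithinAt (fun θ => (t * (1 - θ), α θ))
      (-t, X (α θ).2) (Icc 0 1) θ := fun θ hθ => by
    have h1 : HasDerivAt (fun θ : ℝ => t * (1 - θ)) (t * -1) θ :=
      ((hasDerivAt_id' θ).const_sub 1).const_mul t
    rw [mul_neg_one] at h1
    exact h1.hasDerivWithinAt.prodMk (hα θ hθ)
  refine ⟨fun θ => (t * (1 - θ), α θ), by simp [hα0], fun _ => rfl,
    fun θ hθ => (hd θ hθ).continuousWithinAt, fun θ hθ hy => (hd θ hθ).congr_deriv ?_⟩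
  have h1 : χ (α θ).2 = 1 := χ.one_of_mem_closedBall (by simpa using hy)
  simp [hXdef, h1, charField]

lemma IsSystemSol.hasDerivWithinAt_sum (h : IsNormalForm w G K Gε Kε)
    (hκ : ∀ y, (Kε 0 y).1 ≠ 0) (hw0 : ∀ y, w y ≠ 0) (hu : IsSystemSol Gε Kε σ u₀ u) {ε : ℝ}
    (hε : ε ≠ 0) (N : ℕ) {γ : ℝ → ℝ × ℝ × Space n} {t θ : ℝ} {s : Set ℝ}
    (hγ : HasDerivWithinAt γ (-t • charField w G K ε (γ θ).2.2) s θ) :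
    HasDerivWithinAt (fun θ => ∑ k ∈ Finset.range (N + 1), ε ^ k * unc u k (γ θ))
      (-t * (ε ^ N * slowDeriv K u N (γ θ) + if N = 0 then 0 else σ * w (γ θ).2.2)) s θ := by
  rw [← hu.sum_charField h hκ hw0 hε, Finset.mul_sum]
  refine HasDerivWithinAt.fun_sum fun k _ => ?_
  refine (((hasFDerivAt_unc hu.smooth k (γ θ)).comp_hasDerivWithinAt θ hγ).const_mul
    (ε ^ k)).congr_deriv ?_
  rw [map_smul, smul_eq_mul]
  ring

/-- Mean value inequality on an initial segment of `[0, 1]`. -/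
lemma abs_sub_le_of_hasDerivWithinAt {V V' : ℝ → ℝ} {B b : ℝ} (hb : b ∈ Icc (0 : ℝ) 1)
    (hV : ∀ θ ∈ Icc 0 b, HasDerivWithinAt V (V' θ) (Icc 0 1) θ) (hB : ∀ θ ∈ Icc 0 b, |V' θ| ≤ B) :
    |V b - V 0| ≤ B := by
  have h0 : (0 : ℝ) ∈ Icc 0 b := ⟨le_rfl, hb.1⟩
  have h1 := Convex.norm_image_sub_le_of_norm_hasDerivWithin_le
    (fun θ hθ => (hV θ hθ).mono (Icc_subset_Icc_right hb.2)) hB (convex_Icc 0 b) h0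
    (⟨hb.1, le_rfl⟩ : b ∈ Icc 0 b)
  have hB0 : 0 ≤ B := (abs_nonneg _).trans (hB 0 h0)
  rw [sub_zero, Real.norm_eq_abs, Real.norm_eq_abs, abs_of_nonneg hb.1] at h1
  exact h1.trans (mul_le_of_le_one_right hB0 hb.2)

lemma exists_mem_Icc_flow_eq (hper : ∀ τ y, Φ (τ + 2 * Real.pi) y = Φ τ y) (τ : ℝ)
    (y : Space n) : ∃ s ∈ Icc 0 (2 * Real.pi), Φ τ y = Φ s y := by
  have hp : Function.Periodic (fun τ => Φ τ y) (2 * Real.pi) := fun τ => hper τ y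
  obtain ⟨s, hs, hs'⟩ := hp.exists_mem_Ico₀ Real.two_pi_pos τ
  exact ⟨s, Ico_subset_Icc_self hs, hs'⟩

/-- A classical solution is constant along the characteristics. -/
lemma IsTransportSolution.hasDerivWithinAt {ε : ℝ} {f₀ : Space n → ℝ} {f : ℝ → Space n → ℝ}
    (hf : IsTransportSolution (oscField w G K ε) f₀ f) {γ : ℝ → ℝ × ℝ × Space n} {t θ : ℝ}
    {s : Set ℝ} (hγ : HasDerivWithinAt γ (-t • charField w G K ε (γ θ).2.2) s θ) :
    HasDerivWithinAt (fun θ => f (γ θ).1 (γ θ).2.2) 0 s θ := by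
  rcases hP : γ θ with ⟨a, b, y⟩
  rw [hP] at hγ
  have hd := (hf.diff (a, y)).hasFDerivAt
  have h1 : HasDerivAt (fun s => f s y) (fderiv ℝ (fun p : ℝ × Space n => f p.1 p.2) (a, y) (1, 0)) a :=
    hd.comp_hasDerivAt (f := fun s => (s, y)) a ((hasDerivAt_id a).prodMk (hasDerivAt_const a y))
  have h2 : HasFDerivAt (f a) _ y := hd.comp (f := fun y => (a, y)) y (hasFDerivAt_prodMk_right a y)
  have h3 := hf.eq a y
  rw [h1.deriv, h2.fderiv] at h3
  have h4 : HasDerivWithinAt (fun θ => ((γ θ).1, (γ θ).2.2)) (-t • (1, oscField w G K ε y)) s θ := by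
    have e : ∀ v : ℝ × ℝ × Space n, ((ContinuousLinearMap.fst ℝ ℝ (ℝ × Space n)).prod
      (ContinuousLinearMap.snd ℝ ℝ (Space n) ∘L ContinuousLinearMap.snd ℝ ℝ (ℝ × Space n))) v =
        (v.1, v.2.2) := fun _ => rfl
    have := ((ContinuousLinearMap.fst ℝ ℝ (ℝ × Space n)).prod
      (ContinuousLinearMap.snd ℝ ℝ (Space n) ∘L
        ContinuousLinearMap.snd ℝ ℝ (ℝ × Space n))).hasFDerivAt.comp_hasDerivWithinAt θ hγ
    exact this
  have hd' : HasFDerivAt (fun p : ℝ × Space n => f p.1 p.2)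
      (fderiv ℝ (fun p : ℝ × Space n => f p.1 p.2) (a, y)) ((γ θ).1, (γ θ).2.2) := by
    rw [hP]
    exact hd
  refine (hd'.comp_hasDerivWithinAt (f := fun θ => ((γ θ).1, (γ θ).2.2)) θ h4).congr_deriv ?_
  have e : ((1, oscField w G K ε y) : ℝ × Space n) = (1, 0) + (0, oscField w G K ε y) := by simp
  have h5 : fderiv ℝ (fun p : ℝ × Space n => f p.1 p.2) (a, y) (1, oscField w G K ε y) = 0 := by
    rw [e, map_add]
    exact h3
  rw [map_smul, h5, smul_zero]

end Recovery


/-! ### The asymptotic expansion -/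

section Expansion

variable {n : ℕ} {w : Space n → ℝ} {G K : Space n → Space n} {Gε Kε : ℕ → Space n → ℝ × Space n}
  {Φ Ψ : ℝ → Space n → Space n}

/-- Backward characteristics exist up to `t = 0` and stay in a compact set, uniformly in `ε`. -/
lemma exists_confined_characteristic (h : IsNormalForm w G K Gε Kε) (hκ : ∀ y, (Kε 0 y).1 ≠ 0)
    (hw : ContDiff ℝ ∞ w) (hw0 : ∀ y, w y ≠ 0) (hG : ContDiff ℝ ∞ G) (hK : ContDiff ℝ ∞ K)
    (hΦ : GeneratesFlow G Φ) (hper : ∀ τ y, Φ (τ + 2 * Real.pi) y = Φ τ y)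
    (hΨ : GeneratesFlow (fun y => ((Kε 0 y).1)⁻¹ • (Kε 0 y).2) Ψ) {C : Set (ℝ × Space n)}
    (hC : IsCompact C) {T : ℝ} (hT : ∀ p ∈ C, |p.1| ≤ T) :
    ∃ Q : Set (Space n), IsCompact Q ∧ ∃ ε₀ > 0, ∀ ε ∈ Ioo 0 ε₀, ∀ p ∈ C, ∀ τ : ℝ,
      ∃ γ : ℝ → ℝ × ℝ × Space n, γ 0 = (p.1, τ, p.2) ∧ (∀ θ, (γ θ).1 = p.1 * (1 - θ)) ∧
        ∀ θ ∈ Icc (0 : ℝ) 1, (γ θ).2.2 ∈ Q ∧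
          HasDerivWithinAt γ (-p.1 • charField w G K ε (γ θ).2.2) (Icc 0 1) θ := by
  have ha : ContDiff ℝ ∞ (fun y => ((Kε 0 y).1)⁻¹ • (Kε 0 y).2) :=
    ((h.smooth_K 0).fst.inv hκ).smul (h.smooth_K 0).snd
  have hΦc : Continuous fun p : ℝ × Space n => Φ p.1 p.2 := (hΦ.contDiff hG).continuous
  have hΨc : Continuous fun p : ℝ × Space n => Ψ p.1 p.2 := (hΨ.contDiff ha).continuous
  -- Z₀ contains every initial value of z = Φ_{-τ}Ψ_{-t}y, one period of Φ being enough. Q contains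
  -- every y = Ψ_tΦ_τ z with |t| ≤ T and z within distance 1 of Z₀.
  set Z₀ : Set (Space n) := (fun q : ℝ × ℝ × Space n => Φ q.1 (Ψ (-q.2.1) q.2.2)) ''
    (Icc 0 (2 * Real.pi) ×ˢ C)
  have hZ₀ : IsCompact Z₀ := (isCompact_Icc.prod hC).image
    (hΦc.comp (continuous_fst.prodMk (hΨc.comp (by fun_prop :
      Continuous fun q : ℝ × ℝ × Space n => (-q.2.1, q.2.2)))))
  have hZ₁ : IsCompact (Metric.cthickening 1 Z₀) := hZ₀.cthickening
  set Q : Set (Space n) := (fun q : ℝ × ℝ × Space n => Ψ q.1 (Φ q.2.1 q.2.2)) ''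
    (Icc (-T) T ×ˢ (Icc 0 (2 * Real.pi) ×ˢ Metric.cthickening 1 Z₀))
  have hQ : IsCompact Q := (isCompact_Icc.prod (isCompact_Icc.prod hZ₁)).image
    (hΨc.comp (continuous_fst.prodMk (hΦc.comp continuous_snd)))
  obtain ⟨R, hR, hQR⟩ := hQ.isBounded.exists_pos_norm_le
  -- Profiles with coordinate initial data: their leading terms are the coordinates of z, and their
  -- first two terms together form an almost conserved quantity.
  choose E hE using fun i : Fin n => exists_isSystemSol h hκ hΦ hΨ (u₀ := fun y => y i) 0
    (by fun_prop)
  choose B hB0 hB using fun i : Fin n => exists_bound_series hK (hE i).smooth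
    ((hE i).periodic h hκ hΦ) 1 T hQ
  -- This choice keeps the displacement of z below 1: |T| B_i comes from the drift of the two-term
  -- sum, and 2 B_i from its order-one term at both ends.
  refine ⟨Q, hQ, 1 / (∑ i, (|T| + 2) * B i + 1), ?_, fun ε hε p hp τ => ?_⟩
  · have : 0 ≤ ∑ i, (|T| + 2) * B i := Finset.sum_nonneg fun i _ =>
      mul_nonneg (by positivity) (hB0 i)
    positivity
  obtain ⟨γ, hγ0, hγ1, hγc, hγ⟩ := exists_characteristic hw hG hK hR ε p.1 τ p.2
  refine ⟨γ, hγ0, hγ1, ?_⟩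
  set z : ℝ → Space n := fun θ => Φ (-(γ θ).2.1) (Ψ (-(γ θ).1) (γ θ).2.2) with hz
  have hzc : ContinuousOn z (Icc 0 1) := by
    have : Continuous fun P : ℝ × ℝ × Space n => Φ (-P.2.1) (Ψ (-P.1) P.2.2) :=
      hΦc.comp ((by fun_prop : Continuous fun P : ℝ × ℝ × Space n => -P.2.1).prodMk
        (hΨc.comp (by fun_prop : Continuous fun P : ℝ × ℝ × Space n => (-P.1, P.2.2))))
    exact this.comp_continuousOn hγc
  have hγz : ∀ θ, (γ θ).2.2 = Ψ (γ θ).1 (Φ (γ θ).2.1 (z θ)) := fun θ => by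
    rw [hz, hΦ.apply_apply_neg hG, hΨ.apply_apply_neg ha]
  have ht : ∀ θ ∈ Icc (0 : ℝ) 1, |(γ θ).1| ≤ T := fun θ hθ => by
    rw [hγ1, abs_mul, abs_of_nonneg (sub_nonneg.2 hθ.2)]
    exact (mul_le_of_le_one_right (abs_nonneg _) (by linarith [hθ.1])).trans (hT p hp)
  have hmem : ∀ θ ∈ Icc (0 : ℝ) 1, z θ ∈ Metric.cthickening 1 Z₀ → (γ θ).2.2 ∈ Q := by
    intro θ hθ hzθ
    obtain ⟨s, hs, hs'⟩ := exists_mem_Icc_flow_eq hper (γ θ).2.1 (z θ)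
    exact ⟨((γ θ).1, s, z θ), ⟨abs_le.1 (ht θ hθ), hs, hzθ⟩, by
      simp only
      rw [← hs', ← hγz]⟩
  have hz0 : z 0 ∈ Z₀ := by
    obtain ⟨s, hs, hs'⟩ := exists_mem_Icc_flow_eq hper (-(γ 0).2.1) (Ψ (-(γ 0).1) (γ 0).2.2)
    refine ⟨(s, p), ⟨hs, hp⟩, ?_⟩
    simp only [hz]
    rw [hs', hγ0]
  have hzmem : ∀ θ, ‖z θ - z 0‖ ≤ 1 → z θ ∈ Metric.cthickening 1 Z₀ := fun θ hθ =>
    Metric.mem_cthickening_of_dist_le _ (z 0) 1 _ hz0 (by rwa [dist_eq_norm])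
  have hEz : ∀ i θ, unc (E i) 0 (γ θ) = z θ i := fun i θ =>
    (hE i).leading_eq h hκ hΦ hΨ hG _ _ _
  have hlt : ∀ θ ∈ Icc (0 : ℝ) 1, ‖z θ - z 0‖ < 1 := by
    -- The bounds on the profiles hold only while y is in Q, that is, while z has moved by at most
    -- 1; they then show that it has moved by less than 1.
    refine lt_one_of_bootstrap ((hzc.sub continuousOn_const).norm) (by simp) fun b hb hle => ?_
    have hQb : ∀ θ ∈ Icc 0 b, (γ θ).2.2 ∈ Q := fun θ hθ =>
      hmem θ ⟨hθ.1, hθ.2.trans hb.2⟩ (hzmem θ (hle θ hθ))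
    have hcoord : ∀ i, |(z b - z 0) i| ≤ ε * ((|T| + 2) * B i) := by
      intro i
      have h1 : ∀ θ ∈ Icc 0 b, _ := fun θ hθ => (hE i).hasDerivWithinAt_sum h hκ hw0 hε.1.ne' 1
        (hγ θ ⟨hθ.1, hθ.2.trans hb.2⟩ (hQR _ (hQb θ hθ)))
      have hBθ : ∀ θ ∈ Icc 0 b, _ := fun θ hθ => hB i 1 le_rfl (γ θ).1 (γ θ).2.1 (γ θ).2.2
        (ht θ ⟨hθ.1, hθ.2.trans hb.2⟩) (hQb θ hθ)
      have h2 := abs_sub_le_of_hasDerivWithinAt (B := |T| * (ε * B i)) hb h1 fun θ hθ => by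
        rw [abs_mul, abs_neg, if_neg one_ne_zero, zero_mul, add_zero, abs_mul, pow_one,
          abs_of_pos hε.1]
        have h3 := (hBθ θ hθ).2.1
        have h4 := (hT p hp).trans (le_abs_self T)
        have := hε.1
        gcongr
      simp only [Finset.sum_range_succ, Finset.sum_range_zero, zero_add, pow_zero, one_mul, pow_one,
        hEz] at h2
      have e1 : |unc (E i) 1 (γ b)| ≤ B i := (hBθ b ⟨hb.1, le_rfl⟩).1
      have e2 : |unc (E i) 1 (γ 0)| ≤ B i := (hBθ 0 ⟨le_rfl, hb.1⟩).1
      have e3 : (z b - z 0) i = (z b i + ε * unc (E i) 1 (γ b) - (z 0 i + ε * unc (E i) 1 (γ 0))) -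
          ε * unc (E i) 1 (γ b) + ε * unc (E i) 1 (γ 0) := by
        rw [PiLp.sub_apply]
        ring
      rw [e3]
      refine (abs_add_le _ _).trans ((add_le_add_left (abs_sub _ _) _).trans ?_)
      rw [abs_mul, abs_mul, abs_of_pos hε.1]
      have f1 := mul_le_mul_of_nonneg_left e1 hε.1.le
      have f2 := mul_le_mul_of_nonneg_left e2 hε.1.le
      linarith
    calc ‖z b - z 0‖ ≤ ∑ i, |(z b - z 0) i| := norm_le_sum_abs _
      _ ≤ ∑ i, ε * ((|T| + 2) * B i) := Finset.sum_le_sum fun i _ => hcoord i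
      _ = ε * ∑ i, (|T| + 2) * B i := by rw [Finset.mul_sum]
      _ < 1 := by
        have hs : 0 ≤ ∑ i, (|T| + 2) * B i := Finset.sum_nonneg fun i _ =>
          mul_nonneg (by positivity) (hB0 i)
        have h5 := hε.2
        rw [lt_div_iff₀ (by positivity)] at h5
        linarith [hε.1]
  intro θ hθ
  have hθQ := hmem θ hθ (hzmem θ (hlt θ hθ).le)
  exact ⟨hθQ, hγ θ hθ (hQR _ hθQ)⟩

/-- Going back to t = 0 along the characteristic, f is exactly constant, while the truncated profile
and phase relation are constant up to small errors. The final phase τ' nearly solves a relation with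
root τ' = 0, and the lower bound on the slope makes τ' of size ε^N. -/
theorem recoversSolution (h : IsNormalForm w G K Gε Kε) (hκ : ∀ y, (Kε 0 y).1 ≠ 0)
    (hw : ContDiff ℝ ∞ w) (hw0 : ∀ y, w y ≠ 0) (hG : ContDiff ℝ ∞ G) (hK : ContDiff ℝ ∞ K)
    (hΦ : GeneratesFlow G Φ) (hper : ∀ τ y, Φ (τ + 2 * Real.pi) y = Φ τ y)
    (hΨ : GeneratesFlow (fun y => ((Kε 0 y).1)⁻¹ • (Kε 0 y).2) Ψ) {f₀ : Space n → ℝ}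
    {H S : ℕ → ℝ → ℝ → Space n → ℝ} (hH : IsSystemSol Gε Kε 0 f₀ H)
    (hS : IsSystemSol Gε Kε 1 (fun _ => 0) S) : RecoversSolution w G K f₀ H S := by
  intro N C hC
  obtain ⟨T, hT⟩ := hC.exists_bound_of_continuousOn (f := Prod.fst) continuous_fst.continuousOn
  obtain ⟨Q, hQ, ε₁, hε₁, hchar⟩ :=
    exists_confined_characteristic h hκ hw hw0 hG hK hΦ hper hΨ hC (T := |T|)
      fun p hp => (hT p hp).trans (le_abs_self T)
  obtain ⟨A, hA0, hA⟩ := exists_bound_series hK hH.smooth (hH.periodic h hκ hΦ) N |T| hQ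
  -- The phase is followed one order further than in the relation, because the slope is of order ε
  -- and dividing by it costs one power of ε.
  obtain ⟨B, hB0, hB⟩ := exists_bound_series hK hS.smooth (hS.periodic h hκ hΦ) (N + 1) |T| hQ
  obtain ⟨c, hc, r, hr, hslope⟩ := hS.exists_le_phaseSlope h hκ hΦ hG hw hw0 N hQ
  -- The three terms bound the drift of the profile, the replacement of the final phase by 0, and
  -- the last coefficient h_N. The condition ε < 1 bounds the powers of ε, and ε < r gives the slope
  -- estimate.
  refine ⟨|T| * A + (N + 1) * A * ((|T| + 2) * B / c) + A, min (min 1 r) ε₁, by positivity,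
    fun ε hε f hf p hp τ hτ => ?_⟩
  have hε0 := hε.1
  have hε1 : ε < 1 := hε.2.trans_le ((min_le_left _ _).trans (min_le_left _ _))
  have hεr : ε < r := hε.2.trans_le ((min_le_left _ _).trans (min_le_right _ _))
  obtain ⟨γ, hγ0, hγ1, hγ⟩ := hchar ε ⟨hε0, hε.2.trans_le (min_le_right _ _)⟩ p hp τ
  have hpT : |p.1| ≤ |T| := (hT p hp).trans (le_abs_self T)
  have ht : ∀ θ ∈ Icc (0 : ℝ) 1, |(γ θ).1| ≤ |T| := fun θ hθ => by
    rw [hγ1, abs_mul, abs_of_nonneg (sub_nonneg.2 hθ.2)]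
    exact (mul_le_of_le_one_right (abs_nonneg _) (by linarith [hθ.1])).trans hpT
  have h01 : (0 : ℝ) ∈ Icc (0 : ℝ) 1 := ⟨le_rfl, zero_le_one⟩
  have h11 : (1 : ℝ) ∈ Icc (0 : ℝ) 1 := ⟨zero_le_one, le_rfl⟩
  have hAγ : ∀ θ ∈ Icc (0 : ℝ) 1, ∀ k ≤ N, _ := fun θ hθ k hk =>
    hA k hk (γ θ).1 (γ θ).2.1 (γ θ).2.2 (ht θ hθ) (hγ θ hθ).1
  have hBγ : ∀ θ ∈ Icc (0 : ℝ) 1, ∀ k ≤ N + 1, _ := fun θ hθ k hk =>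
    hB k hk (γ θ).1 (γ θ).2.1 (γ θ).2.2 (ht θ hθ) (hγ θ hθ).1
  obtain ⟨τ', y', hγe⟩ : ∃ τ' y', γ 1 = (0, τ', y') :=
    ⟨(γ 1).2.1, (γ 1).2.2, Prod.ext (by simp [hγ1]) rfl⟩
  have hyQ : y' ∈ Q := by
    have := (hγ 1 h11).1
    rwa [hγe] at this
  -- `f` is transported
  have hfγ : f p.1 p.2 = f₀ y' := by
    have h1 := abs_sub_le_of_hasDerivWithinAt h11
      (fun θ hθ => hf.hasDerivWithinAt (hγ θ hθ).2) (B := 0) (by simp)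
    rw [hγ0, hγe, hf.init] at h1
    exact (sub_eq_zero.1 (abs_nonpos_iff.1 h1)).symm
  -- the profile is almost transported
  have hHγ : |partialSum H (N + 1) ε 0 τ' y' - partialSum H (N + 1) ε p.1 τ p.2| ≤
      |T| * A * ε ^ N := by
    have h1 := abs_sub_le_of_hasDerivWithinAt (B := |T| * (ε ^ N * A)) h11
      (fun θ hθ => hH.hasDerivWithinAt_sum h hκ hw0 hε0.ne' N (hγ θ hθ).2) fun θ hθ => by
        rw [zero_mul, ite_self, add_zero, abs_mul, abs_neg, abs_mul, abs_of_pos (pow_pos hε0 N)]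
        have := (hAγ θ hθ N le_rfl).2.1
        gcongr
    rw [hγ0, hγe] at h1
    exact h1.trans (by linarith)
  -- the phase relation is almost transported
  have hSγ : |ε * τ' - partialSum S (N + 1) ε 0 τ' y'| ≤ (|T| + 2) * B * ε ^ (N + 1) := by
    have h1 := abs_sub_le_of_hasDerivWithinAt (B := |T| * (ε ^ (N + 1) * B)) h11
      (V := fun θ => ∑ k ∈ Finset.range (N + 1 + 1), ε ^ k * unc S k (γ θ) - ε * (γ θ).2.1)
      (V' := fun θ => -p.1 * (ε ^ (N + 1) * slowDeriv K S (N + 1) (γ θ)))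
      (fun θ hθ => by
        have hτ : HasDerivWithinAt (fun θ => (γ θ).2.1) (-p.1 * (ε⁻¹ * w (γ θ).2.2)) (Icc 0 1) θ :=
          ((ContinuousLinearMap.fst ℝ ℝ (Space n)) ∘L
            (ContinuousLinearMap.snd ℝ ℝ (ℝ × Space n))).hasFDerivAt.comp_hasDerivWithinAt θ
              (hγ θ hθ).2
        refine ((hS.hasDerivWithinAt_sum h hκ hw0 hε0.ne' (N + 1) (hγ θ hθ).2).fun_sub
          (hτ.const_mul ε)).congr_deriv ?_
        rw [if_neg N.succ_ne_zero]
        have := hε0.ne'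
        field_simp
        ring) fun θ hθ => by
        rw [abs_mul, abs_neg, abs_mul, abs_of_pos (pow_pos hε0 _)]
        have := (hBγ θ hθ (N + 1) le_rfl).2.1
        gcongr
    -- The coefficient of order N + 1 is not part of the relation; removing it at both ends of the
    -- curve accounts for the 2 in |T| + 2.
    have e0 : |unc S (N + 1) (γ 0)| ≤ B := (hBγ 0 h01 (N + 1) le_rfl).1
    have e1 : |unc S (N + 1) (γ 1)| ≤ B := (hBγ 1 h11 (N + 1) le_rfl).1
    have hτ' : ε * τ = ∑ k ∈ Finset.range (N + 1), ε ^ k * unc S k (p.1, τ, p.2) := hτ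
    simp only [Finset.sum_range_succ _ (N + 1), hγ0, hγe] at h1
    rw [hγ0] at e0
    rw [hγe] at e1
    rw [← hτ'] at h1
    have e2 : ε * τ' - partialSum S (N + 1) ε 0 τ' y' =
        ε ^ (N + 1) * unc S (N + 1) (0, τ', y') - ε ^ (N + 1) * unc S (N + 1) (p.1, τ, p.2) -
        (∑ k ∈ Finset.range (N + 1), ε ^ k * unc S k (0, τ', y') +
          ε ^ (N + 1) * unc S (N + 1) (0, τ', y') - ε * τ' -
          (ε * τ + ε ^ (N + 1) * unc S (N + 1) (p.1, τ, p.2) - ε * τ)) := by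
      simp only [partialSum, unc]
      ring
    rw [e2]
    refine (abs_sub _ _).trans ((add_le_add (abs_sub _ _) h1).trans ?_)
    have hp0 := pow_pos hε0 (N + 1)
    rw [abs_mul, abs_mul, abs_of_pos hp0]
    have f0 := mul_le_mul_of_nonneg_left e0 hp0.le
    have f1 := mul_le_mul_of_nonneg_left e1 hp0.le
    linarith
  -- hence the final phase is small
  have hτ' : |τ'| ≤ (|T| + 2) * B / c * ε ^ N := by
    have hd := hS.hasDerivAt_phaseRelation h hκ hΦ hΨ hG N ε 0
    have hge : ∀ s, ε * c ≤ deriv (fun τ => ε * τ - partialSum S (N + 1) ε 0 τ y') s := fun s => by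
      rw [(hd s y').deriv]
      exact mul_le_mul_of_nonneg_left (hslope ε 0 (by rwa [abs_of_pos hε0]) (by simpa using hr) y'
        hyQ s) hε0.le
    -- At t = 0 the phase relation holds exactly at τ = 0, so the residual at τ' is at least εc|τ'|
    -- in absolute value.
    have hmv := mul_sub_le_image_sub_of_le_deriv (fun s => (hd s y').differentiableAt) hge
    have hz : partialSum S (N + 1) ε 0 0 y' = 0 := Finset.sum_eq_zero fun k _ => by
      rw [hS.init, lead, ite_self, mul_zero]
    have key : ε * c * |τ'| ≤ (|T| + 2) * B * ε ^ (N + 1) := by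
      rcases le_total 0 τ' with hp | hp
      · have := hmv hp
        simp only [hz, mul_zero, sub_zero] at this
        rw [abs_of_nonneg hp]
        exact this.trans ((le_abs_self _).trans hSγ)
      · have := hmv hp
        simp only [hz, mul_zero, sub_zero, zero_sub] at this
        rw [abs_of_nonpos hp]
        exact this.trans ((neg_le_abs _).trans hSγ)
    rw [div_mul_eq_mul_div, le_div_iff₀ hc]
    rw [pow_succ] at key
    exact le_of_mul_le_mul_left (by linarith) hε0
  -- comparison at `τ = 0`
  have hinit : |partialSum H (N + 1) ε 0 τ' y' - f₀ y'| ≤ (N + 1) * A * |τ'| := by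
    have hd : ∀ s, HasDerivAt (fun s => partialSum H (N + 1) ε 0 s y')
        (∑ k ∈ Finset.range (N + 1), ε ^ k * fderiv ℝ (unc H k) (0, s, y') (0, 1, 0)) s := fun s =>
      HasDerivAt.fun_sum fun k _ => (hasDerivAt_tau hH.smooth k 0 s y').const_mul _
    have hb : ∀ s, ‖∑ k ∈ Finset.range (N + 1),
        ε ^ k * fderiv ℝ (unc H k) (0, s, y') (0, 1, 0)‖ ≤ (N + 1) * A := fun s => by
      refine (norm_sum_le_of_le _ (f := fun k => ε ^ k * fderiv ℝ (unc H k) (0, s, y') (0, 1, 0))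
        (n := fun _ => A) fun k hk => ?_).trans (by simp)
      have h1 := (hA k (Nat.lt_succ_iff.1 (Finset.mem_range.1 hk)) 0 s y' (by simp) hyQ).2.2
      rw [norm_mul, norm_pow, Real.norm_of_nonneg hε0.le]
      exact (mul_le_of_le_one_left (norm_nonneg _) (pow_le_one₀ hε0.le hε1.le)).trans h1
    have h1 := Convex.norm_image_sub_le_of_norm_hasDerivWithin_le
      (fun s _ => (hd s).hasDerivWithinAt) (fun s _ => hb s) convex_univ (mem_univ 0) (mem_univ τ')
    have h0 : partialSum H (N + 1) ε 0 0 y' = f₀ y' := by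
      rw [partialSum, Finset.sum_range_succ', Finset.sum_eq_zero fun k _ => by
        rw [hH.init, lead, if_neg k.succ_ne_zero, mul_zero]]
      simp [hH.init, lead]
    rwa [h0, sub_zero] at h1
  have hlast : |ε ^ N * H N p.1 τ p.2| ≤ A * ε ^ N := by
    have h1 := (hAγ 0 h01 N le_rfl).1
    rw [hγ0] at h1
    rw [abs_mul, abs_of_pos (pow_pos hε0 N), mul_comm]
    exact mul_le_mul_of_nonneg_right h1 (pow_pos hε0 N).le
  have e : partialSum H (N + 1) ε p.1 τ p.2 = partialSum H N ε p.1 τ p.2 +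
      ε ^ N * H N p.1 τ p.2 := Finset.sum_range_succ _ _
  have hτ'' := mul_le_mul_of_nonneg_left hτ' (by positivity : 0 ≤ ((N : ℝ) + 1) * A)
  have e2 : f p.1 p.2 - partialSum H N ε p.1 τ p.2 =
      -(partialSum H (N + 1) ε 0 τ' y' - f₀ y') +
      (partialSum H (N + 1) ε 0 τ' y' - partialSum H (N + 1) ε p.1 τ p.2) +
      ε ^ N * H N p.1 τ p.2 := by
    rw [hfγ, e]
    ring
  rw [e2]
  refine (abs_add_le _ _).trans ((add_le_add_left (abs_add_le _ _) _).trans ?_)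
  rw [abs_neg]
  linarith

end Expansion

end HighOsc

end

/-! ### The averaging theorem -/

theorem mainTheorem1 (n : ℕ) (w : HighOsc.Space n → ℝ)
    (G K : HighOsc.Space n → HighOsc.Space n) (f₀ : HighOsc.Space n → ℝ)
    (hw : ContDiff ℝ ∞ w) (hw_pos : ∃ c > 0, ∀ y, c ≤ w y)
    (hG : ContDiff ℝ ∞ G) (hK : ContDiff ℝ ∞ K) (hf₀ : ContDiff ℝ ∞ f₀)
    (hper : ∃ Φ : ℝ → HighOsc.Space n → HighOsc.Space n,
      HighOsc.GeneratesFlow G Φ ∧ ∀ τ y, Φ (τ + 2 * Real.pi) y = Φ τ y) :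
    -- the averaged augmented fields exist and are unique
    (∃! P : (ℕ → HighOsc.Space n → ℝ × HighOsc.Space n) ×
        (ℕ → HighOsc.Space n → ℝ × HighOsc.Space n), HighOsc.IsNormalForm w G K P.1 P.2) ∧
    ∀ Gε Kε : ℕ → HighOsc.Space n → ℝ × HighOsc.Space n, HighOsc.IsNormalForm w G K Gε Kε →
      -- the series `Kε₁` does not vanish (it is invertible)
      (∀ y, (Kε 0 y).1 ≠ 0) →
      -- the (formal) field `Kε₂ / Kε₁` has a global flow
      (∃ Ψ : ℝ → HighOsc.Space n → HighOsc.Space n,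
        HighOsc.GeneratesFlow (fun y => ((Kε 0 y).1)⁻¹ • (Kε 0 y).2) Ψ) →
      ∃ h S : ℕ → ℝ → ℝ → HighOsc.Space n → ℝ,
        (HighOsc.IsProfile Gε Kε f₀ h ∧ HighOsc.PeriodicSeries h ∧
          ∀ h', HighOsc.IsProfile Gε Kε f₀ h' → h' = h) ∧
        (HighOsc.IsPhase Gε Kε S ∧ HighOsc.PeriodicSeries S ∧
          ∀ S', HighOsc.IsPhase Gε Kε S' → S' = S) ∧
        HighOsc.PhaseSolvable S ∧ HighOsc.RecoversSolution w G K f₀ h S := by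
  obtain ⟨c, hc, hcw⟩ := hw_pos
  have hw0 : ∀ y, w y ≠ 0 := fun y => (hc.trans_le (hcw y)).ne'
  obtain ⟨Φ, hΦ, hΦper⟩ := hper
  have hΦ2 : ∀ y, Φ (2 * Real.pi) y = y := fun y => by
    rw [← zero_add (2 * Real.pi), hΦper, hΦ.init]
  constructor
  · obtain ⟨Gε, Kε, h⟩ := HighOsc.exists_isNormalForm hw hw0 hG hK hΦ hΦ2
    refine ⟨(Gε, Kε), h, fun P hP => ?_⟩
    obtain ⟨h1, h2⟩ := HighOsc.IsNormalForm.unique hΦ hP h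
    exact Prod.ext h1 h2
  · rintro Gε Kε h hκ ⟨Ψ, hΨ⟩
    obtain ⟨H, hH⟩ := HighOsc.exists_isSystemSol h hκ hΦ hΨ 0 hf₀
    obtain ⟨S, hS⟩ := HighOsc.exists_isSystemSol h hκ hΦ hΨ 1 (u₀ := fun _ => 0) contDiff_const
    exact ⟨H, S,
      ⟨HighOsc.isProfile_iff.2 hH, hH.periodic h hκ hΦ,
        fun H' hH' => HighOsc.IsSystemSol.unique h hκ hΦ hΨ hH (HighOsc.isProfile_iff.1 hH')⟩,
      ⟨HighOsc.isPhase_iff.2 hS, hS.periodic h hκ hΦ,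
        fun S' hS' => HighOsc.IsSystemSol.unique h hκ hΦ hΨ hS (HighOsc.isPhase_iff.1 hS')⟩,
      hS.phaseSolvable h hκ hΦ hΨ hG hw hw0,
      HighOsc.recoversSolution h hκ hw hw0 hG hK hΦ hΦper hΨ hH hS⟩
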